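/- Let $K$ be an algebraically closed field with $\operatorname{char}K\neq 2$, let $n\ge 4$, let $Q$ be the quiver with vertices $1,\dots,n$ and arrows $n\to n-2$, $n-1\to n-2$ and $b+1\to b$ for $1\le b\le n-3$ (the linearly oriented quiver of type $D_n$), and let $H=KQ$, so that $\operatorname{mod}H$ is the category of finite-dimensional representations of $Q$. Let $P(j)$ be the indecomposable projective representation whose space at $v$ has the paths from $j$ to $v$ as a basis, let $\tau^{-1}$ be the inverse Auslander–Reiten translate (so $\tau^{-1}M$ is the right end term of the almost split sequence starting at $M$), and call $(p,j)$ the vertex of the Auslander–Reiten quiver of $H$ given by $\tau^{-p}P(j)$. Let $M_i$ and $M_\beta$ be indecomposable $H$-modules with $\dim_K\operatorname{Ext}^1_H(M_\beta,M_i)=2$. Then there are integers $k\ge 0$ and $1\le r<s\le i\le n-2$ with $k+s\le n-2$ such that $M_i$ is the vertex $(k,i)$ and $M_\beta$ is the vertex $(k+s,\;n-1-(s-r))$. Moreover, let - $A_1,A_2$ be the vertices $(k,n-1)$ and $(k,n)$, - $B_1,B_2$ be the vertices $(k+r,n-1)$ and $(k+r,n)$, - $X$ be the vertex $(k+r,\;n-1-r)$,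 - $X_1$ be the vertex $(k+s,\;n-1-s)$ and $X_2$ the vertex $(k+r,\;i-r)$, - $X_3$ be the vertex $(k+s,\;i-s)$ if $s<i$, and $X_3=0$ if $s=i$. Then a module $Y$ is the middle term of a non-split exact sequence $0\to M_i\to Y\to M_\beta\to 0$ if and only if it is isomorphic to one of the following four modules: - (s1) $A_1\oplus B_1\oplus X_3$ if $r$ is odd, and $A_1\oplus B_2\oplus X_3$ if $r$ is even; - (s2) $A_2\oplus B_2\oplus X_3$ if $r$ is odd, and $A_2\oplus B_1\oplus X_3$ if $r$ is even; - (s3) $X_1\oplus X_2$; - (s4) $X\oplus X_3$. -/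

import Mathlib

open CategoryTheory CategoryTheory.Limits

universe u

/-- The vertices `1, 2, …, n` of the quiver of type `D_n`. -/
@[ext]
structure DVertex (n : ℕ) where
  label : ℕ
  one_le : 1 ≤ label
  le_n : label ≤ n

/-- The arrows of the linearly oriented quiver of type `D_n`: one arrow `b + 1 ⟶ b` for each
`1 ≤ b ≤ n - 2`, and one arrow `n ⟶ n - 2`. So `n - 1` and `n` are the sources, both with an
arrow to `n - 2`, followed by the linear arm `n - 2 ⟶ n - 3 ⟶ ⋯ ⟶ 1`. -/
def DVertex.IsArrow {n : ℕ} (a b : DVertex n) : Prop :=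
  (a.label = b.label + 1 ∧ a.label < n) ∨ (a.label = n ∧ b.label + 2 = n)

instance DVertex.quiver (n : ℕ) : Quiver (DVertex n) where
  Hom a b := PLift (DVertex.IsArrow a b)

/-- The category of `K`-linear representations of the linearly oriented quiver `Q` of type `D_n`,
equivalently of modules over the path algebra `H = K Q`: functors from the free category on `Q`
to `K`-vector spaces. -/
abbrev DRep (K : Type u) [Field K] (n : ℕ) : Type (u + 1) :=
  Paths (DVertex n) ⥤ ModuleCat.{u} K

instance DRep.hasExt (K : Type u) [Field K] (n : ℕ) : HasExt.{u + 1} (DRep K n) :=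
  HasExt.standard _

namespace DRep

variable {K : Type u} [Field K] {n : ℕ}

/-- The representations belonging to `mod H`: those that are finite dimensional at every vertex
(there are finitely many vertices). -/
def IsFinDim (M : DRep K n) : Prop :=
  ∀ v, Module.Finite K (M.obj v)

/-- The indecomposable projective `P(j)`: its space at `v` has the paths from `j` to `v` as a
basis, and an arrow acts by extending paths. -/
noncomputable def proj (K : Type u) [Field K] {n : ℕ} (j : DVertex n) : DRep K n where
  obj v := ModuleCat.of K (((Paths.of (DVertex n)).obj j ⟶ v) →₀ K)
  map f := ModuleCat.ofHom (Finsupp.lmapDomain K K (fun p => p ≫ f))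
  map_id v := by
    ext x
    simp
  map_comp f g := by
    ext x
    simp

/-- `0 → M → Y → N → 0` for some maps that make it exact and not split: `Y` is the middle term
of a non-split extension of `N` by `M`. -/
def IsNonsplitMiddleTerm (M Y N : DRep K n) : Prop :=
  ∃ (f : M ⟶ Y) (g : Y ⟶ N) (w : f ≫ g = 0),
    (ShortComplex.mk f g w).ShortExact ∧ IsEmpty (ShortComplex.mk f g w).Splitting

/-- Almost split (Auslander-Reiten) sequences in `mod H`: a short exact sequence of finite
dimensional representations that is not split, has indecomposable end terms, and is such that every
map in `mod H` to the right end term that is not a split epimorphism factors through the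
middle term. -/
structure IsAlmostSplit (S : ShortComplex (DRep K n)) : Prop where
  shortExact : S.ShortExact
  finDim_left : IsFinDim S.X₁
  finDim_right : IsFinDim S.X₃
  indecomposable_left : Indecomposable S.X₁
  indecomposable_right : Indecomposable S.X₃
  not_split : IsEmpty S.Splitting
  lift : ∀ (W : DRep K n), IsFinDim W → ∀ h : W ⟶ S.X₃, ¬ IsSplitEpi h →
    ∃ l : W ⟶ S.X₂, l ≫ S.g = h

/-- `AtPosition p j N`: the representation `N` is the vertex `(p, j)` of the Auslander-Reiten
quiver, that is `N ≅ τ⁻ᵖ P(j)`, where the inverse Auslander-Reiten translate `τ⁻¹ M` of an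
indecomposable `M` is the right end term of an almost split sequence with left end term `M`. -/
def AtPosition : ℕ → ℕ → DRep K n → Prop
  | 0, j, N => ∃ v : DVertex n, v.label = j ∧ Nonempty (N ≅ proj K v)
  | p + 1, j, N => ∃ S : ShortComplex (DRep K n),
      IsAlmostSplit S ∧ AtPosition p j S.X₁ ∧ Nonempty (N ≅ S.X₃)

end DRep

/-! The quiver is a tree, so there is at most one path between two vertices and explicit models
suffice. With the convention P(0) = 0, they are P(t)/P(a) (`thin`) and (P(n-1) ⊕ P(n))/(P(a) ⊕ P(b))
for a < b ≤ n-2 (`dbl`). In the second one the generators x at n-1 and y at n satisfy x = y at the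
vertex b and x = 0 at the vertex a. These models, when nonzero, are bricks: their endomorphisms are
scalars.

Positions. If P₁ → P₀ presents C, then τC is the kernel of the map νP₁ → νP₀ of injectives given by
the same matrix. For a brick C, pulling that map back along a suitable C → νP₀ yields an almost
split sequence (`Mat.Presents.exists_isAlmostSplit`). Computing the kernels shows that τ lowers a
and t, or a and b, by one, exchanges the two sources, and turns `dbl` with a = 0 into a `thin`
module. Induction then gives `atPosition_thin`, `atPosition_thin_source` and `atPosition_dbl`.

Classification. A brick Z with maps Z → M → Z of nonzero composite is isomorphic to every
indecomposable M that admits such maps. A suitable vector and functional in M produce these maps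
with Z one of the models (`exists_iso_of_indecomposable`). Bounding Ext¹(C, N) by the cokernel of
Hom(P₀, N) → Hom(P₁, N) leaves two families of pairs with a two-dimensional Ext¹
(`exists_iso_of_finrank_ext`).

Middle terms. An element α of Hom(P₁, N) determines the middle term up to isomorphism, and only its
class modulo Hom(P₀, N) matters. In both families the classes form a plane with coordinates l, m.
The lines l = 0, m = 0 and l + m = 0 each have their own middle term, and all other nonzero classes
share a fourth one. Away from l + m = 0, the middle term is a fixed summand plus a module with two
generators p, q subject to lp + mq = 0 from a certain vertex on (`IsPencil`); it decomposes exactly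
when l or m vanishes. Since the characteristic is not 2, the class l = m = 1 lies off all three
lines. The argument is `isNonsplitMiddleTerm_iff_of_pencil`; the parity of r in the statement only
records how τ permutes the two sources (`exists_summands`). -/

namespace DRep

/-! ### Paths in the quiver -/

/-- The vertices of the quiver, as objects of the path category. -/
abbrev Vert (n : ℕ) : Type := Paths (DVertex n)

/-- The label of a vertex. -/
def lab {n : ℕ} (v : Vert n) : ℕ := DVertex.label (show DVertex n from v)

variable {n : ℕ}

lemma one_le_lab (v : Vert n) : 1 ≤ lab v := DVertex.one_le (show DVertex n from v)

lemma lab_le (v : Vert n) : lab v ≤ n := DVertex.le_n (show DVertex n from v)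

lemma lab_injective : Function.Injective (lab (n := n)) := fun _ _ h => DVertex.ext h

lemma exists_lab {j : ℕ} (h1 : 1 ≤ j) (h2 : j ≤ n) : ∃ v : Vert n, lab v = j :=
  ⟨(⟨j, h1, h2⟩ : DVertex n), rfl⟩

noncomputable instance : Fintype (Vert n) :=
  Fintype.ofInjective (fun v => (⟨lab v, Nat.lt_succ_of_le (lab_le v)⟩ : Fin (n + 1)))
    fun _ _ h => lab_injective (congrArg Fin.val h)

/-- `reach v w` means that there is a path from `v` to `w`. -/
def reach (v w : Vert n) : Prop := Nonempty (v ⟶ w)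

lemma reach_refl (v : Vert n) : reach v v := ⟨𝟙 v⟩

lemma reach.trans {v w x : Vert n} (h : reach v w) (h' : reach w x) : reach v x :=
  ⟨h.some ≫ h'.some⟩

/-- Every arrow lowers the label and ends at a label at most n-2, so n-1 and n are reached only by
their trivial paths. -/
lemma hom_spec {v w : Vert n} (p : v ⟶ w) : w = v ∨ (lab w < lab v ∧ lab w + 2 ≤ n) := by
  induction p using Paths.induction_fixed_source with
  | id => exact Or.inl rfl
  | @comp a b p q ih =>
    right
    have hq : DVertex.IsArrow a b := q.down
    have hb : lab ((Paths.of _).obj b) = b.label := rfl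
    have ha : lab ((Paths.of _).obj a) = a.label := rfl
    have h1 := a.le_n
    rcases ih with h | ⟨h, h'⟩
    · rw [← h, ha, hb]
      rcases hq with hq | hq <;> omega
    · rw [ha] at h h'
      rw [hb]
      rcases hq with hq | hq <;> omega

lemma reach_iff {v w : Vert n} : reach v w ↔ w = v ∨ (lab w < lab v ∧ lab w + 2 ≤ n) := by
  refine ⟨fun h => hom_spec h.some, ?_⟩
  rintro (rfl | ⟨h, h'⟩)
  · exact reach_refl _
  · obtain ⟨d, hd⟩ : ∃ d, lab v = lab w + 1 + d := ⟨lab v - lab w - 1, by omega⟩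
    induction d generalizing w with
    | zero =>
      by_cases hv : lab v < n
      · exact ⟨(Paths.of (DVertex n)).map (show (show DVertex n from v) ⟶ (show DVertex n from w)
          from ⟨Or.inl ⟨hd, hv⟩⟩)⟩
      · omega
    | succ d ih =>
      obtain ⟨x, hx⟩ := exists_lab (n := n) (j := lab w + 1) (by omega)
        (by omega)
      have hxw : ∀ y : Vert n, DVertex.IsArrow (show DVertex n from y) (show DVertex n from w) →
          reach y w := fun y hy =>
        ⟨(Paths.of (DVertex n)).map (show (show DVertex n from y) ⟶ (show DVertex n from w)
          from ⟨hy⟩)⟩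
      -- At the fork the intermediate vertex n-1 is of no use, since n does not reach it; there `v`
      -- is n and has its own arrow to n-2.
      by_cases hw : lab w + 2 = n
      · have := lab_le v
        exact hxw v (Or.inr ⟨by change lab v = n; omega, hw⟩)
      · exact (ih (w := x) (by omega) (by omega) (by omega)).trans
          (hxw x (Or.inl ⟨hx, by change lab x < n; omega⟩))

lemma reach.lab_le {v w : Vert n} (h : reach v w) : lab w ≤ lab v := by
  rcases reach_iff.1 h with rfl | h
  · exact le_rfl
  · exact h.1.le

lemma reach_of_lt {v w : Vert n} (h : lab w < lab v) (h' : lab w + 2 ≤ n) : reach v w :=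
  reach_iff.2 (Or.inr ⟨h, h'⟩)

/-- The last arrow is forced by its target, except at n-2, where it comes from n-1 or n; these are
sources, so the start of the path decides. -/
lemma path_ext {v w : DVertex n} (p q : Quiver.Path v w) : p = q := by
  induction p with
  | nil =>
    cases q with
    | nil => rfl
    | @cons b _ q e =>
      exfalso
      have h1 := (show reach (v : Vert n) b from ⟨q⟩).lab_le
      have h2 : reach (b : Vert n) v := ⟨(Paths.of _).map e⟩
      have h3 : DVertex.IsArrow b v := e.down
      have h4 := h2.lab_le
      have h5 : b.label = v.label := le_antisymm h1 h4
      have := b.le_n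
      rcases h3 with h3 | h3 <;> omega
  | @cons b c p e ih =>
    cases q with
    | nil =>
      exfalso
      have h1 := (show reach (v : Vert n) b from ⟨p⟩).lab_le
      have h3 : DVertex.IsArrow b v := e.down
      change b.label ≤ v.label at h1
      have := b.le_n
      rcases h3 with h3 | h3 <;> omega
    | @cons b' _ q e' =>
      have h3 : DVertex.IsArrow b c := e.down
      have h4 : DVertex.IsArrow b' c := e'.down
      have h1 := hom_spec (v := v) (w := b) p
      have h2 := hom_spec (v := v) (w := b') q
      have hb : b = b' := by
        change b = v ∨ (b.label < v.label ∧ b.label + 2 ≤ n) at h1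
        change b' = v ∨ (b'.label < v.label ∧ b'.label + 2 ≤ n) at h2
        rcases h1 with h1 | h1
        · rcases h2 with h2 | h2
          · rw [h1, h2]
          · have := v.le_n
            rw [h1] at h3
            rcases h3 with h3 | h3 <;> rcases h4 with h4 | h4 <;> omega
        · rcases h2 with h2 | h2
          · have := v.le_n
            rw [h2] at h4
            rcases h3 with h3 | h3 <;> rcases h4 with h4 | h4 <;> omega
          · ext
            rcases h3 with h3 | h3 <;> rcases h4 with h4 | h4 <;> omega
      subst hb
      rw [ih q, show e = e' from Subsingleton.elim (α := PLift (DVertex.IsArrow b c)) e e']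

instance (v w : Vert n) : Subsingleton (v ⟶ w) := ⟨fun p q => path_ext p q⟩

/-! ### Representations and morphisms in terms of elements -/

variable {K : Type u} [Field K]

/-- The structure map of a representation along the unique path from `v` to `w`, and zero if
there is no such path. -/
noncomputable def res (M : DRep K n) (v w : Vert n) : M.obj v →ₗ[K] M.obj w :=
  open Classical in if h : reach v w then (M.map h.some).hom else 0

lemma res_eq_map (M : DRep K n) {v w : Vert n} (p : v ⟶ w) : res M v w = (M.map p).hom := by
  rw [res, dif_pos ⟨p⟩, Subsingleton.elim (Nonempty.some _) p]

lemma res_self (M : DRep K n) (v : Vert n) (x : M.obj v) : res M v v x = x := by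
  rw [res_eq_map M (𝟙 v)]; simp

lemma res_res (M : DRep K n) {v w x : Vert n} (h : reach v w) (h' : reach w x) (m : M.obj v) :
    res M w x (res M v w m) = res M v x m := by
  rw [res_eq_map M h.some, res_eq_map M h'.some, res_eq_map M (h.some ≫ h'.some)]; simp

lemma res_of_not (M : DRep K n) {v w : Vert n} (h : ¬ reach v w) (m : M.obj v) :
    res M v w m = 0 := by
  rw [res, dif_neg h]; rfl

lemma app_res {M N : DRep K n} (f : M ⟶ N) (v w : Vert n) (m : M.obj v) :
    f.app w (res M v w m) = res N v w (f.app v m) := by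
  by_cases h : reach v w
  · rw [res_eq_map M h.some, res_eq_map N h.some]
    exact congrArg (fun g => g.hom m) (f.naturality h.some)
  · rw [res_of_not _ h, res_of_not _ h, map_zero]

/-- A family of linear maps that commutes with the structure maps is a morphism. -/
noncomputable def mkHom {M N : DRep K n} (f : ∀ v, M.obj v →ₗ[K] N.obj v)
    (hf : ∀ v w, reach v w → ∀ m, f w (res M v w m) = res N v w (f v m)) : M ⟶ N where
  app v := ModuleCat.ofHom (f v)
  naturality v w p := by
    ext m
    have := hf v w ⟨p⟩ m
    rw [res_eq_map M p, res_eq_map N p] at this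
    exact this

@[simp] lemma mkHom_app {M N : DRep K n} (f : ∀ v, M.obj v →ₗ[K] N.obj v) (hf) (v : Vert n)
    (m : M.obj v) : (mkHom f hf : M ⟶ N).app v m = f v m := rfl

lemma hom_ext' {M N : DRep K n} {f g : M ⟶ N} (h : ∀ v (m : M.obj v), f.app v m = g.app v m) :
    f = g := by
  ext v m
  exact h v m

@[simp] lemma smul_app_apply {M N : DRep K n} (c : K) (f : M ⟶ N) (v : Vert n) (m : M.obj v) :
    (c • f).app v m = c • f.app v m := rfl

@[simp] lemma add_app_apply {M N : DRep K n} (f g : M ⟶ N) (v : Vert n) (m : M.obj v) :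
    (f + g).app v m = f.app v m + g.app v m := rfl

@[simp] lemma sub_app_apply {M N : DRep K n} (f g : M ⟶ N) (v : Vert n) (m : M.obj v) :
    (f - g).app v m = f.app v m - g.app v m := rfl

@[simp] lemma zero_app_apply {M N : DRep K n} (v : Vert n) (m : M.obj v) :
    (0 : M ⟶ N).app v m = 0 := rfl

lemma mono_of_injective {M N : DRep K n} (f : M ⟶ N) (h : ∀ v, Function.Injective (f.app v)) :
    Mono f := by
  have : ∀ v, Mono (f.app v) := fun v => (ModuleCat.mono_iff_injective _).2 (h v)
  exact NatTrans.mono_of_mono_app f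

lemma injective_of_mono {M N : DRep K n} (f : M ⟶ N) [Mono f] (v : Vert n) :
    Function.Injective (f.app v) :=
  (ModuleCat.mono_iff_injective _).1 inferInstance

lemma epi_of_surjective {M N : DRep K n} (f : M ⟶ N) (h : ∀ v, Function.Surjective (f.app v)) :
    Epi f := by
  have : ∀ v, Epi (f.app v) := fun v => (ModuleCat.epi_iff_surjective _).2 (h v)
  exact NatTrans.epi_of_epi_app f

lemma surjective_of_epi {M N : DRep K n} (f : M ⟶ N) [Epi f] (v : Vert n) :
    Function.Surjective (f.app v) :=
  (ModuleCat.epi_iff_surjective _).1 inferInstance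

/-! ### Coordinate models of representations -/

/-- Linear coordinate subspaces with truncation maps between them. -/
structure Shape (K : Type u) [Field K] (n : ℕ) (ι : Type) where
  space : Vert n → Submodule K (ι → K)
  alive : Vert n → ι → Prop
  trunc_mem : ∀ v w, reach v w → ∀ x ∈ space v,
    (open Classical in fun i => if alive w i then x i else 0) ∈ space w
  eq_zero : ∀ v, ∀ x ∈ space v, ∀ i, ¬ alive v i → x i = 0
  alive_of_reach : ∀ v w, reach v w → ∀ i, alive w i → alive v i

namespace Shape

variable {ι : Type} (S : Shape K n ι)

open Classical in
/-- The coordinatewise truncation at the vertex `w`. -/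
noncomputable def trunc (w : Vert n) : (ι → K) →ₗ[K] (ι → K) where
  toFun x i := if S.alive w i then x i else 0
  map_add' x y := by ext i; by_cases h : S.alive w i <;> simp [h]
  map_smul' c x := by ext i; by_cases h : S.alive w i <;> simp [h]

open Classical in
lemma trunc_apply (w : Vert n) (x : ι → K) (i : ι) :
    S.trunc w x i = if S.alive w i then x i else 0 := rfl

lemma trunc_eq_self {v : Vert n} {x : ι → K} (hx : x ∈ S.space v) : S.trunc v x = x := by
  ext i
  by_cases h : S.alive v i
  · simp [trunc_apply, h]
  · simp [trunc_apply, h, S.eq_zero v x hx i h]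

/-- The representation defined by a shape. -/
noncomputable def rep : DRep K n where
  obj v := ModuleCat.of K (S.space v)
  map {v w} p := ModuleCat.ofHom ((S.trunc w).restrict (fun x hx => S.trunc_mem v w ⟨p⟩ x hx))
  map_id v := by
    refine ModuleCat.hom_ext (LinearMap.ext fun x => Subtype.ext ?_)
    exact S.trunc_eq_self (Subtype.property (show S.space v from x))
  map_comp {v w x} p q := by
    refine ModuleCat.hom_ext (LinearMap.ext fun y => Subtype.ext ?_)
    obtain ⟨y, hy⟩ := (show S.space v from y)
    change S.trunc x y = S.trunc x (S.trunc w y)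
    ext i
    by_cases h : S.alive x i
    · simp [trunc_apply, h, S.alive_of_reach w x ⟨q⟩ i h]
    · simp [trunc_apply, h]

/-- The coordinates of an element. -/
def coord (v : Vert n) : S.rep.obj v →ₗ[K] (ι → K) := (S.space v).subtype

/-- The element with given coordinates. -/
def elt (v : Vert n) (x : ι → K) (hx : x ∈ S.space v) : S.rep.obj v :=
  (⟨x, hx⟩ : S.space v)

@[simp] lemma coord_elt (v : Vert n) (x : ι → K) (hx : x ∈ S.space v) :
    S.coord v (S.elt v x hx) = x := rfl

lemma coord_mem (v : Vert n) (x : S.rep.obj v) : S.coord v x ∈ S.space v :=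
  Subtype.property (show S.space v from x)

lemma coord_injective (v : Vert n) : Function.Injective (S.coord v) := Subtype.val_injective

lemma coord_res {v w : Vert n} (h : reach v w) (x : S.rep.obj v) :
    S.coord w (res S.rep v w x) = S.trunc w (S.coord v x) := by
  rw [res_eq_map _ h.some]
  rfl

lemma isFinDim [Finite ι] : IsFinDim S.rep := fun v =>
  inferInstanceAs (Module.Finite K (S.space v))

/-- The morphism to a shape representation given by coordinate maps. -/
noncomputable def lift {W : DRep K n} (f : ∀ v, W.obj v →ₗ[K] (ι → K))
    (hf : ∀ v m, f v m ∈ S.space v)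
    (hres : ∀ v w, reach v w → ∀ m, f w (res W v w m) = S.trunc w (f v m)) : W ⟶ S.rep :=
  mkHom (fun v => ((f v).codRestrict (S.space v) (hf v) : W.obj v →ₗ[K] S.space v))
    (fun v w h m => S.coord_injective w (by
      rw [S.coord_res h]
      exact hres v w h m))

@[simp] lemma coord_lift {W : DRep K n} (f : ∀ v, W.obj v →ₗ[K] (ι → K)) (hf) (hres)
    (v : Vert n) (m : W.obj v) : S.coord v ((S.lift f hf hres).app v m) = f v m := rfl

end Shape

end DRep

/-! ### Bricks -/

namespace DRep

variable {n : ℕ} {K : Type u} [Field K]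

/-- If every endomorphism of a nonzero representation is a scalar, it is indecomposable. -/
def IsBrick (Z : DRep K n) : Prop :=
  ¬ IsZero Z ∧ ∀ f : Z ⟶ Z, ∃ c : K, f = c • 𝟙 Z

/-- The projection onto a summand is a scalar c. If c = 0 the first summand vanishes; otherwise the
second does, being killed by c. -/
lemma IsBrick.indecomposable {Z : DRep K n} (h : IsBrick Z) : Indecomposable Z := by
  refine ⟨h.1, fun X Y e => ?_⟩
  obtain ⟨c, hc⟩ := h.2 (e.hom ≫ biprod.fst ≫ biprod.inl ≫ e.inv)
  have h1 : biprod.inr ≫ e.inv ≫ (c • 𝟙 Z) = 0 := by rw [← hc]; simp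
  have h2 : biprod.inl ≫ e.inv ≫ (c • 𝟙 Z) ≫ e.hom ≫ biprod.fst = 𝟙 X := by rw [← hc]; simp
  by_cases hc0 : c = 0
  · left
    rw [hc0] at h2
    simp only [zero_smul, zero_comp, comp_zero] at h2
    exact (IsZero.iff_id_eq_zero _).2 h2.symm
  · right
    rw [Linear.comp_smul, Category.comp_id, Linear.comp_smul] at h1
    have h3 : biprod.inr ≫ e.inv = 0 := (smul_eq_zero.1 h1).resolve_left hc0
    have h4 : (biprod.inr ≫ e.inv) ≫ e.hom ≫ biprod.snd = 𝟙 Y := by simp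
    rw [h3, zero_comp] at h4
    exact (IsZero.iff_id_eq_zero _).2 h4.symm

/-- A split monomorphism has its cokernel as a complement, and indecomposability makes that cokernel
zero. -/
lemma nonempty_iso_of_retract {M Z : DRep K n} (hM : Indecomposable M) (hZ : ¬ IsZero Z)
    (i : Z ⟶ M) (p : M ⟶ Z) (h : i ≫ p = 𝟙 Z) : Nonempty (M ≅ Z) := by
  have : Mono i := by
    have : Mono (i ≫ p) := by rw [h]; infer_instance
    exact mono_of_mono i p
  let S : ShortComplex (DRep K n) := ShortComplex.mk i (cokernel.π i) (by simp)
  have hS : S.Exact := ShortComplex.exact_of_g_is_cokernel _ (cokernelIsCokernel i)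
  have s : S.Splitting := ShortComplex.Splitting.ofExactOfRetraction S hS p h
    (by dsimp [S]; infer_instance)
  rcases hM.2 Z (cokernel i) s.isoBinaryBiproduct with h0 | h0
  · exact absurd h0 hZ
  · have : Epi i := Preadditive.epi_of_isZero_cokernel i h0
    have : IsIso i := isIso_of_mono_of_epi i
    exact ⟨(asIso i).symm⟩

/-- This is the recognition criterion behind the classification: the composite is a nonzero scalar,
so rescaling exhibits Z as a retract. -/
lemma IsBrick.nonempty_iso {M Z : DRep K n} (hZ : IsBrick Z) (hM : Indecomposable M)
    (i : Z ⟶ M) (p : M ⟶ Z) (h : i ≫ p ≠ 0) : Nonempty (M ≅ Z) := by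
  obtain ⟨c, hc⟩ := hZ.2 (i ≫ p)
  have hc0 : c ≠ 0 := fun h0 => h (by rw [hc, h0, zero_smul])
  refine nonempty_iso_of_retract hM hZ.1 i (c⁻¹ • p) ?_
  rw [Linear.comp_smul, hc, smul_smul, inv_mul_cancel₀ hc0, one_smul]

/-! ### Sums of projectives and of injectives -/

/-- The shape of a direct sum of projectives. -/
def projShape (K : Type u) [Field K] {κ : Type} (t : κ → Vert n) : Shape K n κ where
  space v := ⨅ k, ⨅ (_ : ¬ reach (t k) v), LinearMap.ker (LinearMap.proj k)
  alive _ _ := True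
  trunc_mem v w h x hx := by
    simp only [Submodule.mem_iInf, LinearMap.mem_ker, LinearMap.proj_apply] at hx ⊢
    intro k hk
    simpa using hx k fun h' => hk (h'.trans h)
  eq_zero _ _ _ _ h := absurd trivial h
  alive_of_reach _ _ _ _ _ := trivial

lemma mem_projShape {κ : Type} {t : κ → Vert n} {v : Vert n} {x : κ → K} :
    x ∈ (projShape K t).space v ↔ ∀ k, ¬ reach (t k) v → x k = 0 := by
  simp [projShape, Submodule.mem_iInf]

/-- The direct sum of the projectives `P(t k)`. -/
noncomputable abbrev projFam (K : Type u) [Field K] {κ : Type} (t : κ → Vert n) : DRep K n :=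
  (projShape K t).rep

lemma projShape_coord_res {κ : Type} {t : κ → Vert n} {v w : Vert n} (h : reach v w)
    (x : (projFam K t).obj v) :
    (projShape K t).coord w (res _ v w x) = (projShape K t).coord v x := by
  rw [Shape.coord_res _ h]
  ext i
  simp [Shape.trunc_apply, projShape]

section

variable {κ : Type} [Fintype κ] (t : κ → Vert n)

open Classical in
/-- The generators of a direct sum of projectives. -/
noncomputable def projGen (k : κ) : (projFam K t).obj (t k) :=
  (projShape K t).elt (t k) (Pi.single k 1) (mem_projShape.2 fun k' h => by
    rw [Pi.single_eq_of_ne]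
    rintro rfl
    exact h (reach_refl _))

/-- The morphism from a direct sum of projectives with given values on the generators. -/
noncomputable def projHom {W : DRep K n} (m : ∀ k, W.obj (t k)) : projFam K t ⟶ W :=
  mkHom (fun v => ∑ k, ((LinearMap.proj k).comp ((projShape K t).coord v)).smulRight
      (res W (t k) v (m k))) (fun v w h x => by
    simp only [LinearMap.sum_apply, LinearMap.smulRight_apply, LinearMap.comp_apply,
      LinearMap.proj_apply, map_sum, map_smul, projShape_coord_res h]
    refine Finset.sum_congr rfl fun k _ => ?_
    by_cases hk : reach (t k) v
    · rw [res_res _ hk h]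
    · rw [mem_projShape.1 ((projShape K t).coord_mem v x) k hk, zero_smul, zero_smul])

lemma projHom_apply {W : DRep K n} (m : ∀ k, W.obj (t k)) (v : Vert n) (x : (projFam K t).obj v) :
    (projHom t m).app v x = ∑ k, (projShape K t).coord v x k • res W (t k) v (m k) := by
  change (∑ k, ((LinearMap.proj k).comp ((projShape K t).coord v)).smulRight
      (res W (t k) v (m k))) x = _
  simp

@[simp] lemma projHom_gen {W : DRep K n} (m : ∀ k, W.obj (t k)) (k : κ) :
    (projHom t m).app (t k) (projGen t k) = m k := by
  classical
  rw [projHom_apply, Finset.sum_eq_single k]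
  · simp [projGen, res_self]
  · intro k' _ hk
    simp [projGen, Pi.single_eq_of_ne hk]
  · simp

lemma projFam_eq_sum (v : Vert n) (x : (projFam K t).obj v) :
    x = ∑ k, (projShape K t).coord v x k • res _ (t k) v (projGen t k) := by
  classical
  refine (projShape K t).coord_injective v (funext fun i => ?_)
  rw [map_sum, Finset.sum_apply, Finset.sum_eq_single i]
  · by_cases hk : reach (t i) v
    · rw [map_smul, Pi.smul_apply, projShape_coord_res hk]
      simp [projGen]
    · simp [mem_projShape.1 ((projShape K t).coord_mem v x) i hk]
  · intro k _ hk
    by_cases h : reach (t k) v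
    · rw [map_smul, Pi.smul_apply, projShape_coord_res h]
      simp [projGen, Pi.single_eq_of_ne hk.symm]
    · simp [mem_projShape.1 ((projShape K t).coord_mem v x) k h]
  · simp

lemma projHom_ext {W : DRep K n} {f g : projFam K t ⟶ W}
    (h : ∀ k, f.app (t k) (projGen t k) = g.app (t k) (projGen t k)) : f = g := by
  refine hom_ext' fun v x => ?_
  rw [projFam_eq_sum t v x, map_sum, map_sum]
  refine Finset.sum_congr rfl fun k _ => ?_
  rw [map_smul, map_smul, app_res, app_res, h]

instance : Projective (projFam K t) where
  factors {E X} f e _ := by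
    choose m hm using fun k => surjective_of_epi e (t k) (f.app (t k) (projGen t k))
    refine ⟨projHom t m, projHom_ext t fun k => ?_⟩
    change e.app _ ((projHom t m).app _ (projGen t k)) = _
    rw [projHom_gen, hm]

end

/-- The shape of a direct sum of injectives. -/
def injShape (K : Type u) [Field K] {ι : Type} (r : ι → Vert n) : Shape K n ι where
  space v := ⨅ i, ⨅ (_ : ¬ reach v (r i)), LinearMap.ker (LinearMap.proj i)
  alive v i := reach v (r i)
  trunc_mem v w h x hx := by
    simp only [Submodule.mem_iInf, LinearMap.mem_ker, LinearMap.proj_apply] at hx ⊢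
    intro k hk
    simp [hk]
  eq_zero v x hx i h := by
    simp only [Submodule.mem_iInf, LinearMap.mem_ker, LinearMap.proj_apply] at hx
    exact hx i h
  alive_of_reach v w h i h' := h.trans h'

lemma mem_injShape {ι : Type} {r : ι → Vert n} {v : Vert n} {x : ι → K} :
    x ∈ (injShape K r).space v ↔ ∀ i, ¬ reach v (r i) → x i = 0 := by
  simp [injShape, Submodule.mem_iInf]

/-- The direct sum of the injectives `I(r i)`. -/
noncomputable abbrev injFam (K : Type u) [Field K] {ι : Type} (r : ι → Vert n) : DRep K n :=
  (injShape K r).rep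

/-- The morphism to a direct sum of injectives given by functionals. -/
noncomputable def injLift {ι : Type} (r : ι → Vert n) {W : DRep K n}
    (l : ∀ i, W.obj (r i) →ₗ[K] K) : W ⟶ injFam K r :=
  (injShape K r).lift (fun v => LinearMap.pi fun i => (l i).comp (res W v (r i)))
    (fun v m => mem_injShape.2 fun i h => by simp [res_of_not _ h])
    (fun v w h m => by
      ext i
      rw [Shape.trunc_apply]
      split_ifs with hi
      · simp [res_res _ h (show reach w (r i) from hi)]
      · simp [res_of_not _ (show ¬ reach w (r i) from hi)])

lemma coord_injLift {ι : Type} (r : ι → Vert n) {W : DRep K n}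
    (l : ∀ i, W.obj (r i) →ₗ[K] K) (v : Vert n) (m : W.obj v) (i : ι) :
    (injShape K r).coord v ((injLift r l).app v m) i = l i (res W v (r i) m) := rfl

/-- A map into I(r) is determined by the functional that it induces at r, dually to the generator of
a projective. -/
lemma injLift_coord {ι : Type} (r : ι → Vert n) {W : DRep K n} (f : W ⟶ injFam K r) :
    injLift r (fun i => (LinearMap.proj i).comp (((injShape K r).coord (r i)).comp
      (f.app (r i)).hom)) = f := by
  refine hom_ext' fun v m => (injShape K r).coord_injective v (funext fun i => ?_)
  rw [coord_injLift]
  change (injShape K r).coord (r i) (f.app (r i) (res W v (r i) m)) i = _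
  by_cases h : reach v (r i)
  · rw [app_res, Shape.coord_res _ h, Shape.trunc_apply,
      if_pos (show (injShape K r).alive (r i) i from reach_refl _)]
  · rw [res_of_not _ h, map_zero, map_zero, Pi.zero_apply]
    exact (mem_injShape.1 ((injShape K r).coord_mem v (f.app v m)) i h).symm

/-! ### Matrices, presentations and the Nakayama functor -/

/-- A matrix of scalar multiples of paths. -/
structure Mat (K : Type u) [Field K] (n : ℕ) (ι κ : Type) where
  row : ι → Vert n
  col : κ → Vert n
  coeff : ι → κ → K
  path : ∀ i k, coeff i k ≠ 0 → reach (col k) (row i)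

namespace Mat

variable {ι κ : Type} [Fintype ι] [Fintype κ] (A : Mat K n ι κ)

/-- The map between products of spaces of a representation defined by a matrix. -/
noncomputable def eval (W : DRep K n) :
    (∀ k, W.obj (A.col k)) →ₗ[K] (∀ i, W.obj (A.row i)) :=
  LinearMap.pi fun i => ∑ k, A.coeff i k • (res W (A.col k) (A.row i)).comp (LinearMap.proj k)

omit [Fintype ι] in
lemma eval_apply (W : DRep K n) (m : ∀ k, W.obj (A.col k)) (i : ι) :
    A.eval W m i = ∑ k, A.coeff i k • res W (A.col k) (A.row i) (m k) := by
  simp [eval]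

omit [Fintype ι] in
lemma eval_app {W W' : DRep K n} (f : W ⟶ W') (m : ∀ k, W.obj (A.col k)) (i : ι) :
    A.eval W' (fun k => f.app _ (m k)) i = f.app _ (A.eval W m i) := by
  simp [eval_apply, app_res]

/-- The map between projectives defined by a matrix. -/
noncomputable def projMap : projFam K A.row ⟶ projFam K A.col :=
  projHom A.row (A.eval _ (projGen A.col))

/-- Under Hom(P(t), W) = W(t), precomposition with the map of projectives becomes `eval`. -/
lemma projMap_projHom {W : DRep K n} (m : ∀ k, W.obj (A.col k)) :
    A.projMap ≫ projHom A.col m = projHom A.row (A.eval W m) := by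
  refine projHom_ext _ fun i => ?_
  change (projHom A.col m).app _ (A.projMap.app _ (projGen A.row i)) = _
  rw [projMap, projHom_gen, projHom_gen, ← eval_app]
  simp

/-- The map between injectives defined by a matrix. -/
noncomputable def injMap : injFam K A.row ⟶ injFam K A.col :=
  injLift A.col fun k => ∑ i, A.coeff i k •
    (LinearMap.proj i).comp ((injShape K A.row).coord (A.col k))

omit [Fintype κ] in
open Classical in
lemma coord_injMap (v : Vert n) (x : (injFam K A.row).obj v) (k : κ) :
    (injShape K A.col).coord v (A.injMap.app v x) k =
      if reach v (A.col k) then ∑ i, A.coeff i k * (injShape K A.row).coord v x i else 0 := by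
  rw [injMap, coord_injLift]
  split_ifs with h
  · simp only [LinearMap.sum_apply, LinearMap.smul_apply, LinearMap.comp_apply,
      LinearMap.proj_apply, smul_eq_mul]
    refine Finset.sum_congr rfl fun i _ => ?_
    by_cases hc : A.coeff i k = 0
    · simp [hc]
    · rw [Shape.coord_res _ h, Shape.trunc_apply,
        if_pos (show (injShape K A.row).alive (A.col k) i from A.path i k hc)]
  · rw [res_of_not _ h, map_zero]

-- The map of injectives acts on functionals by the transpose of `eval`; this duality is what the
-- construction of almost split sequences uses.
omit [Fintype κ] in
lemma injLift_injMap {W : DRep K n} (l : ∀ i, W.obj (A.row i) →ₗ[K] K) :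
    injLift A.row l ≫ A.injMap = injLift A.col fun k =>
      ∑ i, A.coeff i k • (l i).comp (res W (A.col k) (A.row i)) := by
  refine hom_ext' fun v m => (injShape K A.col).coord_injective v (funext fun k => ?_)
  change (injShape K A.col).coord v (A.injMap.app v ((injLift A.row l).app v m)) k = _
  rw [coord_injMap, coord_injLift]
  split_ifs with h
  · simp only [LinearMap.sum_apply, LinearMap.smul_apply, LinearMap.comp_apply, smul_eq_mul]
    refine Finset.sum_congr rfl fun i _ => ?_
    by_cases hc : A.coeff i k = 0
    · simp [hc]
    · rw [coord_injLift, res_res _ h (A.path i k hc)]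
  · rw [res_of_not _ h, map_zero]

/-- `C` is the cokernel of the map of projectives defined by a matrix, with generators `g`. -/
structure Presents (C : DRep K n) (g : ∀ k, C.obj (A.col k)) : Prop where
  rel : A.eval C g = 0
  hom_ext : ∀ {T : DRep K n} (f f' : C ⟶ T), (∀ k, f.app _ (g k) = f'.app _ (g k)) → f = f'
  desc : ∀ {T : DRep K n} (m : ∀ k, T.obj (A.col k)), A.eval T m = 0 →
    ∃ f : C ⟶ T, ∀ k, f.app _ (g k) = m k

variable {A} {C : DRep K n} {g : ∀ k, C.obj (A.col k)}

omit [Fintype ι] in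
lemma Presents.of_iso (h : A.Presents C g) {C' : DRep K n} (e : C ≅ C') :
    A.Presents C' (fun k => e.hom.app _ (g k)) where
  rel := by
    ext i
    rw [eval_app, h.rel]
    simp
  hom_ext f f' hf := by
    have := h.hom_ext (e.hom ≫ f) (e.hom ≫ f') hf
    simpa using this
  desc m hm := by
    obtain ⟨f, hf⟩ := h.desc m hm
    refine ⟨e.inv ≫ f, fun k => ?_⟩
    rw [← hf]
    change (e.hom ≫ e.inv ≫ f).app _ _ = _
    simp

omit [Fintype ι] in
lemma Presents.epi (h : A.Presents C g) : Epi (projHom A.col g) where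
  left_cancellation f f' hf := h.hom_ext f f' fun k => by
    have := congrArg (fun u => u.app (A.col k) (projGen A.col k)) hf
    change f.app _ ((projHom A.col g).app _ _) = f'.app _ ((projHom A.col g).app _ _) at this
    simpa using this

lemma projHom_zero {W : DRep K n} {κ : Type} [Fintype κ] (t : κ → Vert n) :
    projHom t (0 : ∀ k, W.obj (t k)) = 0 :=
  projHom_ext _ fun k => by simp

lemma Presents.projMap_comp (h : A.Presents C g) : A.projMap ≫ projHom A.col g = 0 := by
  rw [projMap_projHom, h.rel, projHom_zero]

lemma Presents.exact (h : A.Presents C g) :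
    (ShortComplex.mk A.projMap (projHom A.col g) h.projMap_comp).Exact := by
  have := h.epi
  refine ShortComplex.exact_of_g_is_cokernel _ ?_
  refine CokernelCofork.IsColimit.ofπ' _ h.projMap_comp fun {T} k hk => ?_
  have hm : A.eval T (fun j => k.app _ (projGen A.col j)) = 0 := by
    ext i
    rw [eval_app]
    have := congrArg (fun u => u.app (A.row i) (projGen A.row i)) hk
    change k.app _ (A.projMap.app _ (projGen A.row i)) = 0 at this
    rwa [projMap, projHom_gen] at this
  refine ⟨(h.desc _ hm).choose, projHom_ext _ fun j => ?_⟩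
  change (h.desc _ hm).choose.app _ ((projHom A.col g).app _ _) = _
  rw [projHom_gen]
  exact (h.desc _ hm).choose_spec j

/-- The map from the relations of `C` onto the kernel of the projective cover. -/
lemma Presents.epi_lift (h : A.Presents C g) :
    Epi (kernel.lift (projHom A.col g) A.projMap h.projMap_comp) :=
  (ShortComplex.exact_iff_epi_kernel_lift _).1 h.exact

omit [Fintype ι] in
lemma Presents.shortExact (h : A.Presents C g) :
    (ShortComplex.mk (kernel.ι (projHom A.col g)) (projHom A.col g) (by simp)).ShortExact := by
  have := h.epi
  exact ShortComplex.ShortExact.mk (ShortComplex.exact_of_f_is_kernel _ (kernelIsKernel _))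

end Mat

end DRep

/-! ### Extension groups and almost split sequences from a presentation -/

namespace DRep

variable {n : ℕ} {K : Type u} [Field K]

section LinearAlgebra

variable {V E Q : Type*} [AddCommGroup V] [Module K V] [AddCommGroup E] [Module K E]
  [AddCommGroup Q] [Module K Q]

lemma exists_eq_comp_of_ker_le (f : V →ₗ[K] Q) (L : V →ₗ[K] E)
    (h : LinearMap.ker f ≤ LinearMap.ker L) : ∃ l : Q →ₗ[K] E, l.comp f = L := by
  obtain ⟨l, hl⟩ := LinearMap.exists_extend
    (((LinearMap.ker f).liftQ L h).comp f.quotKerEquivRange.symm.toLinearMap)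
  refine ⟨l, LinearMap.ext fun x => ?_⟩
  have := LinearMap.congr_fun hl ⟨f x, x, rfl⟩
  simp only [LinearMap.comp_apply, Submodule.subtype_apply, LinearEquiv.coe_coe] at this
  rw [LinearMap.comp_apply, this]
  have h2 : f.quotKerEquivRange.symm ⟨f x, x, rfl⟩ = (LinearMap.ker f).mkQ x := by
    rw [LinearEquiv.symm_apply_eq]
    rfl
  rw [h2]
  simp

lemma finrank_le_of_surjective [Module.Finite K Q] (s : Q →ₗ[K] E)
    (hs : Function.Surjective s) : Module.finrank K E ≤ Module.finrank K Q := by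
  obtain ⟨r, hr⟩ := LinearMap.exists_rightInverse_of_surjective s (LinearMap.range_eq_top.2 hs)
  exact LinearMap.finrank_le_finrank_of_injective (f := r)
    (Function.LeftInverse.injective (g := s) (LinearMap.congr_fun hr))

end LinearAlgebra

lemma exists_preimage {S : ShortComplex (DRep K n)} (hS : S.ShortExact) (v : Vert n)
    (y : S.X₂.obj v) (hy : S.g.app v y = 0) : ∃ x, S.f.app v x = y := by
  have := hS.map_of_exact ((evaluation (Vert n) (ModuleCat.{u} K)).obj v)
  exact (ShortComplex.moduleCat_exact_iff _).1 this.exact y hy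

lemma finrank_of_shortExact {S : ShortComplex (DRep K n)} (hS : S.ShortExact) (v : Vert n)
    [Module.Finite K (S.X₁.obj v)] [Module.Finite K (S.X₃.obj v)] :
    Module.Finite K (S.X₂.obj v) ∧ Module.finrank K (S.X₂.obj v) =
      Module.finrank K (S.X₁.obj v) + Module.finrank K (S.X₃.obj v) := by
  have := hS.mono_f
  have := hS.epi_g
  have h1 : Function.Injective (S.f.app v).hom := injective_of_mono S.f v
  have h2 : Function.Surjective (S.g.app v).hom := surjective_of_epi S.g v
  have h3 : Function.Exact (S.f.app v).hom (S.g.app v).hom := fun y =>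
    ⟨fun hy => exists_preimage hS v y hy, by
      rintro ⟨x, rfl⟩
      change (S.f ≫ S.g).app v x = 0
      rw [S.zero]
      rfl⟩
  have : Module.Finite K (S.X₂.obj v) := Module.Finite.of_exact h3 h2
  refine ⟨this, ?_⟩
  have h4 := LinearMap.finrank_range_add_finrank_ker (S.g.app v).hom
  rw [LinearMap.range_eq_top.2 h2, finrank_top, LinearMap.exact_iff.1 h3,
    LinearMap.finrank_range_of_inj h1] at h4
  exact h4.symm.trans (add_comm _ _)

namespace Mat

variable {ι κ : Type} [Fintype ι] [Fintype κ] {A : Mat K n ι κ}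
  {C : DRep K n} {g : ∀ k, C.obj (A.col k)}

-- Let R be the kernel of P₀ → C. The long exact sequence makes Ext¹(C, N) a quotient of Hom(R, N),
-- and P₁ → R being epi embeds Hom(R, N) into Hom(P₁, N).
open Abelian in
lemma Presents.finrank_ext_le (h : A.Presents C g) (N : DRep K n) (hN : IsFinDim N) :
    Module.finrank K (Ext C N 1) ≤
      Module.finrank K ((∀ i, N.obj (A.row i)) ⧸ LinearMap.range (A.eval N)) := by
  have : ∀ i, Module.Finite K (N.obj (A.row i)) := fun i => hN _
  let q : projFam K A.row ⟶ kernel (projHom A.col g) := kernel.lift _ A.projMap h.projMap_comp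
  have hq : Epi q := h.epi_lift
  let Φ : (kernel (projHom A.col g) ⟶ N) →ₗ[K] Ext C N 1 :=
    (Ext.precompOfLinear h.shortExact.extClass K N (add_zero 1)).comp
      (Ext.linearEquiv₀ (R := K)).symm.toLinearMap
  have hΦ : ∀ f, Φ f = h.shortExact.extClass.comp (Ext.mk₀ f) (add_zero 1) := fun f => rfl
  let Ψ' : (kernel (projHom A.col g) ⟶ N) →ₗ[K] (∀ i, N.obj (A.row i)) :=
    { toFun f i := f.app _ (q.app _ (projGen A.row i))
      map_add' f f' := rfl
      map_smul' c f := rfl }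
  have hΦs : Function.Surjective Φ := fun x => by
    obtain ⟨y, hy⟩ := Ext.contravariant_sequence_exact₃ h.shortExact N x
      (Ext.eq_zero_of_projective _) (n₀ := 0) rfl
    refine ⟨Ext.linearEquiv₀ (R := K) y, ?_⟩
    rw [hΦ, Ext.mk₀_linearEquiv₀_apply, hy]
  obtain ⟨l, hl⟩ := exists_eq_comp_of_ker_le ((LinearMap.range (A.eval N)).mkQ.comp Ψ') Φ (by
    intro f hf
    rw [LinearMap.mem_ker, LinearMap.comp_apply, Submodule.mkQ_apply,
      Submodule.Quotient.mk_eq_zero] at hf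
    obtain ⟨m, hm⟩ := hf
    -- If the values of `f` on the relations lie in the image of `eval`, then `f` is the restriction
    -- to R of a map P₀ → N, hence its extension class vanishes.
    have hf' : f = kernel.ι _ ≫ projHom A.col m := by
      rw [← cancel_epi q, kernel.lift_ι_assoc, projMap_projHom]
      refine projHom_ext _ fun i => ?_
      rw [projHom_gen, hm]
      rfl
    rw [LinearMap.mem_ker, hΦ, hf', ← Ext.mk₀_comp_mk₀]
    exact h.shortExact.extClass_comp_assoc _)
  refine finrank_le_of_surjective l fun x => ?_
  obtain ⟨f, rfl⟩ := hΦs x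
  exact ⟨_, LinearMap.congr_fun hl f⟩

/-- Let `C` be the cokernel of a map of projectives and `N` the kernel of the corresponding map
of injectives. If `C` is a brick, there is an almost split sequence from `N` to `C`. -/
theorem Presents.exists_isAlmostSplit (h : A.Presents C g) (hC : IsBrick C) (fC : IsFinDim C)
    {N : DRep K n} (hN : Indecomposable N) (fN : IsFinDim N) (j : N ⟶ injFam K A.row)
    (w : j ≫ A.injMap = 0) (hj : IsLimit (KernelFork.ofι j w)) [Epi A.injMap] :
    ∃ (E : DRep K n) (f : N ⟶ E) (p : E ⟶ C) (w : f ≫ p = 0),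
      IsAlmostSplit (ShortComplex.mk f p w) := by
  classical
  obtain ⟨k₀, hk₀⟩ : ∃ k, g k ≠ 0 := by
    by_contra! h0
    exact hC.1 ((IsZero.iff_id_eq_zero _).2 (h.hom_ext _ _ fun k => by rw [h0, map_zero, map_zero]))
  obtain ⟨θ₀, hθ₀⟩ : ∃ φ : C.obj (A.col k₀) →ₗ[K] K, φ (g k₀) ≠ 0 := by
    by_contra! h0
    exact hk₀ ((Module.forall_dual_apply_eq_zero_iff K (g k₀)).1 h0)
  -- The functional on Hom(P₀, C) corresponding to Θ must only be nonzero on the covering map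
  -- itself, so one component suffices.
  let θ : ∀ k, C.obj (A.col k) →ₗ[K] K := Function.update 0 k₀ θ₀
  have hθ : ∑ k, θ k (g k) ≠ 0 := by
    rw [Finset.sum_eq_single k₀]
    · simpa [θ] using hθ₀
    · intro k _ hk
      simp [θ, Function.update_of_ne hk]
    · simp
  let Θ : C ⟶ injFam K A.col := injLift A.col θ
  have hmono : Mono j := mono_of_isLimit_fork hj
  let u : N ⟶ pullback Θ A.injMap := pullback.lift 0 j (by rw [w, zero_comp])
  have hu1 : u ≫ pullback.fst Θ A.injMap = 0 := pullback.lift_fst _ _ _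
  have hu2 : u ≫ pullback.snd Θ A.injMap = j := pullback.lift_snd _ _ _
  refine ⟨pullback Θ A.injMap, u, pullback.fst _ _, hu1, ?_⟩
  have hS : (ShortComplex.mk u (pullback.fst Θ A.injMap) hu1).ShortExact := by
    have hm : Mono u := by
      have : Mono (u ≫ pullback.snd _ _) := by rw [hu2]; exact hmono
      exact mono_of_mono _ (pullback.snd Θ A.injMap)
    have he : Epi (pullback.fst Θ A.injMap) := inferInstance
    refine ShortComplex.ShortExact.mk (ShortComplex.exact_of_f_is_kernel _ ?_)
    refine KernelFork.IsLimit.ofι' _ _ fun {W} k hk => ?_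
    have hk' : (k ≫ pullback.snd Θ A.injMap) ≫ A.injMap = 0 := by
      rw [Category.assoc, ← pullback.condition, ← Category.assoc, hk, zero_comp]
    refine ⟨(KernelFork.IsLimit.lift' hj _ hk').1, pullback.hom_ext ?_ ?_⟩
    · rw [Category.assoc, hu1, comp_zero, hk]
    · rw [Category.assoc, hu2]
      exact (KernelFork.IsLimit.lift' hj _ hk').2
  refine ⟨hS, fN, fC, hN, hC.indecomposable, ⟨fun s => hθ ?_⟩, fun W _ f hf => ?_⟩
  -- A splitting factors Θ through the map of injectives, so θ is in the image of the transpose of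
  -- `eval`; it then vanishes on the generators `g` because these satisfy the relations.
  · have h1 : s.s ≫ pullback.fst Θ A.injMap = 𝟙 C := s.s_g
    have h2 : (s.s ≫ pullback.snd Θ A.injMap) ≫ A.injMap = Θ := by
      rw [Category.assoc, ← pullback.condition, ← Category.assoc, h1, Category.id_comp]
    obtain ⟨τ, hτ⟩ : ∃ τ : ∀ i, C.obj (A.row i) →ₗ[K] K,
        injLift A.row τ = s.s ≫ pullback.snd Θ A.injMap := ⟨_, injLift_coord _ _⟩
    rw [← hτ, injLift_injMap] at h2
    have h3 : ∀ k, θ k (g k) = ∑ i, A.coeff i k * τ i (res C (A.col k) (A.row i) (g k)) := by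
      intro k
      have := congrArg (fun u => (injShape K A.col).coord (A.col k) (u.app (A.col k) (g k)) k) h2
      simp only [Θ, coord_injLift, res_self] at this
      rw [← this]
      simp
    simp_rw [h3]
    rw [Finset.sum_comm]
    refine Finset.sum_eq_zero fun i _ => ?_
    have := congrFun h.rel i
    rw [eval_apply] at this
    have := congrArg (τ i) this
    simpa using this
  · let L : (∀ k, W.obj (A.col k)) →ₗ[K] K :=
      ∑ k, (θ k).comp ((f.app _).hom.comp (LinearMap.proj k))
    have hL : ∀ m, L m = ∑ k, θ k (f.app _ (m k)) := fun m => by simp [L]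
    -- The kernel of `eval` is Hom(C, W). For s there, s ≫ f is a scalar, and a nonzero one would
    -- split `f`; so L vanishes on this kernel and factors through `eval`.
    obtain ⟨l, hl⟩ := exists_eq_comp_of_ker_le (A.eval W) L (by
      intro m hm
      obtain ⟨s, hs⟩ := h.desc m hm
      obtain ⟨c, hc⟩ := hC.2 (s ≫ f)
      by_cases hc0 : c = 0
      · rw [LinearMap.mem_ker, hL]
        refine Finset.sum_eq_zero fun k _ => ?_
        rw [← hs]
        change θ k ((s ≫ f).app _ (g k)) = 0
        rw [hc, hc0]
        simp
      · refine absurd ⟨⟨⟨c⁻¹ • s, ?_⟩⟩⟩ hf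
        rw [Linear.smul_comp, hc, smul_smul, inv_mul_cancel₀ hc0, one_smul])
    -- The components of `l` define the map from W to the injectives indexed by the rows, and with
    -- `f` it gives the lift to the pullback.
    have hl' : injLift A.row (fun i => l.comp (LinearMap.single K (fun i => W.obj (A.row i)) i)) ≫ A.injMap = f ≫ Θ := by
      rw [injLift_injMap]
      refine hom_ext' fun v m => (injShape K A.col).coord_injective v (funext fun k => ?_)
      change _ = (injShape K A.col).coord v (Θ.app v (f.app v m)) k
      rw [coord_injLift, coord_injLift, ← app_res]
      generalize res W v (A.col k) m = x
      have h1 := LinearMap.congr_fun hl (Pi.single k x)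
      rw [hL, Finset.sum_eq_single k, Pi.single_eq_same] at h1
      · rw [← h1, LinearMap.comp_apply,
          ← Finset.univ_sum_single (A.eval W (Pi.single k x)), map_sum, LinearMap.sum_apply]
        refine Finset.sum_congr rfl fun i _ => ?_
        rw [eval_apply, Finset.sum_eq_single k]
        · rw [Pi.single_eq_same, Pi.single_smul, map_smul]
          rfl
        · intro k' _ hk'
          simp [Pi.single_eq_of_ne hk']
        · simp
      · intro k' _ hk'
        simp [Pi.single_eq_of_ne hk']
      · simp
    exact ⟨pullback.lift f _ hl'.symm, pullback.lift_fst _ _ _⟩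

end Mat

end DRep

/-! ### Middle terms in terms of values on the relations -/

namespace DRep

variable {n : ℕ} {K : Type u} [Field K]

/-- The kernel of `p` has dimension at most dim N and `Q` at most dim C; the dimension of `Y` forces
equality in both, leaving no room for kernels. -/
lemma injective_of_finrank_eq_add {N Y Q C : Type*} [AddCommGroup N] [Module K N]
    [AddCommGroup Y] [Module K Y] [AddCommGroup Q] [Module K Q] [AddCommGroup C] [Module K C]
    [Module.Finite K N] [Module.Finite K Y] [Module.Finite K C]
    (f : N →ₗ[K] Y) (p : Y →ₗ[K] Q) (c : C →ₗ[K] Q) (hc : Function.Surjective c)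
    (hp : Function.Surjective p) (h : LinearMap.ker p ≤ LinearMap.range f)
    (hdim : Module.finrank K Y = Module.finrank K N + Module.finrank K C) :
    Function.Injective f ∧ Function.Injective c := by
  have d1 := LinearMap.finrank_range_add_finrank_ker c
  rw [LinearMap.range_eq_top.2 hc, finrank_top] at d1
  have d2 := LinearMap.finrank_range_add_finrank_ker p
  rw [LinearMap.range_eq_top.2 hp, finrank_top] at d2
  have d3 := LinearMap.finrank_range_add_finrank_ker f
  have d4 := Submodule.finrank_mono h
  have e1 : Module.finrank K (LinearMap.ker f) = 0 := by omega
  have e2 : Module.finrank K (LinearMap.ker c) = 0 := by omega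
  exact ⟨LinearMap.ker_eq_bot.1 (Submodule.finrank_eq_zero.1 e1),
    LinearMap.ker_eq_bot.1 (Submodule.finrank_eq_zero.1 e2)⟩

namespace Mat

variable {ι κ : Type} [Fintype ι] [Fintype κ] (A : Mat K n ι κ)
  {C : DRep K n} (g : ∀ k, C.obj (A.col k)) {N : DRep K n}

/-- `Y` is the middle term of an extension of `C` by `N` such that for some lifts to `Y` of the
generators of `C`, the relations take the values `α` in `N`. -/
def Realizes (α : ∀ i, N.obj (A.row i)) (Y : DRep K n) : Prop :=
  ∃ (f : N ⟶ Y) (p : Y ⟶ C) (w : f ≫ p = 0) (m : ∀ k, Y.obj (A.col k)),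
    (ShortComplex.mk f p w).ShortExact ∧ (∀ k, p.app _ (m k) = g k) ∧
      ∀ i, A.eval Y m i = f.app _ (α i)

variable {A g}

omit [Fintype ι] in
lemma Presents.exists_lift (h : A.Presents C g) {Y : DRep K n} {f : N ⟶ Y} {p : Y ⟶ C}
    {w : f ≫ p = 0} (hS : (ShortComplex.mk f p w).ShortExact) :
    ∃ (m : ∀ k, Y.obj (A.col k)) (α : ∀ i, N.obj (A.row i)),
      (∀ k, p.app _ (m k) = g k) ∧ ∀ i, A.eval Y m i = f.app _ (α i) := by
  have := hS.epi_g
  choose m hm using fun k => surjective_of_epi p (A.col k) (g k)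
  choose α hα using fun i => exists_preimage hS (A.row i) (A.eval Y m i) (by
    change p.app _ _ = 0
    rw [← eval_app]
    simp_rw [hm]
    rw [h.rel]
    rfl)
  exact ⟨m, α, hm, fun i => (hα i).symm⟩

-- Moving the lifts of the generators by elements of N changes α by an element of the image of
-- `eval`, without changing the sequence.
omit [Fintype ι] in
lemma Realizes.add_range {α : ∀ i, N.obj (A.row i)} {Y : DRep K n} (h : A.Realizes g α Y)
    (x : ∀ k, N.obj (A.col k)) : A.Realizes g (α + A.eval N x) Y := by
  obtain ⟨f, p, w, m, hS, hm, hα⟩ := h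
  refine ⟨f, p, w, m + fun k => f.app _ (x k), hS, fun k => ?_, fun i => ?_⟩
  · rw [Pi.add_apply, map_add, hm]
    change g k + (f ≫ p).app _ (x k) = g k
    rw [w]
    simp
  · rw [map_add, Pi.add_apply, eval_app, hα, Pi.add_apply, map_add]

omit [Fintype ι] in
lemma Realizes.of_iso {α : ∀ i, N.obj (A.row i)} {Y Y' : DRep K n} (h : A.Realizes g α Y)
    (e : Y ≅ Y') : A.Realizes g α Y' := by
  obtain ⟨f, p, w, m, hS, hm, hα⟩ := h
  refine ⟨f ≫ e.hom, e.inv ≫ p, by simp [w], fun k => e.hom.app _ (m k), ?_, fun k => ?_,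
    fun i => ?_⟩
  · refine ShortComplex.shortExact_of_iso (S₁ := ShortComplex.mk f p w)
      (S₂ := ShortComplex.mk (f ≫ e.hom) (e.inv ≫ p) (by simp [w]))
      (ShortComplex.isoMk (Iso.refl N) e (Iso.refl C) ?_ ?_) hS
    · simp
    · simp
  · change (e.hom ≫ e.inv ≫ p).app _ (m k) = g k
    simpa using hm k
  · rw [eval_app, hα]
    rfl

/-- With R the kernel of P₀ → C, the middle term is the pushout of P₀ ← R → N, and the map R → N is
determined by α because P₁ → R is epi. -/
lemma Realizes.nonempty_iso (h : A.Presents C g) {α : ∀ i, N.obj (A.row i)} {Y Y' : DRep K n}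
    (hY : A.Realizes g α Y) (hY' : A.Realizes g α Y') : Nonempty (Y ≅ Y') := by
  obtain ⟨f, p, w, m, hS, hm, hα⟩ := hY
  obtain ⟨f', p', w', m', hS', hm', hα'⟩ := hY'
  have := hS.mono_f
  have := hS.epi_g
  have := hS'.mono_f
  have := h.epi_lift
  have hcov : ∀ {Z : DRep K n} (q : Z ⟶ C) (z : ∀ k, Z.obj (A.col k)),
      (∀ k, q.app _ (z k) = g k) → projHom A.col z ≫ q = projHom A.col g := fun q z hz =>
    projHom_ext _ fun k => by
      change q.app _ ((projHom A.col z).app _ _) = _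
      rw [projHom_gen, projHom_gen, hz]
  have hp := hcov p m hm
  have hp' := hcov p' m' hm'
  let R := kernel.ι (projHom A.col g)
  let ρ : kernel (projHom A.col g) ⟶ N := hS.exact.lift (R ≫ projHom A.col m) (by
    change (R ≫ projHom A.col m) ≫ p = 0
    rw [Category.assoc, hp]
    exact kernel.condition _)
  have hρ : ρ ≫ f = R ≫ projHom A.col m := hS.exact.lift_f _ _
  have hlift : kernel.lift (projHom A.col g) A.projMap h.projMap_comp ≫ R = A.projMap :=
    kernel.lift_ι _ _ _
  have hproj : ∀ {Z : DRep K n} (u : N ⟶ Z) (z : ∀ k, Z.obj (A.col k)),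
      (∀ i, A.eval Z z i = u.app _ (α i)) → A.projMap ≫ projHom A.col z = projHom A.row α ≫ u :=
    fun u z hz => by
      rw [projMap_projHom]
      refine projHom_ext _ fun i => ?_
      rw [projHom_gen, hz]
      change _ = u.app _ ((projHom A.row α).app _ _)
      rw [projHom_gen]
  have hρ0 : kernel.lift (projHom A.col g) A.projMap h.projMap_comp ≫ ρ = projHom A.row α := by
    rw [← cancel_mono f, Category.assoc, hρ, reassoc_of% hlift]
    exact hproj f m hα
  have hρ' : ρ ≫ f' = R ≫ projHom A.col m' := by
    rw [← cancel_epi (kernel.lift (projHom A.col g) A.projMap h.projMap_comp),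
      reassoc_of% hlift, reassoc_of% hρ0]
    exact (hproj f' m' hα').symm
  -- The comparison Y → Y' is obtained by descending along P₀ ⊕ N → Y, so the kernel of the latter
  -- must also die in Y'.
  let d := biprod.desc (projHom A.col m) f
  have hd : Epi d := by
    refine Preadditive.epi_of_cancel_zero _ fun {Z} z hz => ?_
    have h1 : projHom A.col m ≫ z = 0 := by
      have := congrArg (fun u => biprod.inl ≫ u) hz
      simpa [d] using this
    have h2 : f ≫ z = 0 := by
      have := congrArg (fun u => biprod.inr ≫ u) hz
      simpa [d] using this
    have h3 : p ≫ hS.exact.desc z h2 = z := hS.exact.g_desc z h2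
    rw [← h3, ← Category.assoc, hp] at h1
    have := h.epi
    rw [← h3, (cancel_epi (projHom A.col g)).1 (h1.trans comp_zero.symm), comp_zero]
  have hker : kernel.ι d ≫ biprod.desc (projHom A.col m') f' = 0 := by
    have hk : (kernel.ι d ≫ biprod.fst) ≫ projHom A.col m +
        (kernel.ι d ≫ biprod.snd) ≫ f = 0 := by
      have := kernel.condition d
      have hd' : d = biprod.fst ≫ projHom A.col m + biprod.snd ≫ f := biprod.desc_eq
      rw [← this]
      conv_rhs => arg 2; rw [hd']
      rw [Preadditive.comp_add, Category.assoc, Category.assoc]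
    have hk1 : (kernel.ι d ≫ biprod.fst) ≫ projHom A.col g = 0 := by
      have := congrArg (fun u => u ≫ p) hk
      rw [Preadditive.add_comp, Category.assoc _ _ p, hp, Category.assoc _ _ p, w] at this
      simpa using this
    obtain ⟨l, hl⟩ : ∃ l, l ≫ R = kernel.ι d ≫ biprod.fst := ⟨_, kernel.lift_ι _ _ hk1⟩
    -- The kernel consists of the pairs (r, -ρ r) with r in R, and ρ serves both sequences.
    have hk2 : kernel.ι d ≫ biprod.snd = - (l ≫ ρ) := by
      rw [← cancel_mono f, Preadditive.neg_comp, Category.assoc _ ρ, hρ, reassoc_of% hl]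
      rw [Category.assoc] at hk
      exact eq_neg_of_add_eq_zero_right hk
    rw [biprod.desc_eq, Preadditive.comp_add, ← Category.assoc, ← Category.assoc, hk2, ← hl,
      Preadditive.neg_comp, Category.assoc _ R, ← hρ', Category.assoc, add_neg_cancel]
  let e : Y ⟶ Y' := Abelian.epiDesc d _ hker
  have he : d ≫ e = biprod.desc (projHom A.col m') f' := Abelian.comp_epiDesc _ _ _
  have he1 : f ≫ e = f' := by
    have := congrArg (fun u => biprod.inr ≫ u) he
    simpa [d] using this
  have he2 : projHom A.col m ≫ e = projHom A.col m' := by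
    have := congrArg (fun u => biprod.inl ≫ u) he
    simpa [d] using this
  have he3 : e ≫ p' = p := by
    rw [← cancel_epi d]
    refine biprod.hom_ext' _ _ ?_ ?_
    · simp only [d, biprod.inl_desc_assoc]
      rw [reassoc_of% he2, hp', hp]
    · simp only [d, biprod.inr_desc_assoc]
      rw [reassoc_of% he1, w', w]
  let φ : ShortComplex.mk f p w ⟶ ShortComplex.mk f' p' w' :=
    { τ₁ := 𝟙 _, τ₂ := e, τ₃ := 𝟙 _
      comm₁₂ := by simpa using he1.symm
      comm₂₃ := by simpa using he3 }
  have : IsIso φ.τ₁ := inferInstanceAs (IsIso (𝟙 N))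
  have : IsIso φ.τ₃ := inferInstanceAs (IsIso (𝟙 C))
  have : IsIso e := ShortComplex.isIso₂_of_shortExact_of_isIso₁₃ φ hS hS'
  exact ⟨asIso e⟩

omit [Fintype ι] in
lemma Realizes.isNonsplitMiddleTerm {α : ∀ i, N.obj (A.row i)} {Y : DRep K n}
    (hY : A.Realizes g α Y) (hα : α ∉ LinearMap.range (A.eval N)) :
    IsNonsplitMiddleTerm N Y C := by
  obtain ⟨f, p, w, m, hS, hm, hα'⟩ := hY
  refine ⟨f, p, w, hS, ⟨fun s => hα ⟨fun k => s.r.app _ (m k), ?_⟩⟩⟩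
  ext i
  rw [eval_app]
  change s.r.app _ (A.eval Y m i) = α i
  rw [hα']
  have : f ≫ s.r = 𝟙 N := s.f_r
  change (f ≫ s.r).app _ (α i) = α i
  rw [this]
  rfl

-- If α is the value of `eval` at x, subtracting x from the lifts makes them satisfy the relations
-- of C, which defines a section.
omit [Fintype ι] in
lemma Presents.exists_realizes (h : A.Presents C g) {Y : DRep K n}
    (hY : IsNonsplitMiddleTerm N Y C) :
    ∃ α, α ∉ LinearMap.range (A.eval N) ∧ A.Realizes g α Y := by
  obtain ⟨f, p, w, hS, hs'⟩ := hY
  obtain ⟨m, α, hm, hα⟩ := h.exists_lift hS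
  refine ⟨α, ?_, f, p, w, m, hS, hm, hα⟩
  rintro ⟨x, rfl⟩
  obtain ⟨s, hs⟩ := h.desc (fun k => m k - f.app _ (x k)) (by
    change A.eval Y (m - fun k => f.app _ (x k)) = 0
    ext i
    rw [map_sub, Pi.sub_apply, hα, eval_app, sub_self]
    rfl)
  refine hs'.false (ShortComplex.Splitting.ofExactOfSection _ hS.exact s
    (h.hom_ext _ _ fun k => ?_) hS.mono_f)
  change p.app _ (s.app _ (g k)) = g k
  rw [hs, map_sub, hm]
  change g k - (f ≫ p).app _ (x k) = g k
  rw [w]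
  simp

omit [Fintype ι] in
/-- A representation that receives compatible maps from `N` and the projective cover of `C`, and
is generated by their images, is an extension of `C` by `N` if it has the right dimensions. -/
lemma realizes_of_finrank (h : A.Presents C g) (fC : IsFinDim C) (fN : IsFinDim N)
    {Y : DRep K n} (fY : IsFinDim Y) (f : N ⟶ Y) (m : ∀ k, Y.obj (A.col k))
    {α : ∀ i, N.obj (A.row i)} (hα : ∀ i, A.eval Y m i = f.app _ (α i))
    (hgen : ∀ {T : DRep K n} (q : Y ⟶ T), f ≫ q = 0 → (∀ k, q.app _ (m k) = 0) → q = 0)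
    (hdim : ∀ v : Vert n, Module.finrank K (Y.obj v) =
      Module.finrank K (N.obj v) + Module.finrank K (C.obj v)) :
    A.Realizes g α Y := by
  have hrel : A.eval (cokernel f) (fun k => (cokernel.π f).app _ (m k)) = 0 := by
    ext i
    rw [eval_app, hα]
    change (f ≫ cokernel.π f).app _ (α i) = 0
    rw [cokernel.condition]
    rfl
  -- The elements `m` satisfy the relations of C modulo the image of `f`. Generation makes the
  -- induced map from C to the cokernel epi; the dimension count will make it and `f` mono.
  obtain ⟨c, hc⟩ := h.desc _ hrel
  have hcepi : Epi c := by
    refine Preadditive.epi_of_cancel_zero _ fun {T} q hq => ?_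
    rw [← cancel_epi (cokernel.π f), comp_zero]
    refine hgen _ (by simp) fun k => ?_
    change q.app _ ((cokernel.π f).app _ (m k)) = 0
    rw [← hc]
    change (c ≫ q).app _ (g k) = 0
    rw [hq]
    rfl
  have key : ∀ v : Vert n, Function.Injective (f.app v) ∧ Function.Injective (c.app v) := by
    intro v
    have i1 : Module.Finite K (N.obj v) := fN v
    have i2 : Module.Finite K (Y.obj v) := fY v
    have i3 : Module.Finite K (C.obj v) := fC v
    have hcs : Function.Surjective (c.app v).hom := surjective_of_epi c v
    have hps : Function.Surjective ((cokernel.π f).app v).hom := surjective_of_epi (cokernel.π f) v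
    have hex : LinearMap.ker ((cokernel.π f).app v).hom ≤ LinearMap.range (f.app v).hom := by
      have hS : (ShortComplex.mk (kernel.ι (cokernel.π f)) (cokernel.π f) (by simp)).ShortExact :=
        ShortComplex.ShortExact.mk (ShortComplex.exact_of_f_is_kernel _ (kernelIsKernel _))
      intro y hy
      obtain ⟨x, hx⟩ := exists_preimage hS v y hy
      obtain ⟨z, hz⟩ := surjective_of_epi (Abelian.factorThruImage f) v x
      refine ⟨z, ?_⟩
      have : f = Abelian.factorThruImage f ≫ kernel.ι (cokernel.π f) :=
        (Abelian.image.fac f).symm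
      rw [this, ← hx]
      change (kernel.ι (cokernel.π f)).app v ((Abelian.factorThruImage f).app v z) = _
      rw [hz]
    exact injective_of_finrank_eq_add _ _ _ hcs hps hex (hdim v)
  have hcmono : Mono c := mono_of_injective c fun v => (key v).2
  have hfmono : Mono f := mono_of_injective f fun v => (key v).1
  have hciso : IsIso c := isIso_of_mono_of_epi c
  obtain ⟨e, he⟩ : ∃ e : C ≅ cokernel f, e.hom = c := ⟨asIso c, rfl⟩
  have hw : f ≫ cokernel.π f ≫ e.inv = 0 := by rw [← Category.assoc, cokernel.condition, zero_comp]
  refine ⟨f, cokernel.π f ≫ e.inv, hw, m, ?_, fun k => ?_, hα⟩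
  · refine ShortComplex.shortExact_of_iso
      (S₁ := ShortComplex.mk f (cokernel.π f) (cokernel.condition f))
      (S₂ := ShortComplex.mk f (cokernel.π f ≫ e.inv) hw)
      (ShortComplex.isoMk (Iso.refl N) (Iso.refl Y) e.symm ?_ ?_)
      (ShortComplex.ShortExact.mk (ShortComplex.exact_of_g_is_cokernel _ (cokernelIsCokernel f)))
    · simp
    · simp
  · change e.inv.app _ ((cokernel.π f).app _ (m k)) = g k
    rw [← hc, ← he]
    change (e.hom ≫ e.inv).app _ (g k) = g k
    rw [e.hom_inv_id]
    rfl

end Mat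

end DRep

/-! ### The modules P(t)/P(a) -/

namespace DRep

variable {n : ℕ} {K : Type u} [Field K]

section Thin

/-- The shape of `P(t) / P(a)`. -/
def thinShape (K : Type u) [Field K] (a : ℕ) (t : Vert n) : Shape K n Unit where
  space v :=
    { carrier := {x | ¬ (reach t v ∧ a < lab v) → x () = 0}
      add_mem' := fun hx hy h => by simp [hx h, hy h]
      zero_mem' := fun _ => rfl
      smul_mem' := fun c x hx h => by simp [hx h] }
  alive v _ := a < lab v
  trunc_mem v w h x hx := by
    intro hw
    by_cases ha : a < lab w
    · exact (if_pos ha).trans (hx fun hv => hw ⟨hv.1.trans h, ha⟩)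
    · exact if_neg ha
  eq_zero v x hx i hi := hx fun h => hi h.2
  alive_of_reach v w h i hi := lt_of_lt_of_le hi h.lab_le

lemma mem_thinShape {a : ℕ} {t v : Vert n} {x : Unit → K} :
    x ∈ (thinShape K a t).space v ↔ (¬ (reach t v ∧ a < lab v) → x () = 0) := Iff.rfl

/-- The representation `P(t) / P(a)`. -/
noncomputable abbrev thin (K : Type u) [Field K] (a : ℕ) (t : Vert n) : DRep K n :=
  (thinShape K a t).rep

lemma isFinDim_thin (a : ℕ) (t : Vert n) : IsFinDim (thin K a t) := Shape.isFinDim _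

variable {a : ℕ} {t : Vert n}

/-- The generator of `P(t) / P(a)`. -/
noncomputable def thinGen (K : Type u) [Field K] (a : ℕ) (t : Vert n) : (thin K a t).obj t :=
  -- The zero value outside `a < lab t` covers the zero module, which occurs as X₃ when s = i.
  (thinShape K a t).elt t (fun _ => if a < lab t then 1 else 0)
    (mem_thinShape.2 fun h => if_neg fun h' => h ⟨reach_refl t, h'⟩)

lemma thin_eq_smul (v : Vert n) (x : (thin K a t).obj v) :
    x = (thinShape K a t).coord v x () • res _ t v (thinGen K a t) := by
  refine (thinShape K a t).coord_injective v (funext fun _ => ?_)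
  by_cases h : reach t v ∧ a < lab v
  · rw [map_smul, Pi.smul_apply, Shape.coord_res _ h.1, Shape.trunc_apply,
      if_pos (show (thinShape K a t).alive v _ from h.2), thinGen, Shape.coord_elt,
      if_pos (h.2.trans_le h.1.lab_le), smul_eq_mul, mul_one]
  · rw [mem_thinShape.1 ((thinShape K a t).coord_mem v x) h, zero_smul, map_zero]
    rfl

lemma thin_hom_ext {T : DRep K n} {f g : thin K a t ⟶ T}
    (h : f.app t (thinGen K a t) = g.app t (thinGen K a t)) : f = g :=
  hom_ext' fun v x => by rw [thin_eq_smul v x, map_smul, map_smul, app_res, app_res, h]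

/-- Morphisms from `P(t) / P(a)` are given by elements at `t` that vanish from `a` on. -/
lemma exists_thin_hom {T : DRep K n} (m : T.obj t)
    (hm : ∀ w, lab w ≤ a → res T t w m = 0) :
    ∃ f : thin K a t ⟶ T, f.app t (thinGen K a t) = m := by
  refine ⟨mkHom (fun v => ((LinearMap.proj ()).comp ((thinShape K a t).coord v)).smulRight
    (res T t v m)) (fun v w h x => ?_), ?_⟩
  · simp only [LinearMap.smulRight_apply, LinearMap.comp_apply, LinearMap.proj_apply, map_smul]
    by_cases ht : reach t v
    · rw [res_res _ ht h, Shape.coord_res _ h, Shape.trunc_apply]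
      by_cases ha : (thinShape K a t).alive w ()
      · rw [if_pos ha]
      · rw [hm w (not_lt.1 ha), smul_zero, smul_zero]
    · have h0 := mem_thinShape.1 ((thinShape K a t).coord_mem v x) fun h => ht h.1
      rw [Shape.coord_res _ h, Shape.trunc_apply, h0, ite_self, zero_smul, zero_smul]
  · change (thinShape K a t).coord t (thinGen K a t) () • res T t t m = m
    rw [res_self, thinGen, Shape.coord_elt]
    by_cases ha : a < lab t
    · rw [if_pos ha, one_smul]
    · rw [if_neg ha, zero_smul, ← res_self T t m, hm t (not_lt.1 ha)]

lemma res_thinGen_of_le {w : Vert n} (hw : lab w ≤ a) : res _ t w (thinGen K a t) = 0 := by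
  refine (thinShape K a t).coord_injective w (funext fun i => ?_)
  rw [map_zero]
  exact (thinShape K a t).eq_zero w _ ((thinShape K a t).coord_mem w _) i (not_lt.2 hw)

lemma res_thinGen_ne_zero {w : Vert n} (h : reach t w) (hw : a < lab w) :
    res _ t w (thinGen K a t) ≠ 0 := by
  intro h0
  have := congrArg (fun x => (thinShape K a t).coord w x ()) h0
  simp only [Shape.coord_res _ h, Shape.trunc_apply, map_zero, Pi.zero_apply] at this
  rw [if_pos (show (thinShape K a t).alive w () from hw), thinGen, Shape.coord_elt,
    if_pos (hw.trans_le h.lab_le)] at this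
  exact one_ne_zero this

lemma isZero_thin (h : lab t ≤ a) : IsZero (thin K a t) := by
  refine (IsZero.iff_id_eq_zero _).2 (thin_hom_ext ?_)
  have : thinGen K a t = 0 := by rw [← res_self _ t (thinGen K a t), res_thinGen_of_le h]
  rw [this, map_zero, map_zero]

lemma isBrick_thin (h : a < lab t) : IsBrick (thin K a t) := by
  refine ⟨fun h0 => ?_, fun f => ?_⟩
  · have h1 := (IsZero.iff_id_eq_zero _).1 h0
    have h2 := congrArg (fun u => u.app t (thinGen K a t)) h1
    refine res_thinGen_ne_zero (K := K) (reach_refl t) h ?_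
    rw [res_self]
    exact h2
  · refine ⟨(thinShape K a t).coord t (f.app t (thinGen K a t)) (), thin_hom_ext ?_⟩
    rw [smul_app_apply]
    conv_lhs => rw [thin_eq_smul t (f.app t (thinGen K a t)), res_self]
    rfl

open Classical in
lemma finrank_thin (v : Vert n) :
    Module.finrank K ((thin K a t).obj v) = if reach t v ∧ a < lab v then 1 else 0 := by
  split_ifs with h
  · refine finrank_eq_one (res _ t v (thinGen K a t)) (res_thinGen_ne_zero h.1 h.2) fun x => ?_
    exact ⟨_, (thin_eq_smul v x).symm⟩
  · have : Subsingleton ((thin K a t).obj v) := by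
      refine ⟨fun x y => (thinShape K a t).coord_injective v (funext fun _ => ?_)⟩
      rw [mem_thinShape.1 ((thinShape K a t).coord_mem v x) h,
        mem_thinShape.1 ((thinShape K a t).coord_mem v y) h]
    exact Module.finrank_zero_of_subsingleton

/-- The vertices with label `a`, as rows of a presentation. -/
abbrev RowOne (n a : ℕ) : Type := {v : Vert n // lab v = a}

instance : Subsingleton (RowOne n a) := ⟨fun i j => Subtype.ext (lab_injective (i.2.trans j.2.symm))⟩

/-- The matrix presenting `P(t) / P(a)`. -/
abbrev thinMat (K : Type u) [Field K] (a : ℕ) (t : Vert n) (ha : a < lab t) (ha' : a + 2 ≤ n) :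
    Mat K n (RowOne n a) Unit where
  row i := i.1
  col _ := t
  coeff _ _ := 1
  path i _ _ := reach_of_lt (by rw [i.2]; exact ha) (by rw [i.2]; exact ha')

lemma thinMat_eval (ha : a < lab t) (ha' : a + 2 ≤ n) (W : DRep K n) (m : Unit → W.obj t)
    (i : RowOne n a) : (thinMat K a t ha ha').eval W m i = res W t i.1 (m ()) := by
  rw [Mat.eval_apply, Fintype.sum_unique]
  exact one_smul K (res W t i.1 (m ()))

/-- For a = 0 there are no rows, and the presentation is that of the projective P(t). -/
lemma thinMat_presents (ha : a < lab t) (ha' : a + 2 ≤ n) :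
    (thinMat K a t ha ha').Presents (thin K a t) (fun _ => thinGen K a t) where
  rel := funext fun i => (thinMat_eval ha ha' _ _ i).trans (res_thinGen_of_le i.2.le)
  hom_ext f f' h := thin_hom_ext (h ())
  desc {T} m hm := by
    obtain ⟨f, hf⟩ := exists_thin_hom (a := a) (m ()) fun w hw => by
      have h1 := one_le_lab w
      obtain ⟨i, hi⟩ := exists_lab (n := n) (j := a) (by omega) (by omega)
      have hr := (thinMat_eval ha ha' T m ⟨i, hi⟩).symm.trans (congrFun hm ⟨i, hi⟩)
      have hiw : reach i w := by
        rcases hw.eq_or_lt with h | h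
        · rw [lab_injective (h.trans hi.symm)]
          exact reach_refl i
        · exact reach_of_lt (by omega) (by omega)
      rw [← res_res T (reach_of_lt (by omega) (by omega) : reach t i) hiw]
      exact (congrArg _ hr).trans (map_zero _)
    exact ⟨f, fun _ => hf⟩

end Thin

end DRep

/-! ### The modules (P(n-1) ⊕ P(n))/(P(a) ⊕ P(b)) -/

namespace DRep

variable {n : ℕ} {K : Type u} [Field K]

section Dbl

variable [h4 : Fact (4 ≤ n)]

/-- The source vertex `n - 1`. -/
def vL : Vert n := (⟨n - 1, by have := h4.out; omega, by omega⟩ : DVertex n)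

/-- The source vertex `n`. -/
def vR : Vert n := (⟨n, by have := h4.out; omega, le_rfl⟩ : DVertex n)

lemma lab_vL : lab (vL : Vert n) = n - 1 := rfl

lemma lab_vR : lab (vR : Vert n) = n := rfl

lemma eq_vL_or_eq_vR_or (v : Vert n) : v = vL ∨ v = vR ∨ lab v + 2 ≤ n := by
  have := lab_le v
  by_cases h1 : lab v = n - 1
  · exact Or.inl (lab_injective h1)
  · by_cases h2 : lab v = n
    · exact Or.inr (Or.inl (lab_injective h2))
    · right; right; omega

lemma reach_vL {w : Vert n} (h : lab w + 2 ≤ n) : reach vL w :=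
  reach_of_lt (by rw [lab_vL]; omega) h

lemma reach_vR {w : Vert n} (h : lab w + 2 ≤ n) : reach vR w :=
  reach_of_lt (by rw [lab_vR]; omega) h

lemma not_reach_vL {v : Vert n} (h : ¬ reach vL v) : v = vR := by
  rcases eq_vL_or_eq_vR_or v with rfl | rfl | h'
  · exact absurd (reach_refl _) h
  · rfl
  · exact absurd (reach_vL h') h

lemma not_reach_vR {v : Vert n} (h : ¬ reach vR v) : v = vL := by
  rcases eq_vL_or_eq_vR_or v with rfl | rfl | h'
  · rfl
  · exact absurd (reach_refl _) h
  · exact absurd (reach_vR h') h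

omit h4 in
lemma label_le_of_reach_ne {v w : Vert n} (h : reach v w) (hne : w ≠ v) : lab w + 2 ≤ n :=
  ((reach_iff.1 h).resolve_left hne).2

/-- The shape of `(P(n-1) ⊕ P(n)) / (P(a) ⊕ P(b))`. The two coordinates `false` and `true` at a
vertex of the arm are dual to the generators of the socle of a generic such representation. -/
def dblShape (K : Type u) [Field K] (n a b : ℕ) [h4 : Fact (4 ≤ n)] : Shape K n Bool where
  space v :=
    -- The space at n-1 is the diagonal and the space at n is the `false` axis, so their generators
    -- agree once the `true` coordinate is cut off at b, and vanish once the `false` one is cut off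
    -- at a.
    { carrier := {x | (lab v ≤ a → x false = 0) ∧ (lab v ≤ b → x true = 0) ∧
        (v = vL → x true = x false) ∧ (v = vR → x true = 0)}
      add_mem' := fun {x y} hx hy => ⟨fun h => by simp [hx.1 h, hy.1 h],
        fun h => by simp [hx.2.1 h, hy.2.1 h], fun h => by simp [hx.2.2.1 h, hy.2.2.1 h],
        fun h => by simp [hx.2.2.2 h, hy.2.2.2 h]⟩
      zero_mem' := ⟨fun _ => rfl, fun _ => rfl, fun _ => rfl, fun _ => rfl⟩
      smul_mem' := fun c x hx => ⟨fun h => by simp [hx.1 h],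
        fun h => by simp [hx.2.1 h], fun h => by simp [hx.2.2.1 h],
        fun h => by simp [hx.2.2.2 h]⟩ }
  alive v i := (bif i then b else a) < lab v
  trunc_mem v w h x hx := by
    by_cases hvw : w = v
    · subst hvw
      convert hx using 1
      funext i
      cases i
      · by_cases ha : a < lab w
        · exact if_pos ha
        · exact (if_neg ha).trans (hx.1 (not_lt.1 ha)).symm
      · by_cases hb : b < lab w
        · exact if_pos hb
        · exact (if_neg hb).trans (hx.2.1 (not_lt.1 hb)).symm
    · have h2 := label_le_of_reach_ne h hvw
      refine ⟨fun ha => if_neg (not_lt.2 ha), fun hb => if_neg (not_lt.2 hb), fun hL => ?_,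
        fun hR => ?_⟩
      · rw [hL, lab_vL] at h2
        have := h4.out
        omega
      · rw [hR, lab_vR] at h2
        omega
  eq_zero v x hx i hi := by
    cases i
    · exact hx.1 (not_lt.1 hi)
    · exact hx.2.1 (not_lt.1 hi)
  alive_of_reach v w h i hi := lt_of_lt_of_le hi h.lab_le

/-- The representation `(P(n-1) ⊕ P(n)) / (P(a) ⊕ P(b))`. -/
noncomputable abbrev dbl (K : Type u) [Field K] (n a b : ℕ) [Fact (4 ≤ n)] : DRep K n :=
  (dblShape K n a b).rep

lemma mem_dblShape {a b : ℕ} {v : Vert n} {x : Bool → K} :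
    x ∈ (dblShape K n a b).space v ↔ (lab v ≤ a → x false = 0) ∧ (lab v ≤ b → x true = 0) ∧
        (v = vL → x true = x false) ∧ (v = vR → x true = 0) := Iff.rfl

lemma isFinDim_dbl (a b : ℕ) : IsFinDim (dbl K n a b) := Shape.isFinDim _

variable {a b : ℕ}

lemma dblShape_trunc_false (w : Vert n) (x : Bool → K) :
    (dblShape K n a b).trunc w x false = if a < lab w then x false else 0 := by
  classical exact (Shape.trunc_apply _ _ _ _).trans (if_congr Iff.rfl rfl rfl)

lemma dblShape_trunc_true (w : Vert n) (x : Bool → K) :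
    (dblShape K n a b).trunc w x true = if b < lab w then x true else 0 := by
  classical exact (Shape.trunc_apply _ _ _ _).trans (if_congr Iff.rfl rfl rfl)

lemma vL_ne_vR : (vL : Vert n) ≠ vR := fun h => by
  have := congrArg lab h
  rw [lab_vL, lab_vR] at this
  have := h4.out
  omega

section Gen

variable (hab : a < b) (hb : b + 2 ≤ n)
include hab hb

/-- The generator at the vertex `n - 1`. -/
noncomputable def dblGenL (K : Type u) [Field K] : (dbl K n a b).obj vL :=
  (dblShape K n a b).elt vL 1 (mem_dblShape.2
    ⟨fun h => by rw [lab_vL] at h; omega, fun h => by rw [lab_vL] at h; omega, fun _ => rfl,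
      fun h => absurd h vL_ne_vR⟩)

/-- The generator at the vertex `n`. -/
noncomputable def dblGenR (K : Type u) [Field K] : (dbl K n a b).obj vR :=
  (dblShape K n a b).elt vR (fun i => bif i then 0 else 1) (mem_dblShape.2
    ⟨fun h => by rw [lab_vR] at h; omega, fun _ => rfl, fun h => absurd h.symm vL_ne_vR,
      fun _ => rfl⟩)

lemma coord_res_dblGenL {w : Vert n} (h : reach vL w) (i : Bool) :
    (dblShape K n a b).coord w (res _ vL w (dblGenL hab hb K)) i =
      if (bif i then b else a) < lab w then 1 else 0 := by
  classical
  rw [Shape.coord_res _ h, Shape.trunc_apply]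
  exact if_congr Iff.rfl rfl rfl

lemma coord_res_dblGenR {w : Vert n} (h : reach vR w) (i : Bool) :
    (dblShape K n a b).coord w (res _ vR w (dblGenR hab hb K)) i =
      bif i then 0 else if a < lab w then 1 else 0 := by
  classical
  rw [Shape.coord_res _ h, Shape.trunc_apply]
  cases i
  · exact if_congr Iff.rfl rfl rfl
  · exact ite_self _

lemma dbl_eq_add (v : Vert n) (x : (dbl K n a b).obj v) :
    x = (dblShape K n a b).coord v x true • res _ vL v (dblGenL hab hb K) +
      ((dblShape K n a b).coord v x false - (dblShape K n a b).coord v x true) •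
        res _ vR v (dblGenR hab hb K) := by
  have hx := mem_dblShape.1 ((dblShape K n a b).coord_mem v x)
  refine (dblShape K n a b).coord_injective v (funext fun i => ?_)
  rw [map_add, map_smul, map_smul, Pi.add_apply, Pi.smul_apply, Pi.smul_apply, smul_eq_mul,
    smul_eq_mul]
  have hA : (dblShape K n a b).coord v x true *
      (dblShape K n a b).coord v (res _ vL v (dblGenL hab hb K)) i =
      (dblShape K n a b).coord v x true * if (bif i then b else a) < lab v then 1 else 0 := by
    by_cases h : reach vL v
    · rw [coord_res_dblGenL hab hb h]
    · rw [hx.2.2.2 (not_reach_vL h), zero_mul, zero_mul]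
  have hB : ((dblShape K n a b).coord v x false - (dblShape K n a b).coord v x true) *
      (dblShape K n a b).coord v (res _ vR v (dblGenR hab hb K)) i =
      ((dblShape K n a b).coord v x false - (dblShape K n a b).coord v x true) *
        bif i then 0 else if a < lab v then 1 else 0 := by
    by_cases h : reach vR v
    · rw [coord_res_dblGenR hab hb h]
    · rw [hx.2.2.1 (not_reach_vR h), sub_self, zero_mul, zero_mul]
  rw [hA, hB]
  cases i
  · by_cases ha : a < lab v
    · simp [ha]
    · simp [ha, hx.1 (not_lt.1 ha)]
  · by_cases hb' : b < lab v
    · simp [hb']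
    · simp [hb', hx.2.1 (not_lt.1 hb')]

lemma dbl_hom_ext {T : DRep K n} {f g : dbl K n a b ⟶ T}
    (hL : f.app vL (dblGenL hab hb K) = g.app vL (dblGenL hab hb K))
    (hR : f.app vR (dblGenR hab hb K) = g.app vR (dblGenR hab hb K)) : f = g :=
  hom_ext' fun v x => by
    rw [dbl_eq_add hab hb v x, map_add, map_add, map_smul, map_smul, map_smul, map_smul, app_res,
      app_res, app_res, app_res, hL, hR]

lemma exists_dbl_hom {T : DRep K n} (p : T.obj vL) (q : T.obj vR)
    (h1 : ∀ w, lab w ≤ b → res T vL w p = res T vR w q)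
    (h2 : ∀ w, lab w ≤ a → res T vL w p = 0) :
    ∃ f : dbl K n a b ⟶ T, f.app vL (dblGenL hab hb K) = p ∧
      f.app vR (dblGenR hab hb K) = q := by
  let F : ∀ v, (dbl K n a b).obj v →ₗ[K] T.obj v := fun v =>
    ((LinearMap.proj true : (Bool → K) →ₗ[K] K).comp
        ((dblShape K n a b).coord v)).smulRight (res T vL v p) +
      ((LinearMap.proj (R := K) (φ := fun _ : Bool => K) false -
        LinearMap.proj (R := K) (φ := fun _ : Bool => K) true).comp
        ((dblShape K n a b).coord v)).smulRight (res T vR v q)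
  have hF : ∀ v x, F v x = (dblShape K n a b).coord v x true • res T vL v p +
      ((dblShape K n a b).coord v x false - (dblShape K n a b).coord v x true) •
        res T vR v q := fun v x => rfl
  refine ⟨mkHom F (fun v w h x => ?_), ?_, ?_⟩
  · have hx := mem_dblShape.1 ((dblShape K n a b).coord_mem v x)
    rw [hF, hF, map_add, map_smul, map_smul, Shape.coord_res _ h, dblShape_trunc_true,
      dblShape_trunc_false]
    generalize (dblShape K n a b).coord v x = y at hx
    have hA : y true • res T v w (res T vL v p) = y true • res T vL w p := by
      by_cases hv : reach vL v
      · rw [res_res _ hv h]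
      · rw [hx.2.2.2 (not_reach_vL hv), zero_smul, zero_smul]
    have hB : (y false - y true) • res T v w (res T vR v q) =
        (y false - y true) • res T vR w q := by
      by_cases hv : reach vR v
      · rw [res_res _ hv h]
      · rw [hx.2.2.1 (not_reach_vR hv), sub_self, zero_smul, zero_smul]
    rw [hA, hB]
    by_cases hbw : b < lab w
    · rw [if_pos hbw, if_pos (hab.trans hbw)]
    · rw [if_neg hbw, ← h1 w (not_lt.1 hbw)]
      by_cases haw : a < lab w
      · rw [if_pos haw]
        module
      · rw [h2 w (not_lt.1 haw)]
        simp
  · rw [mkHom_app, hF, res_self]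
    simp [dblGenL]
  · rw [mkHom_app, hF, res_self]
    simp [dblGenR]

lemma res_dblGen_eq {w : Vert n} (hw : lab w ≤ b) :
    res _ vL w (dblGenL hab hb K) = res _ vR w (dblGenR hab hb K) := by
  refine (dblShape K n a b).coord_injective w (funext fun i => ?_)
  rw [coord_res_dblGenL hab hb (reach_vL (by omega)), coord_res_dblGenR hab hb (reach_vR (by omega))]
  cases i
  · rfl
  · exact if_neg (not_lt.2 hw)

lemma res_dblGenL_eq_zero {w : Vert n} (hw : lab w ≤ a) :
    res _ vL w (dblGenL hab hb K) = 0 := by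
  refine (dblShape K n a b).coord_injective w (funext fun i => ?_)
  rw [coord_res_dblGenL hab hb (reach_vL (by omega)), map_zero]
  cases i
  · exact if_neg (not_lt.2 hw)
  · exact if_neg (not_lt.2 (by simp only [cond_true]; omega))

lemma res_dblGenL_ne_zero {w : Vert n} (h : reach vL w) (hw : a < lab w) :
    res _ vL w (dblGenL hab hb K) ≠ 0 := fun h0 => by
  have := congrArg (fun x => (dblShape K n a b).coord w x false) h0
  simp only [coord_res_dblGenL hab hb h, map_zero, Pi.zero_apply] at this
  rw [if_pos (by exact hw)] at this
  exact one_ne_zero this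

lemma res_dblGenR_ne_zero {w : Vert n} (h : reach vR w) (hw : a < lab w) :
    res _ vR w (dblGenR hab hb K) ≠ 0 := fun h0 => by
  have := congrArg (fun x => (dblShape K n a b).coord w x false) h0
  simp only [coord_res_dblGenR hab hb h, map_zero, Pi.zero_apply] at this
  rw [cond_false, if_pos (by exact hw)] at this
  exact one_ne_zero this

/-- Both source spaces are lines, so an endomorphism multiplies the two generators by scalars c and
d. At the vertex b the generators have the same nonzero image, whence c = d. -/
lemma isBrick_dbl : IsBrick (dbl K n a b) := by
  refine ⟨fun h0 => ?_, fun f => ?_⟩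
  · have h1 := (IsZero.iff_id_eq_zero _).1 h0
    have h2 := congrArg (fun u => u.app vL (dblGenL hab hb K)) h1
    refine res_dblGenL_ne_zero (K := K) hab hb (reach_refl vL) (by rw [lab_vL]; omega) ?_
    rw [res_self]
    exact h2
  · have eL := dbl_eq_add hab hb vL (f.app vL (dblGenL hab hb K))
    have eR := dbl_eq_add hab hb vR (f.app vR (dblGenR hab hb K))
    have mL := (mem_dblShape.1 ((dblShape K n a b).coord_mem vL
      (f.app vL (dblGenL hab hb K)))).2.2.1 rfl
    have mR := (mem_dblShape.1 ((dblShape K n a b).coord_mem vR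
      (f.app vR (dblGenR hab hb K)))).2.2.2 rfl
    rw [mL, sub_self, zero_smul, add_zero, res_self] at eL
    rw [mR, sub_zero, zero_smul, zero_add, res_self] at eR
    generalize (dblShape K n a b).coord vL (f.app vL (dblGenL hab hb K)) false = c at eL
    generalize (dblShape K n a b).coord vR (f.app vR (dblGenR hab hb K)) false = d at eR
    obtain ⟨w, hw⟩ := exists_lab (n := n) (j := b) (by omega) (by omega)
    have h1 := congrArg (res _ vL w) eL
    have h2 := congrArg (res _ vR w) eR
    rw [← app_res, map_smul] at h1 h2
    rw [← res_dblGen_eq hab hb hw.le, h1] at h2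
    have hcd : c = d := smul_left_injective K
      (res_dblGenL_ne_zero (K := K) hab hb (reach_vL (by omega)) (by omega)) h2
    refine ⟨c, dbl_hom_ext hab hb ?_ ?_⟩
    · rw [eL]; rfl
    · rw [eR, ← hcd]; rfl

lemma finrank_dbl (v : Vert n) : Module.finrank K ((dbl K n a b).obj v) =
    (if a < lab v then 1 else 0) + (if b < lab v ∧ lab v + 2 ≤ n then 1 else 0) := by
  classical
  by_cases h2 : b < lab v ∧ lab v + 2 ≤ n
  · rw [if_pos (by omega), if_pos h2]
    have e : (dbl K n a b).obj v ≃ₗ[K] (Bool → K) := LinearEquiv.ofBijective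
      ((dblShape K n a b).coord v) ⟨(dblShape K n a b).coord_injective v, fun x =>
        ⟨(dblShape K n a b).elt v x (mem_dblShape.2 ⟨fun h => by omega, fun h => by omega,
          fun h => by rw [h, lab_vL] at h2; omega, fun h => by rw [h, lab_vR] at h2; omega⟩), rfl⟩⟩
    rw [e.finrank_eq]
    simp
  · rw [if_neg h2, add_zero]
    split_ifs with h1
    · have key : ∀ x : (dbl K n a b).obj v, (dblShape K n a b).coord v x true =
          if v = vL then (dblShape K n a b).coord v x false else 0 := by
        intro x
        have hx := mem_dblShape.1 ((dblShape K n a b).coord_mem v x)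
        split_ifs with hL
        · exact hx.2.2.1 hL
        · rcases eq_vL_or_eq_vR_or v with h | h | h
          · exact absurd h hL
          · exact hx.2.2.2 h
          · exact hx.2.1 (by omega)
      have e : (dbl K n a b).obj v ≃ₗ[K] K := LinearEquiv.ofBijective
        ((LinearMap.proj false).comp ((dblShape K n a b).coord v)) ⟨fun x y hxy =>
          (dblShape K n a b).coord_injective v (funext fun i => by
            have hxy' : (dblShape K n a b).coord v x false =
              (dblShape K n a b).coord v y false := hxy
            cases i
            · exact hxy'
            · rw [key, key, hxy']), fun c =>
          ⟨(dblShape K n a b).elt v (fun i => bif i then (if v = vL then c else 0) else c)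
            (mem_dblShape.2 ⟨fun h => by omega, fun h => ?_, fun h => ?_, fun h => ?_⟩), rfl⟩⟩
      · rw [e.finrank_eq, Module.finrank_self]
      · exact if_neg fun hL => by rw [hL, lab_vL] at h; omega
      · exact if_pos h
      · exact if_neg fun hL => vL_ne_vR (hL.symm.trans h)
    · have : Subsingleton ((dbl K n a b).obj v) := by
        refine ⟨fun x y => (dblShape K n a b).coord_injective v (funext fun i => ?_)⟩
        have hx := mem_dblShape.1 ((dblShape K n a b).coord_mem v x)
        have hy := mem_dblShape.1 ((dblShape K n a b).coord_mem v y)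
        cases i
        · rw [hx.1 (by omega), hy.1 (by omega)]
        · rw [hx.2.1 (by omega), hy.2.1 (by omega)]
      exact Module.finrank_zero_of_subsingleton

end Gen

/-- The vertices with label `a` or `b`, as rows of a presentation. -/
abbrev RowTwo (n a b : ℕ) : Type := {v : Vert n // lab v = a ∨ lab v = b}

/-- The sources of the quiver, as columns of a presentation. -/
abbrev source (n : ℕ) [Fact (4 ≤ n)] (i : Bool) : Vert n := bif i then vL else vR

/-- The matrix presenting `(P(n-1) ⊕ P(n)) / (P(a) ⊕ P(b))`. -/
abbrev dblMat (K : Type u) [Field K] (n a b : ℕ) [Fact (4 ≤ n)] (hab : a < b) (hb : b + 2 ≤ n) :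
    Mat K n (RowTwo n a b) Bool where
  row i := i.1
  col := source n
  -- Row a is the relation x = 0 and row b is x - y = 0, for the generators x at n-1 and y at n. For
  -- a = 0 only row b exists.
  coeff i k := bif k then 1 else if lab i.1 = b then -1 else 0
  path i k _ := by
    have h : lab i.1 + 2 ≤ n := by rcases i.2 with h | h <;> omega
    cases k
    · exact reach_vR h
    · exact reach_vL h

variable (hab : a < b) (hb : b + 2 ≤ n)

lemma dblMat_eval (W : DRep K n) (m : ∀ k, W.obj (source n k)) (i : RowTwo n a b) :
    (dblMat K n a b hab hb).eval W m i = res W vL i.1 (m true) -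
      if lab i.1 = b then res W vR i.1 (m false) else 0 := by
  rw [Mat.eval_apply, Fintype.sum_bool]
  change (1 : K) • res W vL i.1 (m true) + (if lab i.1 = b then (-1 : K) else 0) •
    res W vR i.1 (m false) = _
  split_ifs <;> simp [sub_eq_add_neg]

/-- The generators of `(P(n-1) ⊕ P(n)) / (P(a) ⊕ P(b))`. -/
noncomputable def dblGen (K : Type u) [Field K] : ∀ k, (dbl K n a b).obj (source n k)
  | true => dblGenL hab hb K
  | false => dblGenR hab hb K

lemma dblMat_presents :
    (dblMat K n a b hab hb).Presents (dbl K n a b) (dblGen hab hb K) where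
  rel := funext fun i => by
    refine (dblMat_eval hab hb _ _ i).trans ?_
    split_ifs with h
    · exact sub_eq_zero.2 (res_dblGen_eq hab hb h.le)
    · rw [sub_zero]
      exact res_dblGenL_eq_zero hab hb (i.2.resolve_right h).le
  hom_ext f f' h := dbl_hom_ext hab hb (h true) (h false)
  desc {T} m hm := by
    have hm' := fun i => (dblMat_eval hab hb T m i).symm.trans (congrFun hm i)
    have hreach : ∀ {i w : Vert n}, lab w ≤ lab i → lab i + 2 ≤ n → reach i w := by
      intro i w h h'
      rcases h.eq_or_lt with h | h
      · rw [lab_injective h]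
        exact reach_refl i
      · exact reach_of_lt (by omega) (by omega)
    obtain ⟨f, hL, hR⟩ := exists_dbl_hom hab hb (m true) (m false) (fun w hw => by
        have h1 := one_le_lab w
        obtain ⟨i, hi⟩ := exists_lab (n := n) (j := b) (by omega) (by omega)
        have h2 := hm' ⟨i, Or.inr hi⟩
        rw [if_pos hi] at h2
        have hiw : reach i w := hreach (by omega) (by omega)
        rw [← res_res T (reach_vL (by omega)) hiw, ← res_res T (reach_vR (by omega)) hiw]
        exact congrArg (res T i w) (sub_eq_zero.1 h2)) (fun w hw => by
        have h1 := one_le_lab w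
        obtain ⟨i, hi⟩ := exists_lab (n := n) (j := a) (by omega) (by omega)
        have h2 := hm' ⟨i, Or.inl hi⟩
        rw [if_neg (by change ¬ lab i = b; omega), sub_zero] at h2
        have hiw : reach i w := hreach (by omega) (by omega)
        rw [← res_res T (reach_vL (by omega)) hiw]
        exact (congrArg (res T i w) h2).trans (map_zero _))
    refine ⟨f, fun k => ?_⟩
    cases k
    · exact hR
    · exact hL

end Dbl

end DRep

/-! ### Positions in the Auslander–Reiten quiver -/

namespace DRep

variable {n : ℕ} {K : Type u} [Field K]

lemma AtPosition.of_iso {p q : ℕ} {N N' : DRep K n} (h : AtPosition p q N) (e : N ≅ N') :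
    AtPosition p q N' := by
  cases p with
  | zero =>
    obtain ⟨v, hv, ⟨e'⟩⟩ := h
    exact ⟨v, hv, ⟨e.symm ≪≫ e'⟩⟩
  | succ p =>
    obtain ⟨S, hS, h1, ⟨e'⟩⟩ := h
    exact ⟨S, hS, h1, ⟨e.symm ≪≫ e'⟩⟩

/-- A pointwise kernel is a kernel. -/
lemma exists_comp_eq {N I J W : DRep K n} (j : N ⟶ I) (d : I ⟶ J)
    (hj : ∀ v, Function.Injective (j.app v))
    (hker : ∀ (v : Vert n) (x : I.obj v), d.app v x = 0 → ∃ y, j.app v y = x)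
    (k : W ⟶ I) (hk : k ≫ d = 0) : ∃ l : W ⟶ N, l ≫ j = k := by
  have hr : ∀ v (m : W.obj v), (k.app v).hom m ∈ LinearMap.range (j.app v).hom := fun v m =>
    hker v _ (congrArg (fun u => u.app v m) hk)
  let l : ∀ v, W.obj v →ₗ[K] N.obj v := fun v =>
    (LinearEquiv.ofInjective (j.app v).hom (hj v)).symm.toLinearMap.comp
      ((k.app v).hom.codRestrict _ (hr v))
  have hl : ∀ v m, j.app v (l v m) = k.app v m := fun v m =>
    congrArg Subtype.val ((LinearEquiv.ofInjective (j.app v).hom (hj v)).apply_symm_apply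
      ⟨k.app v m, hr v m⟩)
  refine ⟨mkHom l fun v w _ m => hj w ?_, hom_ext' fun v m => ?_⟩
  · rw [hl, app_res, app_res, hl]
  · exact hl v m

/-- The hypotheses say, vertex by vertex, that N is the kernel of a surjection νP₁ → νP₀, that is, N
= τC; so C lies one step to the right of N. -/
lemma Mat.Presents.atPosition_succ {ι κ : Type} [Fintype ι] [Fintype κ] {A : Mat K n ι κ}
    {C : DRep K n} {g : ∀ k, C.obj (A.col k)} (h : A.Presents C g) (hC : IsBrick C)
    (fC : IsFinDim C) {N : DRep K n} (hN : IsBrick N) (fN : IsFinDim N)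
    (j : N ⟶ injFam K A.row) (hj : ∀ v, Function.Injective (j.app v))
    (hw : ∀ v x, A.injMap.app v (j.app v x) = 0)
    (hker : ∀ (v : Vert n) (x : (injFam K A.row).obj v), A.injMap.app v x = 0 →
      ∃ y, j.app v y = x)
    (hsurj : ∀ v, Function.Surjective (A.injMap.app v)) {p q : ℕ} (hp : AtPosition p q N) :
    AtPosition (p + 1) q C := by
  have hmono := mono_of_injective j hj
  have hepi := epi_of_surjective _ hsurj
  have w : j ≫ A.injMap = 0 := hom_ext' fun v x => hw v x
  obtain ⟨E, f, g', w', hS⟩ := h.exists_isAlmostSplit hC fC hN.indecomposable fN j w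
    (KernelFork.IsLimit.ofι' j w fun k hk =>
      ⟨_, (exists_comp_eq j A.injMap hj hker k hk).choose_spec⟩)
  exact ⟨_, hS, hp, ⟨Iso.refl _⟩⟩

/-- The basis vector of a projective given by a path. -/
noncomputable def pathElt (K : Type u) [Field K] {t v : Vert n} (p : t ⟶ v) :
    (proj K (show DVertex n from t)).obj v :=
  (Finsupp.single p (1 : K) : (t ⟶ v) →₀ K)

lemma pathElt_ne_zero {t v : Vert n} (p : t ⟶ v) : pathElt K p ≠ 0 := fun h =>
  one_ne_zero (Finsupp.single_eq_zero.1 h)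

lemma exists_eq_smul_pathElt {t v : Vert n} (p : t ⟶ v)
    (y : (proj K (show DVertex n from t)).obj v) : ∃ c : K, y = c • pathElt K p := by
  refine ⟨(show (t ⟶ v) →₀ K from y) p, ?_⟩
  refine (Finsupp.ext fun q => ?_ :
    (show (t ⟶ v) →₀ K from y) = (show (t ⟶ v) →₀ K from y) p • Finsupp.single p (1 : K))
  rw [Subsingleton.elim q p, Finsupp.smul_apply, Finsupp.single_eq_same, smul_eq_mul, mul_one]

lemma res_pathElt {t v : Vert n} (p : t ⟶ v) :
    res (proj K (show DVertex n from t)) t v (pathElt K (𝟙 t)) = pathElt K p := by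
  rw [res_eq_map _ p]
  refine (Finsupp.mapDomain_single).trans ?_
  exact congrArg (fun x => (Finsupp.single x (1 : K) : (t ⟶ v) →₀ K)) (Subsingleton.elim _ _)

lemma nonempty_iso_proj (t : Vert n) :
    Nonempty (thin K 0 t ≅ proj K (show DVertex n from t)) := by
  obtain ⟨f, hf⟩ := exists_thin_hom (K := K) (a := 0) (pathElt K (𝟙 t))
    (fun w hw => absurd (one_le_lab w) (by omega))
  have hmono : Mono f := by
    refine mono_of_injective f fun v => (injective_iff_map_eq_zero (f.app v).hom).2 fun x hx => ?_
    by_cases h : reach t v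
    · have h1 : f.app v x = 0 := hx
      rw [thin_eq_smul v x, map_smul, app_res, hf, res_pathElt h.some] at h1
      rw [thin_eq_smul v x, (smul_eq_zero.1 h1).resolve_right (pathElt_ne_zero _), zero_smul]
    · rw [thin_eq_smul v x, res_of_not _ h, smul_zero]
  have hepi : Epi f := by
    refine epi_of_surjective f fun v y => ?_
    by_cases h : reach t v
    · obtain ⟨c, hc⟩ := exists_eq_smul_pathElt h.some y
      refine ⟨c • res _ t v (thinGen K 0 t), ?_⟩
      rw [map_smul, app_res, hf, res_pathElt h.some, hc]
    · refine ⟨0, ?_⟩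
      rw [map_zero]
      exact (Finsupp.ext fun p => absurd ⟨p⟩ h :
        (0 : (t ⟶ v) →₀ K) = (show (t ⟶ v) →₀ K from y))
  have : IsIso f := isIso_of_mono_of_epi f
  exact ⟨asIso f⟩

lemma atPosition_thin_zero (t : Vert n) : AtPosition 0 (lab t) (thin K 0 t) :=
  ⟨t, rfl, nonempty_iso_proj t⟩

lemma reach_row_iff {r v : Vert n} (hr : lab r + 2 ≤ n) : reach v r ↔ lab r ≤ lab v := by
  refine ⟨fun h => h.lab_le, fun h => ?_⟩
  rcases h.eq_or_lt with h | h
  · rw [lab_injective h]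
    exact reach_refl v
  · exact reach_of_lt h hr

/-- The kernel of I(a+1) → I(t) is one-dimensional at the vertices of label above a that do not
reach t, and `H` says that these are the vertices below t'. -/
lemma AtPosition.thin_succ {a : ℕ} {t t' : Vert n} (ha : a + 1 < lab t) (ha' : a + 3 ≤ n)
    (hat' : a < lab t') (H : ∀ v, a < lab v → (reach t' v ↔ ¬ reach v t)) {p q : ℕ}
    (hp : AtPosition p q (thin K a t')) : AtPosition (p + 1) q (thin K (a + 1) t) := by
  classical
  obtain ⟨r, hr⟩ := exists_lab (n := n) (j := a + 1) (by omega) (by omega)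
  have hrow : ∀ i : RowOne n (a + 1), i = ⟨r, hr⟩ := fun i => Subsingleton.elim _ _
  have hreach : ∀ (i : RowOne n (a + 1)) v, reach v i.1 ↔ a < lab v := fun i v => by
    rw [reach_row_iff (by rw [i.2]; omega), i.2]
    omega
  let A := thinMat K (a + 1) t ha ha'
  let j : thin K a t' ⟶ injFam K A.row := (injShape K A.row).lift
    (fun v => LinearMap.pi fun _ => (LinearMap.proj () : (Unit → K) →ₗ[K] K).comp
      ((thinShape K a t').coord v))
    (fun v m => mem_injShape.2 fun i h => mem_thinShape.1 ((thinShape K a t').coord_mem v m)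
      fun h' => h ((hreach i v).2 h'.2))
    (fun v w h m => funext fun i => by
      change (thinShape K a t').coord w (res _ v w m) () = _
      rw [Shape.coord_res _ h, Shape.trunc_apply, Shape.trunc_apply]
      exact if_congr (hreach i w).symm rfl rfl)
  have hjc : ∀ v m i, (injShape K A.row).coord v (j.app v m) i =
    (thinShape K a t').coord v m () := fun v m i => rfl
  have hsum : ∀ v (x : (injFam K A.row).obj v), (injShape K A.col).coord v (A.injMap.app v x) () =
      if reach v t then (injShape K A.row).coord v x ⟨r, hr⟩ else 0 := by
    intro v x
    rw [Mat.coord_injMap]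
    refine if_congr Iff.rfl ?_ rfl
    rw [Finset.sum_eq_single ⟨r, hr⟩ (fun i _ h => absurd (hrow i) h)
      (fun h => absurd (Finset.mem_univ _) h)]
    exact one_mul _
  refine (thinMat_presents ha ha').atPosition_succ (isBrick_thin ha) (isFinDim_thin _ _)
    (isBrick_thin hat') (isFinDim_thin _ _) j (fun v x y hxy => ?_) (fun v x => ?_)
    (fun v x hx => ?_) (fun v y => ?_) hp
  · refine (thinShape K a t').coord_injective v (funext fun i => ?_)
    exact congrFun (congrArg ((injShape K A.row).coord v) hxy) ⟨r, hr⟩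
  · refine (injShape K A.col).coord_injective v (funext fun k => ?_)
    refine (hsum v _).trans ?_
    rw [hjc, map_zero]
    split_ifs with h
    · exact mem_thinShape.1 ((thinShape K a t').coord_mem v x) fun h' => (H v h'.2).1 h'.1 h
    · rfl
  · refine ⟨(thinShape K a t').elt v (fun _ => (injShape K A.row).coord v x ⟨r, hr⟩)
      (mem_thinShape.2 fun h => ?_), (injShape K A.row).coord_injective v (funext fun i => ?_)⟩
    · by_cases hv : a < lab v
      · have h1 : reach v t := not_not.1 fun h' => h ⟨(H v hv).2 h', hv⟩
        have h2 := hsum v x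
        rw [if_pos h1, hx, map_zero] at h2
        exact h2.symm
      · exact mem_injShape.1 ((injShape K A.row).coord_mem v x) ⟨r, hr⟩ fun h' =>
        hv ((hreach ⟨r, hr⟩ v).1 h')
    · rw [hjc, Shape.coord_elt, hrow i]
  · refine ⟨(injShape K A.row).elt v (fun _ => (injShape K A.col).coord v y ())
      (mem_injShape.2 fun i h => ?_), (injShape K A.col).coord_injective v (funext fun k => ?_)⟩
    · exact mem_injShape.1 ((injShape K A.col).coord_mem v y) () fun h' =>
        h (h'.trans (reach_of_lt (by rw [i.2]; exact ha) (by rw [i.2]; exact ha')))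
    · refine (hsum v _).trans ?_
      split_ifs with h
      · rfl
      · exact (mem_injShape.1 ((injShape K A.col).coord_mem v y) () h).symm

variable [h4 : Fact (4 ≤ n)]

lemma reach_to_vL {v : Vert n} : reach v vL ↔ v = vL := by
  refine ⟨fun h => ?_, fun h => h ▸ reach_refl _⟩
  rcases reach_iff.1 h with h | h
  · exact h.symm
  · have := h4.out
    rw [lab_vL] at h
    omega

lemma reach_to_vR {v : Vert n} : reach v vR ↔ v = vR := by
  refine ⟨fun h => ?_, fun h => h ▸ reach_refl _⟩
  rcases reach_iff.1 h with h | h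
  · exact h.symm
  · rw [lab_vR] at h
    omega

lemma reach_vR_iff {v : Vert n} : reach vR v ↔ v ≠ vL := by
  refine ⟨fun h h' => ?_, fun h => not_not.1 fun h' => h (not_reach_vR h')⟩
  rw [h', reach_to_vL] at h
  exact vL_ne_vR h.symm

lemma reach_vL_iff {v : Vert n} : reach vL v ↔ v ≠ vR := by
  refine ⟨fun h h' => ?_, fun h => not_not.1 fun h' => h (not_reach_vL h')⟩
  rw [h', reach_to_vR] at h
  exact vL_ne_vR h

-- On the arm, the vertices not reaching t are those below the next vertex down, together with none
-- of label above a elsewhere; so τ lowers both t and a by one until a = 0.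
omit h4 in
lemma atPosition_thin {a : ℕ} {t : Vert n} (ha : a < lab t) (ht : lab t + 2 ≤ n) :
    AtPosition a (lab t - a) (thin K a t) := by
  induction a generalizing t with
  | zero => exact atPosition_thin_zero t
  | succ a ih =>
    obtain ⟨t', ht'⟩ := exists_lab (n := n) (j := lab t - 1) (by omega) (by omega)
    have := ih (t := t') (by omega) (by omega)
    rw [ht', show lab t - 1 - a = lab t - (a + 1) by omega] at this
    refine this.thin_succ ha (by omega) (by omega) fun v hv => ?_
    rw [reach_row_iff ht, reach_iff]
    constructor
    · rintro (rfl | h) <;> omega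
    · intro h
      rcases eq_or_ne (lab v) (lab t') with h1 | h1
      · exact Or.inl (lab_injective h1)
      · right; omega

/-- The map from I(a+1) to the simple injective at one source removes only that source from the
support, leaving a module generated at the other. Thus τ exchanges the sources. -/
lemma atPosition_thin_source (a : ℕ) (ha : a + 2 ≤ n) :
    AtPosition a (if Even a then n - 1 else n) (thin K a (vL : Vert n)) ∧
      AtPosition a (if Even a then n else n - 1) (thin K a (vR : Vert n)) := by
  induction a with
  | zero => exact ⟨atPosition_thin_zero vL, atPosition_thin_zero vR⟩
  | succ a ih =>
    obtain ⟨hL, hR⟩ := ih (by omega)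
    have key : ∀ x y : ℕ, (if Even (a + 1) then x else y) = if Even a then y else x := by
      intro x y
      by_cases h : Even a
      · rw [if_pos h, if_neg (by rw [Nat.even_add_one]; exact not_not.2 h)]
      · rw [if_neg h, if_pos (Nat.even_add_one.2 h)]
    rw [key, key]
    constructor
    · exact hR.thin_succ (by rw [lab_vL]; omega) ha (by rw [lab_vR]; omega) fun v _ => by
        rw [reach_vR_iff, reach_to_vL]
    · exact hL.thin_succ (by rw [lab_vR]; omega) ha (by rw [lab_vL]; omega) fun v _ => by
        rw [reach_vL_iff, reach_to_vR]

end DRep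

namespace DRep

variable {n : ℕ} {K : Type u} [Field K]

lemma sum_rowTwo {a b : ℕ} (hab : a ≠ b) {ra rb : Vert n} (ha : lab ra = a) (hb : lab rb = b)
    {M : Type*} [AddCommMonoid M] (f : RowTwo n a b → M) :
    ∑ i, f i = f ⟨ra, Or.inl ha⟩ + f ⟨rb, Or.inr hb⟩ := by
  classical
  have : (Finset.univ : Finset (RowTwo n a b)) = {⟨ra, Or.inl ha⟩, ⟨rb, Or.inr hb⟩} := by
    ext i
    simp only [Finset.mem_univ, Finset.mem_insert, Finset.mem_singleton, true_iff]
    exact i.2.imp (fun h => Subtype.ext (lab_injective (h.trans ha.symm)))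
      (fun h => Subtype.ext (lab_injective (h.trans hb.symm)))
  rw [this, Finset.sum_pair fun h => hab (by rw [← ha, ← hb]; exact congrArg (fun i => lab i.1) h)]

lemma rowTwo_zero_eq {b : ℕ} {rb : Vert n} (hb : lab rb = b) (i : RowTwo n 0 b) :
    i = ⟨rb, Or.inr hb⟩ :=
  Subtype.ext (lab_injective ((i.2.resolve_left
    fun h => by have := one_le_lab i.1; omega).trans hb.symm))

variable [h4 : Fact (4 ≤ n)]

-- I(n-1) and I(n) are simple, so the map of injectives imposes one condition at each source and
-- none on the arm.
open Classical in
lemma coord_injMap_dblMat {a b : ℕ} (hab : a < b) (hb : b + 2 ≤ n) {ra rb : Vert n}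
    (ha' : lab ra = a) (hb' : lab rb = b) (v : Vert n)
    (x : (injFam K (dblMat K n a b hab hb).row).obj v) (k : Bool) :
    (injShape K (dblMat K n a b hab hb).col).coord v ((dblMat K n a b hab hb).injMap.app v x) k =
      if v = source n k then (bif k then
        (injShape K (dblMat K n a b hab hb).row).coord v x ⟨ra, Or.inl ha'⟩ +
          (injShape K (dblMat K n a b hab hb).row).coord v x ⟨rb, Or.inr hb'⟩
        else -(injShape K (dblMat K n a b hab hb).row).coord v x ⟨rb, Or.inr hb'⟩) else 0 := by
  rw [Mat.coord_injMap]
  cases k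
  · refine if_congr reach_to_vR ?_ rfl
    rw [sum_rowTwo hab.ne ha' hb']
    change (if lab ra = b then (-1 : K) else 0) * _ + (if lab rb = b then (-1 : K) else 0) * _ = _
    rw [if_neg (by omega), if_pos hb', zero_mul, zero_add, neg_one_mul, cond_false]
  · refine if_congr reach_to_vL ?_ rfl
    rw [sum_rowTwo hab.ne ha' hb']
    change (1 : K) * _ + (1 : K) * _ = _
    rw [one_mul, one_mul, cond_true]

open Classical in
lemma coord_injMap_dblMat_zero {b : ℕ} (h0 : 0 < b) (hb : b + 2 ≤ n) {rb : Vert n}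
    (hb' : lab rb = b) (v : Vert n)
    (x : (injFam K (dblMat K n 0 b h0 hb).row).obj v) (k : Bool) :
    (injShape K (dblMat K n 0 b h0 hb).col).coord v ((dblMat K n 0 b h0 hb).injMap.app v x) k =
      if v = source n k then (bif k then
        (injShape K (dblMat K n 0 b h0 hb).row).coord v x ⟨rb, Or.inr hb'⟩
        else -(injShape K (dblMat K n 0 b h0 hb).row).coord v x ⟨rb, Or.inr hb'⟩) else 0 := by
  rw [Mat.coord_injMap]
  have hs : ∀ f : RowTwo n 0 b → K, ∑ i, f i = f ⟨rb, Or.inr hb'⟩ := fun f =>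
    Finset.sum_eq_single _ (fun i _ h => absurd (rowTwo_zero_eq hb' i) h)
      (fun h => absurd (Finset.mem_univ _) h)
  cases k
  · refine if_congr reach_to_vR ?_ rfl
    rw [hs]
    change (if lab rb = b then (-1 : K) else 0) * _ = _
    rw [if_pos hb', neg_one_mul, cond_false]
  · refine if_congr reach_to_vL ?_ rfl
    rw [hs]
    change (1 : K) * _ = _
    rw [one_mul, cond_true]

/-- The kernel of I(a+1) ⊕ I(b+1) → I(n-1) ⊕ I(n) is cut out by x_a + x_b = 0 at n-1 and x_b = 0 at
n. With x_a the `false` and -x_b the `true` coordinate, these are the conditions of `dblShape`. -/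
lemma dbl_succ_atPosition {a b : ℕ} (hab : a < b) (hb : b + 3 ≤ n) {p q : ℕ}
    (hp : AtPosition p q (dbl K n a b)) : AtPosition (p + 1) q (dbl K n (a + 1) (b + 1)) := by
  classical
  obtain ⟨ra, hra⟩ := exists_lab (n := n) (j := a + 1) (by omega) (by omega)
  obtain ⟨rb, hrb⟩ := exists_lab (n := n) (j := b + 1) (by omega) (by omega)
  have hab' : a + 1 < b + 1 := by omega
  let A := dblMat K n (a + 1) (b + 1) hab' hb
  let ia : RowTwo n (a + 1) (b + 1) := ⟨ra, Or.inl hra⟩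
  let ib : RowTwo n (a + 1) (b + 1) := ⟨rb, Or.inr hrb⟩
  have hi : ∀ i : RowTwo n (a + 1) (b + 1), i = ia ∨ i = ib := fun i =>
    i.2.imp (fun h => Subtype.ext (lab_injective (h.trans hra.symm)))
      (fun h => Subtype.ext (lab_injective (h.trans hrb.symm)))
  have hsum := coord_injMap_dblMat (K := K) hab' hb hra hrb
  let φ : RowTwo n (a + 1) (b + 1) → (Bool → K) →ₗ[K] K := fun i =>
    if lab i.1 = b + 1 then -(LinearMap.proj true : (Bool → K) →ₗ[K] K)
      else (LinearMap.proj false : (Bool → K) →ₗ[K] K)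
  have hφa : φ ia = LinearMap.proj false := if_neg (by change ¬ lab ra = _; omega)
  have hφb : φ ib = -LinearMap.proj true := if_pos hrb
  have hra' : ∀ v, reach v ra ↔ a < lab v := fun v => by
    rw [reach_row_iff (by omega), hra]; omega
  have hrb' : ∀ v, reach v rb ↔ b < lab v := fun v => by
    rw [reach_row_iff (by omega), hrb]; omega
  let j : dbl K n a b ⟶ injFam K A.row := (injShape K A.row).lift
    (fun v => LinearMap.pi fun i => (φ i).comp ((dblShape K n a b).coord v))
    (fun v m => mem_injShape.2 fun i h => by
      have hm := mem_dblShape.1 ((dblShape K n a b).coord_mem v m)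
      change φ i _ = 0
      rcases hi i with rfl | rfl
      · rw [hφa]
        exact hm.1 (not_lt.1 fun h' => h ((hra' v).2 h'))
      · rw [hφb]
        exact neg_eq_zero.2 (hm.2.1 (not_lt.1 fun h' => h ((hrb' v).2 h'))))
    (fun v w h m => funext fun i => by
      change φ i ((dblShape K n a b).coord w (res _ v w m)) = _
      rw [Shape.coord_res _ h, Shape.trunc_apply]
      change _ = if _ then φ i ((dblShape K n a b).coord v m) else 0
      rcases hi i with rfl | rfl
      · rw [hφa, LinearMap.proj_apply, LinearMap.proj_apply, dblShape_trunc_false]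
        exact if_congr (hra' w).symm rfl rfl
      · rw [hφb, LinearMap.neg_apply, LinearMap.proj_apply, LinearMap.neg_apply,
          LinearMap.proj_apply, dblShape_trunc_true]
        rw [apply_ite Neg.neg, neg_zero]
        exact if_congr (hrb' w).symm rfl rfl)
  have hja : ∀ v m, (injShape K A.row).coord v (j.app v m) ia =
      (dblShape K n a b).coord v m false := fun v m => by
    change φ ia _ = _
    rw [hφa]
    rfl
  have hjb : ∀ v m, (injShape K A.row).coord v (j.app v m) ib =
      -(dblShape K n a b).coord v m true := fun v m => by
    change φ ib _ = _
    rw [hφb]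
    rfl
  refine (dblMat_presents hab' hb).atPosition_succ (isBrick_dbl hab' hb) (isFinDim_dbl _ _)
    (isBrick_dbl hab (by omega)) (isFinDim_dbl _ _) j (fun v x y hxy => ?_) (fun v x => ?_)
    (fun v x hx => ?_) (fun v y => ?_) hp
  · refine (dblShape K n a b).coord_injective v (funext fun i => ?_)
    cases i
    · rw [← hja, ← hja]
      exact congrFun (congrArg ((injShape K A.row).coord v) hxy) ia
    · rw [← neg_inj, ← hjb, ← hjb]
      exact congrFun (congrArg ((injShape K A.row).coord v) hxy) ib
  · have hm := mem_dblShape.1 ((dblShape K n a b).coord_mem v x)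
    refine (injShape K A.col).coord_injective v (funext fun k => ?_)
    refine (hsum v _ k).trans ?_
    rw [map_zero, hja, hjb, Pi.zero_apply]
    split_ifs with h
    · cases k
      · rw [cond_false, neg_neg]
        exact hm.2.2.2 h
      · rw [cond_true, hm.2.2.1 h, add_neg_cancel]
    · rfl
  · have hk := fun k => (hsum v x k).symm.trans
      (congrFun ((congrArg ((injShape K A.col).coord v) hx).trans (map_zero _)) k)
    have hx' := mem_injShape.1 ((injShape K A.row).coord_mem v x)
    refine ⟨(dblShape K n a b).elt v (fun k => bif k then -(injShape K A.row).coord v x ib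
      else (injShape K A.row).coord v x ia) (mem_dblShape.2 ⟨fun h => ?_, fun h => ?_,
        fun h => ?_, fun h => ?_⟩), (injShape K A.row).coord_injective v (funext fun i => ?_)⟩
    · exact hx' ia fun h' => by have := (hra' v).1 h'; omega
    · exact neg_eq_zero.2 (hx' ib fun h' => by have := (hrb' v).1 h'; omega)
    · have := hk true
      rw [if_pos (show v = source n true from h), cond_true] at this
      exact (eq_neg_of_add_eq_zero_left this).symm
    · have := hk false
      rw [if_pos (show v = source n false from h), cond_false] at this
      exact this
    · rcases hi i with rfl | rfl
      · rw [hja]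
        rfl
      · rw [hjb]
        exact neg_neg _
  · have hy := mem_injShape.1 ((injShape K A.col).coord_mem v y)
    let z : K := if v = vR then -(injShape K A.col).coord v y false else 0
    let z' : K := if v = vL then (injShape K A.col).coord v y true else 0
    have hz : ∀ c, lab v ≤ c → c + 2 ≤ n → z = 0 ∧ z' = 0 := fun c h h' =>
      ⟨if_neg fun hv => by rw [hv, lab_vR] at h; omega,
        if_neg fun hv => by rw [hv, lab_vL] at h; omega⟩
    refine ⟨(injShape K A.row).elt v (fun i => if lab i.1 = b + 1 then z else z')
      (mem_injShape.2 fun i h => ?_), (injShape K A.col).coord_injective v (funext fun k => ?_)⟩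
    · rcases hi i with rfl | rfl
      · rw [(hz a (not_lt.1 fun h' => h ((hra' v).2 h')) (by omega)).1,
          (hz a (not_lt.1 fun h' => h ((hra' v).2 h')) (by omega)).2, ite_self]
      · rw [(hz b (not_lt.1 fun h' => h ((hrb' v).2 h')) (by omega)).1,
          (hz b (not_lt.1 fun h' => h ((hrb' v).2 h')) (by omega)).2, ite_self]
    · refine (hsum v _ k).trans ?_
      rw [Shape.coord_elt, if_neg (by omega : ¬ lab ra = b + 1), if_pos hrb]
      by_cases h : v = source n k
      · rw [if_pos h]
        cases k
        · rw [cond_false]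
          exact (congrArg Neg.neg (if_pos (show v = vR from h))).trans (neg_neg _)
        · rw [cond_true]
          exact (congrArg₂ (· + ·) (if_pos (show v = vL from h))
            (if_neg (fun h' => vL_ne_vR (h.symm.trans h')))).trans (add_zero _)
      · rw [if_neg h]
        refine (hy k fun h' => h ?_).symm
        cases k
        · exact reach_to_vR.1 h'
        · exact reach_to_vL.1 h'

/-- Only I(b+1) is left on the row side. The kernel loses both sources and keeps the labels from b+1
to n-2, which is P(n-2)/P(b). -/
lemma dbl_zero_atPosition {b : ℕ} (hb : b + 3 ≤ n) {t : Vert n} (ht : lab t + 2 = n) {p q : ℕ}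
    (hp : AtPosition p q (thin K b t)) : AtPosition (p + 1) q (dbl K n 0 (b + 1)) := by
  classical
  obtain ⟨rb, hrb⟩ := exists_lab (n := n) (j := b + 1) (by omega) (by omega)
  have h0 : 0 < b + 1 := by omega
  let A := dblMat K n 0 (b + 1) h0 hb
  let ib : RowTwo n 0 (b + 1) := ⟨rb, Or.inr hrb⟩
  have hi : ∀ i : RowTwo n 0 (b + 1), i = ib := rowTwo_zero_eq hrb
  have hsum := coord_injMap_dblMat_zero (K := K) h0 hb hrb
  have hrb' : ∀ (i : RowTwo n 0 (b + 1)) v, reach v i.1 ↔ b < lab v := fun i v => by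
    rw [hi i, reach_row_iff (by change lab rb + 2 ≤ n; omega)]
    change lab rb ≤ _ ↔ _
    omega
  have ht' : ∀ v, reach t v ↔ lab v + 2 ≤ n := fun v => by
    rw [reach_iff]
    constructor
    · rintro (rfl | h) <;> omega
    · intro h
      rcases eq_or_ne (lab v) (lab t) with h1 | h1
      · exact Or.inl (lab_injective h1)
      · right; omega
  let j : thin K b t ⟶ injFam K A.row := (injShape K A.row).lift
    (fun v => LinearMap.pi fun _ => (LinearMap.proj () : (Unit → K) →ₗ[K] K).comp
      ((thinShape K b t).coord v))
    (fun v m => mem_injShape.2 fun i h => mem_thinShape.1 ((thinShape K b t).coord_mem v m)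
      fun h' => h ((hrb' i v).2 h'.2))
    (fun v w h m => funext fun i => by
      change (thinShape K b t).coord w (res _ v w m) () = _
      rw [Shape.coord_res _ h, Shape.trunc_apply, Shape.trunc_apply]
      exact if_congr (hrb' i w).symm rfl rfl)
  have hjc : ∀ v m i, (injShape K A.row).coord v (j.app v m) i =
    (thinShape K b t).coord v m () := fun v m i => rfl
  refine (dblMat_presents h0 hb).atPosition_succ (isBrick_dbl h0 hb) (isFinDim_dbl _ _)
    (isBrick_thin (by omega)) (isFinDim_thin _ _) j (fun v x y hxy => ?_) (fun v x => ?_)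
    (fun v x hx => ?_) (fun v y => ?_) hp
  · refine (thinShape K b t).coord_injective v (funext fun i => ?_)
    exact congrFun (congrArg ((injShape K A.row).coord v) hxy) ib
  · refine (injShape K A.col).coord_injective v (funext fun k => ?_)
    refine (hsum v _ k).trans ?_
    rw [map_zero, hjc]
    split_ifs with h
    · have : (thinShape K b t).coord v x () = 0 := by
        refine mem_thinShape.1 ((thinShape K b t).coord_mem v x) fun h' => ?_
        have h1 := (ht' v).1 h'.1
        rw [h] at h1
        cases k
        · exact absurd h1 (by change ¬ (lab vR + 2 ≤ n); rw [lab_vR]; omega)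
        · exact absurd h1 (by change ¬ (lab vL + 2 ≤ n); rw [lab_vL]; omega)
      rw [this, neg_zero]
      cases k <;> rfl
    · rfl
  · have hk := fun k => (hsum v x k).symm.trans
      (congrFun ((congrArg ((injShape K A.col).coord v) hx).trans (map_zero _)) k)
    refine ⟨(thinShape K b t).elt v (fun _ => (injShape K A.row).coord v x ib)
      (mem_thinShape.2 fun h => ?_), (injShape K A.row).coord_injective v (funext fun i => ?_)⟩
    · rcases eq_vL_or_eq_vR_or v with h1 | h1 | h1
      · have := hk true
        rwa [if_pos (show v = source n true from h1)] at this
      · have := hk false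
        rw [if_pos (show v = source n false from h1)] at this
        exact neg_eq_zero.1 this
      · refine mem_injShape.1 ((injShape K A.row).coord_mem v x) ib fun h' => h ⟨(ht' v).2 h1, ?_⟩
        exact (hrb' ib v).1 h'
    · rw [hjc, Shape.coord_elt, hi i]
  · have hy := mem_injShape.1 ((injShape K A.col).coord_mem v y)
    refine ⟨(injShape K A.row).elt v (fun _ => if v = vL then (injShape K A.col).coord v y true
        else if v = vR then -(injShape K A.col).coord v y false else 0)
      (mem_injShape.2 fun i h => ?_), (injShape K A.col).coord_injective v (funext fun k => ?_)⟩
    · rw [if_neg, if_neg]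
      · exact fun hv => h ((hrb' i v).2 (by rw [hv, lab_vR]; omega))
      · exact fun hv => h ((hrb' i v).2 (by rw [hv, lab_vL]; omega))
    · refine (hsum v _ k).trans ?_
      rw [Shape.coord_elt]
      by_cases h : v = source n k
      · rw [if_pos h]
        cases k
        · rw [cond_false, if_neg (fun h' => vL_ne_vR (h'.symm.trans h)),
            if_pos (show v = vR from h), neg_neg]
        · rw [cond_true, if_pos (show v = vL from h)]
      · rw [if_neg h]
        refine (hy k fun h' => h ?_).symm
        cases k
        · exact reach_to_vR.1 h'
        · exact reach_to_vL.1 h'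

/-- Applying τ lowers a and b together, so b - a is constant until a = 0; one more step lands on a
quotient of P(n-2), whose position is known. -/
lemma atPosition_dbl {a b : ℕ} (hab : a < b) (hb : b + 2 ≤ n) :
    AtPosition b (n - 1 - (b - a)) (dbl K n a b) := by
  induction a generalizing b with
  | zero =>
    obtain ⟨b, rfl⟩ : ∃ c, b = c + 1 := ⟨b - 1, by omega⟩
    obtain ⟨t, ht⟩ := exists_lab (n := n) (j := n - 2) (by omega) (by omega)
    have := atPosition_thin (K := K) (a := b) (t := t) (by omega) (by omega)
    rw [show n - 1 - (b + 1 - 0) = lab t - b by omega]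
    exact dbl_zero_atPosition (by omega) (by omega) this
  | succ a ih =>
    obtain ⟨b, rfl⟩ : ∃ c, b = c + 1 := ⟨b - 1, by omega⟩
    rw [show n - 1 - (b + 1 - (a + 1)) = n - 1 - (b - a) by omega]
    exact dbl_succ_atPosition (by omega) (by omega) (ih (by omega) (by omega))

end DRep

/-! ### Classification of the indecomposables -/

namespace DRep

variable {n : ℕ} {K : Type u} [Field K]

/-- The vector `u` defines a map from the thin module to M, since it dies below r; the functional
`φ` defines a map back, and their composite is nonzero. -/
lemma nonempty_iso_thin (hn : 2 ≤ n) {M : DRep K n} (hM : Indecomposable M) {t r : Vert n} (hr : reach t r)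
    (u : M.obj t) (φ : M.obj r →ₗ[K] K) (hu : φ (res M t r u) ≠ 0)
    (hu' : ∀ w, lab w < lab r → lab w + 2 ≤ n → res M t w u = 0)
    (hφ : ∀ v, ¬ reach t v → ∀ m, φ (res M v r m) = 0) :
    ∃ a, a < lab t ∧ a + 2 ≤ n ∧ Nonempty (M ≅ thin K a t) := by
  have h1 := one_le_lab r
  have h2 := hr.lab_le
  -- If r is a source then r = t and the module is the simple P(t)/P(n-2); the cap is needed for r =
  -- n, where `lab r - 1` is n-1.
  let a := min (lab r - 1) (n - 2)
  have hat : a < lab t := by omega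
  have ha : ∀ w, reach t w → (a < lab w ↔ reach w r) := by
    intro w hw
    refine ⟨fun h => ?_, fun h => by have := h.lab_le; omega⟩
    by_cases h3 : lab r + 2 ≤ n
    · exact (reach_row_iff h3).2 (by omega)
    · have hrt : r = t := (reach_iff.1 hr).resolve_right fun h => h3 h.2
      have hwt : w = t := (reach_iff.1 hw).resolve_right fun h' => by omega
      rw [hrt, hwt]
      exact reach_refl t
  refine ⟨a, hat, by omega, ?_⟩
  obtain ⟨i, hi⟩ := exists_thin_hom (a := a) u fun w hw => hu' w (by omega) (by omega)
  let p : M ⟶ thin K a t := (thinShape K a t).lift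
    (fun v => LinearMap.pi fun _ => φ.comp (res M v r))
    (fun v m => mem_thinShape.2 fun h => by
      change φ (res M v r m) = 0
      by_cases hv : reach t v
      · rw [res_of_not _ fun h' => h ⟨hv, (ha v hv).2 h'⟩, map_zero]
      · exact hφ v hv m)
    (fun v w h m => funext fun k => by
      classical
      rw [Shape.trunc_apply]
      refine (?_ : φ (res M w r (res M v w m)) = if a < lab w then φ (res M v r m) else 0).trans
        (if_congr Iff.rfl rfl rfl)
      by_cases hw : reach t w
      · by_cases h' : reach w r
        · rw [if_pos ((ha w hw).2 h'), res_res _ h h']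
        · rw [if_neg (mt (ha w hw).1 h'), res_of_not _ h', map_zero]
      · rw [hφ w hw, hφ v (fun hv => hw (hv.trans h)), ite_self])
  refine (isBrick_thin hat).nonempty_iso hM i p fun h0 => hu ?_
  have := congrArg (fun f => (thinShape K a t).coord t (f.app t (thinGen K a t)) ()) h0
  change φ (res M t r (i.app t (thinGen K a t))) = 0 at this
  rwa [hi] at this

lemma exists_dual_ne_zero {V : Type*} [AddCommGroup V] [Module K V] {S : Submodule K V} {x : V}
    (hx : x ∉ S) : ∃ φ : V →ₗ[K] K, φ x ≠ 0 ∧ S ≤ LinearMap.ker φ := by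
  obtain ⟨φ, h1, h2⟩ := Submodule.exists_le_ker_of_notMem hx
  exact ⟨φ, h1, h2⟩

/-- Take r to be the lowest vertex to which some vector at t survives; that vector and a functional
not vanishing on its image do the job. -/
lemma exists_iso_thin_of_subsingleton (hn : 2 ≤ n) {M : DRep K n} (hM : Indecomposable M) {t : Vert n}
    (ht : Nontrivial (M.obj t)) (h0 : ∀ v, ¬ reach t v → Subsingleton (M.obj v)) :
    ∃ a, a < lab t ∧ a + 2 ≤ n ∧ Nonempty (M ≅ thin K a t) := by
  classical
  obtain ⟨u₀, hu₀⟩ := exists_ne (0 : M.obj t)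
  obtain ⟨r, hr, hmin⟩ := Finset.exists_min_image
    (Finset.univ.filter fun r : Vert n => reach t r ∧ ∃ u, res M t r u ≠ 0) lab
    ⟨t, by simpa using ⟨reach_refl t, u₀, by rwa [res_self]⟩⟩
  simp only [Finset.mem_filter, Finset.mem_univ, true_and] at hr hmin
  obtain ⟨hr, u, hu⟩ := hr
  obtain ⟨φ, hφ, -⟩ := exists_dual_ne_zero (K := K) (S := ⊥) (x := res M t r u) (by simpa using hu)
  refine nonempty_iso_thin hn hM hr u φ hφ (fun w hw _ => ?_) fun v hv m => ?_
  · by_contra h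
    by_cases h' : reach t w
    · exact absurd (hmin w ⟨h', u, h⟩) (by omega)
    · exact h (res_of_not _ h' _)
  · have := h0 v hv
    rw [Subsingleton.elim m 0, map_zero, map_zero]

variable [h4 : Fact (4 ≤ n)]

/-- The vectors `u` and `x`, which agree at c, give a map from the model to M. The functional `θ`
factors through the space at ra, and through the space at rb modulo the image of the source n; these
two factorizations are the coordinates of a map back. -/
lemma nonempty_iso_dbl {M : DRep K n} (hM : Indecomposable M) {ra rb c : Vert n} (u : M.obj vL)
    (x : M.obj vR) (hra : lab ra ≤ lab c) (hc : lab c + 2 ≤ n)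
    (hrb : ∀ w, w ≠ vR → (lab c < lab w ↔ reach w rb))
    (hux : res M vL c u = res M vR c x) (hu : ∀ w, lab w < lab ra → res M vL w u = 0)
    (θ : M.obj vL →ₗ[K] K) (hθ : θ u ≠ 0) (hθa : LinearMap.ker (res M vL ra) ≤ LinearMap.ker θ)
    (hθb : (LinearMap.range (res M vR rb)).comap (res M vL rb) ≤ LinearMap.ker θ) :
    ∃ a b, a < b ∧ b + 2 ≤ n ∧ Nonempty (M ≅ dbl K n a b) := by
  have h1 := one_le_lab ra
  let a := lab ra - 1
  have hab : a < lab c := by omega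
  obtain ⟨ψ, hψ⟩ := exists_eq_comp_of_ker_le (res M vL ra) θ hθa
  obtain ⟨l, hl⟩ := exists_eq_comp_of_ker_le
    ((LinearMap.range (res M vR rb)).mkQ.comp (res M vL rb)) θ (by
      rwa [LinearMap.ker_comp, Submodule.ker_mkQ])
  let φ := l.comp (LinearMap.range (res M vR rb)).mkQ
  have hφR : ∀ m, φ (res M vR rb m) = 0 := fun m => by
    change l ((LinearMap.range (res M vR rb)).mkQ (res M vR rb m)) = 0
    rw [(LinearMap.mem_ker (f := (LinearMap.range (res M vR rb)).mkQ)).1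
      (by rw [Submodule.ker_mkQ]; exact ⟨m, rfl⟩), map_zero]
  have hφL : ∀ m, φ (res M vL rb m) = θ m := fun m => LinearMap.congr_fun hl m
  have hψL : ∀ m, ψ (res M vL ra m) = θ m := fun m => LinearMap.congr_fun hψ m
  have hra' : ∀ w, a < lab w ↔ reach w ra := fun w => by
    rw [reach_row_iff (by omega)]; omega
  obtain ⟨i, hiL, hiR⟩ := exists_dbl_hom hab hc u x (fun w hw => by
      have hcw : reach c w := by
        rcases hw.eq_or_lt with h | h
        · rw [lab_injective h]; exact reach_refl c
        · exact reach_of_lt h (by omega)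
      rw [← res_res M (reach_vL hc) hcw, ← res_res M (reach_vR hc) hcw, hux])
    (fun w hw => hu w (by omega))
  let χ : ∀ v, Bool → M.obj v →ₗ[K] K := fun v k =>
    bif k then φ.comp (res M v rb) else ψ.comp (res M v ra)
  let p : M ⟶ dbl K n a (lab c) := (dblShape K n a (lab c)).lift
    (fun v => LinearMap.pi fun k => χ v k)
    (fun v m => by
      refine mem_dblShape.2 ⟨fun h => ?_, fun h => ?_, fun h => ?_, fun h => ?_⟩
      · change ψ (res M v ra m) = 0
        rw [res_of_not _ (mt (hra' v).2 (not_lt.2 h)), map_zero]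
      · change φ (res M v rb m) = 0
        rw [res_of_not _ (mt (hrb v (fun hv => ?_)).2 (not_lt.2 h)), map_zero]
        rw [hv, lab_vR] at h
        omega
      · subst h
        exact (hφL m).trans (hψL m).symm
      · subst h
        exact hφR m)
    (fun v w h m => funext fun k => by
      cases k
      · rw [dblShape_trunc_false]
        change ψ (res M w ra (res M v w m)) = if a < lab w then ψ (res M v ra m) else 0
        by_cases h' : reach w ra
        · rw [if_pos ((hra' w).2 h'), res_res _ h h']
        · rw [if_neg (mt (hra' w).1 h'), res_of_not _ h', map_zero]
      · rw [dblShape_trunc_true]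
        change φ (res M w rb (res M v w m)) = if lab c < lab w then φ (res M v rb m) else 0
        by_cases hw : w = vR
        · subst hw
          obtain rfl := reach_to_vR.1 h
          rw [hφR, hφR, ite_self]
        · by_cases h' : reach w rb
          · rw [if_pos ((hrb w hw).2 h'), res_res _ h h']
          · rw [if_neg (mt (hrb w hw).1 h'), res_of_not _ h', map_zero])
  refine ⟨a, lab c, hab, hc, (isBrick_dbl hab hc).nonempty_iso hM i p fun h0 => hθ ?_⟩
  have := congrArg (fun f => (dblShape K n a (lab c)).coord vL
    (f.app vL (dblGenL hab hc K)) false) h0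
  change ψ (res M vL ra (i.app vL (dblGenL hab hc K))) = 0 at this
  rwa [hiL, hψL] at this

/-- The space at n-1 is filtered by the kernels G r and by the preimages H r of the image of the
space at n. The first proper G and the first proper G + H locate the ends ra and rb of the support
of a summand. -/
lemma exists_iso_of_nontrivial {M : DRep K n} (hM : Indecomposable M)
    (hU : Nontrivial (M.obj vL)) :
    (∃ a, a < lab (vL : Vert n) ∧ a + 2 ≤ n ∧ Nonempty (M ≅ thin K a vL)) ∨
      ∃ a b, a < b ∧ b + 2 ≤ n ∧ Nonempty (M ≅ dbl K n a b) := by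
  classical
  obtain ⟨u₀, hu₀⟩ := exists_ne (0 : M.obj vL)
  let G : Vert n → Submodule K (M.obj vL) := fun r => LinearMap.ker (res M vL r)
  let H : Vert n → Submodule K (M.obj vL) := fun r =>
    (LinearMap.range (res M vR r)).comap (res M vL r)
  have hself : ∀ x, res M vL vL x = x := res_self M vL
  obtain ⟨ra, hra, hmina⟩ := Finset.exists_min_image
    (Finset.univ.filter fun r : Vert n => r ≠ vR ∧ G r ≠ ⊤) lab
    ⟨vL, by
      simp only [Finset.mem_filter, Finset.mem_univ, true_and]
      refine ⟨vL_ne_vR, fun h => hu₀ ?_⟩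
      have : u₀ ∈ G vL := h ▸ Submodule.mem_top
      rw [← hself u₀]
      exact this⟩
  simp only [Finset.mem_filter, Finset.mem_univ, true_and] at hra hmina
  obtain ⟨rb, hrb, hminb⟩ := Finset.exists_min_image
    (Finset.univ.filter fun r : Vert n => r ≠ vR ∧ G ra ⊔ H r ≠ ⊤) lab
    ⟨vL, by
      simp only [Finset.mem_filter, Finset.mem_univ, true_and]
      refine ⟨vL_ne_vR, fun h => hra.2 ?_⟩
      rw [← h]
      refine (sup_eq_left.2 fun x hx => ?_).symm
      obtain ⟨y, hy⟩ := hx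
      rw [res_of_not _ (by rw [reach_to_vL]; exact vL_ne_vR.symm), hself] at hy
      rw [← hy]
      exact zero_mem _⟩
  simp only [Finset.mem_filter, Finset.mem_univ, true_and] at hrb hminb
  have hGH : ∀ r, G r ≤ H r := fun r x hx => ⟨0, by rw [map_zero]; exact hx.symm⟩
  have hG : ∀ w, lab w < lab ra → w ≠ vR → ∀ x, res M vL w x = 0 := fun w hw hw' x => by
    by_contra h
    refine absurd (hmina w ⟨hw', fun h' => h ?_⟩) (by omega)
    exact (h' ▸ Submodule.mem_top : x ∈ G w)
  have hG' : ∀ w, lab w < lab ra → ∀ x, res M vL w x = 0 := fun w hw x => by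
    by_cases h : w = vR
    · exact res_of_not _ (by rw [h, reach_to_vR]; exact vL_ne_vR) x
    · exact hG w hw h x
  have hle : lab ra ≤ lab rb := by
    by_contra! h
    refine hrb.2 (eq_top_iff.2 (le_trans (fun x _ => ?_) ((hGH rb).trans le_sup_right)))
    exact hG rb h hrb.1 x
  rcases hle.eq_or_lt with heq | hlt
  · left
    obtain rfl := lab_injective heq
    obtain ⟨u, -, hu⟩ := SetLike.exists_of_lt (lt_top_iff_ne_top.2 hrb.2)
    obtain ⟨φ, hφ, hφ'⟩ := exists_dual_ne_zero (S := LinearMap.range (res M vR ra))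
      (x := res M vL ra u) (fun h => hu (Submodule.mem_sup_right h))
    refine nonempty_iso_thin (by have := h4.out; omega) hM (reach_vL_iff.2 hra.1) u φ hφ (fun w hw _ => hG' w hw u)
      fun v hv m => ?_
    obtain rfl := not_reach_vL hv
    exact hφ' ⟨m, rfl⟩
  · right
    have h1 := one_le_lab ra
    have hn := h4.out
    have hlb := lab_le rb
    have hrbR : lab rb ≠ n := fun h => hrb.1 (lab_injective h)
    -- One vertex below rb the sum G + H is still everything, so a vector outside the sum at rb can
    -- be corrected by G to one whose image at c comes from the source n.
    obtain ⟨c, hc⟩ := exists_lab (n := n) (j := lab rb - 1) (by omega) (by omega)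
    have hcR : c ≠ vR := fun h => by rw [h, lab_vR] at hc; omega
    have htop : G ra ⊔ H c = ⊤ := by
      by_contra h
      exact absurd (hminb c ⟨hcR, h⟩) (by omega)
    obtain ⟨u', -, hu'⟩ := SetLike.exists_of_lt (lt_top_iff_ne_top.2 hrb.2)
    obtain ⟨g, hg, u, ⟨x, hx⟩, rfl⟩ := Submodule.mem_sup.1 (htop ▸ Submodule.mem_top : u' ∈ G ra ⊔ H c)
    have hu : u ∉ G ra ⊔ H rb := fun h => hu' (add_mem (Submodule.mem_sup_left hg) h)
    obtain ⟨θ, hθ, hθ'⟩ := exists_dual_ne_zero hu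
    refine nonempty_iso_dbl hM (ra := ra) (rb := rb) (c := c) u x (by omega) (by omega)
      (fun w hw => ?_) hx.symm (fun w hw => hG' w hw u) θ hθ (le_sup_left.trans hθ')
      (le_sup_right.trans hθ')
    have hwn : lab w ≠ n := fun h => hw (lab_injective h)
    have hwl := lab_le w
    rcases eq_vL_or_eq_vR_or rb with h | h | h
    · rw [h, lab_vL] at hc
      rw [h, reach_to_vL, hc]
      exact ⟨fun h' => lab_injective (by rw [lab_vL]; omega), fun h' => by rw [h', lab_vL]; omega⟩
    · exact absurd h hrb.1
    · rw [reach_row_iff h]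
      omega

/-- The classification of the indecomposable representations. -/
theorem exists_iso_of_indecomposable {M : DRep K n} (hM : Indecomposable M) :
    (∃ a t, a < lab (t : Vert n) ∧ a + 2 ≤ n ∧ Nonempty (M ≅ thin K a t)) ∨
      ∃ a b, a < b ∧ b + 2 ≤ n ∧ Nonempty (M ≅ dbl K n a b) := by
  classical
  by_cases hU : Nontrivial (M.obj vL)
  · exact (exists_iso_of_nontrivial hM hU).imp_left fun ⟨a, h⟩ => ⟨a, vL, h⟩
  rw [not_nontrivial_iff_subsingleton] at hU
  left
  by_cases hV : Nontrivial (M.obj vR)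
  · obtain ⟨a, ha⟩ := exists_iso_thin_of_subsingleton (by have := h4.out; omega) hM hV fun v hv => by
      rw [not_reach_vR hv]; exact hU
    exact ⟨a, vR, ha⟩
  rw [not_nontrivial_iff_subsingleton] at hV
  obtain ⟨t₀, ht₀⟩ : ∃ t, Nontrivial (M.obj t) := by
    by_contra! h
    refine hM.1 ((IsZero.iff_id_eq_zero _).2 (hom_ext' fun v m => ?_))
    have := h v
    exact Subsingleton.elim _ _
  -- Both sources carry zero here, so the highest vertex of the support reaches every other one.
  obtain ⟨t, ht, hmax⟩ := Finset.exists_max_image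
    (Finset.univ.filter fun r : Vert n => Nontrivial (M.obj r)) lab
    ⟨t₀, by simpa using ht₀⟩
  simp only [Finset.mem_filter, Finset.mem_univ, true_and] at ht hmax
  obtain ⟨a, ha⟩ := exists_iso_thin_of_subsingleton (by have := h4.out; omega) hM ht fun v hv => by
    by_contra h
    have h1 := hmax v (not_subsingleton_iff_nontrivial.1 h)
    refine hv ?_
    rcases eq_vL_or_eq_vR_or v with h2 | h2 | h2
    · exact absurd (h2 ▸ hU) h
    · exact absurd (h2 ▸ hV) h
    · rw [reach_row_iff h2]
      exact h1
  exact ⟨a, t, ha⟩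

end DRep

/-! ### Pairs with a two-dimensional extension group -/

namespace DRep

open Abelian

variable {n : ℕ} {K : Type u} [Field K]

lemma IsFinDim.of_iso {N N' : DRep K n} (h : IsFinDim N) (e : N ≅ N') : IsFinDim N' := fun v => by
  have := h v
  have hs : Function.Surjective (e.hom.app v).hom := surjective_of_epi e.hom v
  exact Module.Finite.of_surjective _ hs

/-- An upper bound for the dimension of an extension group. -/
lemma Mat.Presents.finrank_ext_add_le {ι κ : Type} [Fintype ι] [Fintype κ] {A : Mat K n ι κ}
    {C C' N N' : DRep K n} {g : ∀ k, C.obj (A.col k)} (h : A.Presents C g) (eC : C' ≅ C)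
    (eN : N' ≅ N) (fN : IsFinDim N) :
    Module.finrank K (Ext C' N' 1) + Module.finrank K (LinearMap.range (A.eval N)) ≤
      ∑ i, Module.finrank K (N.obj (A.row i)) := by
  have h1 := (h.of_iso eC.symm).finrank_ext_le N' (fN.of_iso eN.symm)
  have hfin : ∀ i, Module.Finite K (N.obj (A.row i)) := fun i => fN _
  let f : (∀ i, N.obj (A.row i)) →ₗ[K] (∀ i, N'.obj (A.row i)) :=
    LinearMap.pi fun i => (eN.inv.app (A.row i)).hom.comp (LinearMap.proj i)
  have hf : LinearMap.range (A.eval N) ≤ (LinearMap.range (A.eval N')).comap f := by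
    rintro _ ⟨m, rfl⟩
    exact ⟨fun k => eN.inv.app _ (m k), funext fun i => A.eval_app eN.inv m i⟩
  have hsurj : Function.Surjective (Submodule.mapQ _ _ f hf) := by
    intro q
    obtain ⟨y, rfl⟩ := Submodule.mkQ_surjective _ q
    choose x hx using fun i => surjective_of_epi eN.inv (A.row i) (y i)
    exact ⟨Submodule.mkQ _ x, congrArg (Submodule.mkQ _) (funext hx)⟩
  have h2 := finrank_le_of_surjective _ hsurj
  have h3 := Submodule.finrank_quotient_add_finrank (LinearMap.range (A.eval N))
  rw [Module.finrank_pi_fintype] at h3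
  omega

lemma Mat.one_le_finrank_range {ι κ : Type} [Fintype ι] [Fintype κ] (A : Mat K n ι κ)
    {N : DRep K n} (fN : IsFinDim N) (m : ∀ k, N.obj (A.col k)) (i : ι)
    (h : A.eval N m i ≠ 0) : 1 ≤ Module.finrank K (LinearMap.range (A.eval N)) := by
  have hfin : ∀ i, Module.Finite K (N.obj (A.row i)) := fun i => fN _
  rw [Submodule.one_le_finrank_iff, Submodule.ne_bot_iff]
  exact ⟨_, ⟨m, rfl⟩, fun h0 => h (congrFun h0 i)⟩

lemma sum_rowOne_le (a : ℕ) (f : RowOne n a → ℕ) (g : ℕ → ℕ) (h : ∀ i, f i ≤ g (lab i.1)) :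
    ∑ i, f i ≤ g a := by
  classical
  rcases isEmpty_or_nonempty (RowOne n a) with h0 | ⟨⟨i⟩⟩
  · rw [Finset.univ_eq_empty, Finset.sum_empty]
    exact Nat.zero_le _
  · rw [Finset.sum_eq_single i (fun j _ hj => absurd (Subsingleton.elim j i) hj)
      (fun hi => absurd (Finset.mem_univ _) hi)]
    exact (h i).trans_eq (by rw [i.2])

lemma sum_rowTwo_le {a b : ℕ} (hab : a < b) (hb : b ≤ n) (f : RowTwo n a b → ℕ) (g : ℕ → ℕ)
    (h : ∀ i, f i ≤ g (lab i.1)) : ∑ i, f i ≤ g a + g b := by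
  classical
  obtain ⟨rb, hrb⟩ := exists_lab (n := n) (j := b) (by omega) hb
  have h2 := (h ⟨rb, Or.inr hrb⟩).trans_eq (congrArg g hrb)
  rcases Nat.eq_zero_or_pos a with rfl | ha
  · rw [Finset.sum_eq_single _ (fun i _ h => absurd (rowTwo_zero_eq hrb i) h)
      (fun h => absurd (Finset.mem_univ _) h)]
    omega
  · obtain ⟨ra, hra⟩ := exists_lab (n := n) (j := a) ha (by omega)
    have h1 := (h ⟨ra, Or.inl hra⟩).trans_eq (congrArg g hra)
    rw [sum_rowTwo hab.ne hra hrb]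
    omega

lemma finrank_thin_le {c : ℕ} {t : Vert n} (v : Vert n) :
    Module.finrank K ((thin K c t).obj v) ≤ if c < lab v ∧ lab v ≤ lab t then 1 else 0 := by
  classical
  rw [finrank_thin]
  split_ifs with h1 h2 h2
  · exact le_rfl
  · exact absurd ⟨h1.2, h1.1.lab_le⟩ h2
  · exact Nat.zero_le _
  · exact le_rfl

variable [h4 : Fact (4 ≤ n)]

lemma finrank_dbl_le {c d : ℕ} (hcd : c < d) (hd : d + 2 ≤ n) (v : Vert n) :
    Module.finrank K ((dbl K n c d).obj v) ≤
      (if c < lab v then 1 else 0) + (if d < lab v then 1 else 0) := by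
  rw [finrank_dbl hcd hd]
  refine Nat.add_le_add_left ?_ _
  split_ifs with h1 h2
  · exact le_rfl
  · exact absurd h1.1 h2
  · exact Nat.zero_le _
  · exact le_rfl

/-- The images of the spaces at the two sources are independent where the space has dimension
two. -/
lemma eq_zero_of_res_eq {c d : ℕ} {r : Vert n} (hcr : c < lab r ∧ d < lab r) (hr : lab r + 2 ≤ n)
    {p : (dbl K n c d).obj vL} {q : (dbl K n c d).obj vR} (h : res _ vL r p = res _ vR r q) :
    p = 0 ∧ q = 0 := by
  have h5 := congrArg ((dblShape K n c d).coord r) h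
  rw [Shape.coord_res _ (reach_vL hr), Shape.coord_res _ (reach_vR hr)] at h5
  have h6 := congrFun h5 true
  have h7 := congrFun h5 false
  rw [dblShape_trunc_true, dblShape_trunc_true, if_pos hcr.2, if_pos hcr.2] at h6
  rw [dblShape_trunc_false, dblShape_trunc_false, if_pos hcr.1, if_pos hcr.1] at h7
  have hL := (mem_dblShape.1 ((dblShape K n c d).coord_mem vL p)).2.2.1 rfl
  have hR := (mem_dblShape.1 ((dblShape K n c d).coord_mem vR q)).2.2.2 rfl
  rw [hR] at h6
  rw [h6] at hL
  rw [← hL] at h7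
  constructor
  · refine (dblShape K n c d).coord_injective _ (funext fun i => ?_)
    cases i
    · exact hL.symm
    · exact h6
  · refine (dblShape K n c d).coord_injective _ (funext fun i => ?_)
    cases i
    · exact h7.symm
    · exact hR

section

variable {M N : DRep K n} {a b c d : ℕ} {t t' : Vert n}

omit h4 in
lemma finrank_ext_thin_thin (ha : a < lab t) (ha' : a + 2 ≤ n) (eC : M ≅ thin K a t)
    (eN : N ≅ thin K c t') : Module.finrank K (Ext M N 1) ≤ 1 := by
  have h1 := (thinMat_presents ha ha').finrank_ext_add_le eC eN (isFinDim_thin _ _)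
  have h2 := sum_rowOne_le a _
    (fun x => if c < x ∧ x ≤ lab t' then 1 else 0) (fun i : RowOne n a => finrank_thin_le (K := K) (c := c) (t := t') i.1)
  refine (Nat.le_add_right _ _).trans (h1.trans (h2.trans ?_))
  split_ifs <;> omega

/-- The single row contributes dimension two only for d < a; then a vector at t survives to the
vertex a, so `eval` is nonzero and one dimension is lost. -/
lemma finrank_ext_thin_dbl (ha : a < lab t) (ha' : a + 2 ≤ n) (hcd : c < d) (hd : d + 2 ≤ n)
    (eC : M ≅ thin K a t) (eN : N ≅ dbl K n c d) : Module.finrank K (Ext M N 1) ≤ 1 := by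
  have h1 := (thinMat_presents ha ha').finrank_ext_add_le eC eN (isFinDim_dbl _ _)
  have h2 := h1.trans (sum_rowOne_le a _
    (fun x => (if c < x then 1 else 0) + (if d < x then 1 else 0))
    (fun i : RowOne n a => finrank_dbl_le (K := K) hcd hd i.1))
  by_cases hda : d < a
  · rw [if_pos (by omega), if_pos hda] at h2
    obtain ⟨r, hr⟩ := exists_lab (n := n) (j := a) (by omega) (by omega)
    obtain ⟨x, hx⟩ : ∃ x : (dbl K n c d).obj t, res _ t r x ≠ 0 := by
      by_cases ht : t = vR
      · subst ht
        exact ⟨dblGenR hcd hd K, res_dblGenR_ne_zero hcd hd (reach_vR (by omega)) (by omega)⟩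
      · refine ⟨res _ vL t (dblGenL hcd hd K), ?_⟩
        rw [res_res _ (reach_vL_iff.2 ht) (reach_of_lt (by omega) (by omega))]
        exact res_dblGenL_ne_zero hcd hd (reach_vL (by omega)) (by omega)
    have h3 := Mat.one_le_finrank_range (thinMat K a t ha ha') (isFinDim_dbl (K := K) c d)
      (fun _ => x) ⟨r, hr⟩ (by rwa [thinMat_eval])
    omega
  · rw [if_neg hda] at h2
    split_ifs at h2 <;> omega

/-- Each row contributes at most one, so both must lie in the support of N. If t were a source, its
generator would survive to b and `eval` would take away one dimension. -/
lemma finrank_ext_dbl_thin (hab : a < b) (hb : b + 2 ≤ n) (hct : c < lab t)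
    (eC : M ≅ dbl K n a b) (eN : N ≅ thin K c t) (h : Module.finrank K (Ext M N 1) = 2) :
    c < a ∧ b ≤ lab t ∧ lab t + 2 ≤ n := by
  have h1 := (dblMat_presents hab hb).finrank_ext_add_le eC eN (isFinDim_thin _ _)
  have h2 := h1.trans (sum_rowTwo_le hab (by omega) _
    (fun x => if c < x ∧ x ≤ lab t then 1 else 0) (fun i : RowTwo n a b => finrank_thin_le (K := K) (c := c) (t := t) i.1))
  have h3 : (c < a ∧ a ≤ lab t) ∧ (c < b ∧ b ≤ lab t) := by
    by_contra hcon
    split_ifs at h2 <;> omega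
  refine ⟨h3.1.1, h3.2.2, ?_⟩
  by_contra ht
  have h5 : 1 ≤ Module.finrank K (LinearMap.range ((dblMat K n a b hab hb).eval (thin K c t))) := by
    obtain ⟨r, hr⟩ := exists_lab (n := n) (j := b) (by omega) (by omega)
    have h6 : ∀ w, reach w r → res (thin K c w) w r (thinGen K c w) ≠ 0 := fun w hw =>
      res_thinGen_ne_zero hw (by omega)
    rcases eq_vL_or_eq_vR_or t with rfl | rfl | h'
    · refine Mat.one_le_finrank_range _ (isFinDim_thin _ _)
        (Bool.rec 0 (thinGen K c vL)) ⟨r, Or.inr hr⟩ ?_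
      rw [dblMat_eval, if_pos hr]
      change res _ vL r (thinGen K c vL) - res _ vR r 0 ≠ 0
      rw [map_zero, sub_zero]
      exact h6 _ (reach_vL (by omega))
    · refine Mat.one_le_finrank_range _ (isFinDim_thin _ _)
        (Bool.rec (thinGen K c vR) 0) ⟨r, Or.inr hr⟩ ?_
      rw [dblMat_eval, if_pos hr]
      change res _ vL r 0 - res _ vR r (thinGen K c vR) ≠ 0
      rw [map_zero, zero_sub, neg_ne_zero]
      exact h6 _ (reach_vR (by omega))
    · exact absurd h' ht
  rw [if_pos h3.1, if_pos h3.2] at h2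
  omega

/-- Suppose a ≤ d. If d < b, the rows give at most 1 + 2, but `eval` is injective on a
two-dimensional space because the source spaces are independent at b. If c < b ≤ d, they give at
most 2 and `eval` is nonzero. Otherwise they give 0. -/
lemma finrank_ext_dbl_dbl (hab : a < b) (hb : b + 2 ≤ n) (hcd : c < d) (hd : d + 2 ≤ n)
    (eC : M ≅ dbl K n a b) (eN : N ≅ dbl K n c d) (h : Module.finrank K (Ext M N 1) = 2) :
    d < a := by
  have h1 := (dblMat_presents hab hb).finrank_ext_add_le eC eN (isFinDim_dbl _ _)
  have h2 := h1.trans (sum_rowTwo_le hab (by omega) _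
    (fun x => (if c < x then 1 else 0) + (if d < x then 1 else 0))
    (fun i : RowTwo n a b => finrank_dbl_le (K := K) hcd hd i.1))
  by_contra hda
  obtain ⟨r, hr⟩ := exists_lab (n := n) (j := b) (by omega) (by omega)
  rw [if_neg hda] at h2
  by_cases hcb : c < b
  · by_cases hdb : d < b
    · have hinj : Function.Injective ((dblMat K n a b hab hb).eval (dbl K n c d)) := by
        rw [injective_iff_map_eq_zero]
        intro m hm
        have h3 := (dblMat_eval hab hb _ m ⟨r, Or.inr hr⟩).symm.trans
          (congrFun hm ⟨r, Or.inr hr⟩)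
        rw [if_pos hr] at h3
        obtain ⟨h5, h6⟩ := eq_zero_of_res_eq (r := r) (by omega) (by omega) (sub_eq_zero.1 h3)
        funext k
        cases k
        · exact h6
        · exact h5
      have h3 := LinearMap.finrank_range_of_inj hinj
      have hfin : ∀ k, Module.Finite K ((dbl K n c d).obj (source n k)) :=
        fun k => isFinDim_dbl _ _ _
      have h8 : Module.finrank K (∀ k, (dbl K n c d).obj (source n k)) = 2 := by
        rw [Module.finrank_pi_fintype, Fintype.sum_bool]
        change Module.finrank K ((dbl K n c d).obj vL) + Module.finrank K ((dbl K n c d).obj vR) = 2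
        rw [finrank_dbl hcd hd, finrank_dbl hcd hd, lab_vL, lab_vR, if_pos (by omega),
          if_neg (by omega), if_pos (by omega), if_neg (by omega)]
      have h9 := h3.trans h8
      split_ifs at h2 <;> omega
    · have h3 := Mat.one_le_finrank_range (dblMat K n a b hab hb) (isFinDim_dbl (K := K) c d)
        (Bool.rec 0 (dblGenL hcd hd K)) ⟨r, Or.inr hr⟩ (by
          rw [dblMat_eval, if_pos hr]
          change res _ vL r (dblGenL hcd hd K) - res _ vR r 0 ≠ 0
          rw [map_zero, sub_zero]
          exact res_dblGenL_ne_zero hcd hd (reach_vL (by omega)) (by omega))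
      split_ifs at h2 <;> omega
  · split_ifs at h2 <;> omega

/-- The pairs of indecomposables with a two-dimensional extension group. -/
theorem exists_iso_of_finrank_ext (hM : Indecomposable M) (hN : Indecomposable N)
    (h : Module.finrank K (Ext M N 1) = 2) :
    ∃ a b, a < b ∧ b + 2 ≤ n ∧ Nonempty (M ≅ dbl K n a b) ∧
      ((∃ c t, c < a ∧ b ≤ lab (t : Vert n) ∧ lab t + 2 ≤ n ∧ Nonempty (N ≅ thin K c t)) ∨
        ∃ c d, c < d ∧ d < a ∧ Nonempty (N ≅ dbl K n c d)) := by
  rcases exists_iso_of_indecomposable hM with ⟨a, t, ha, ha', ⟨eC⟩⟩ | ⟨a, b, hab, hb, ⟨eC⟩⟩ <;>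
  rcases exists_iso_of_indecomposable hN with ⟨c, t', hc, hc', ⟨eN⟩⟩ | ⟨c, d, hcd, hd, ⟨eN⟩⟩
  · have := finrank_ext_thin_thin ha ha' eC eN
    omega
  · have := finrank_ext_thin_dbl ha ha' hcd hd eC eN
    omega
  · obtain ⟨h1, h2, h3⟩ := finrank_ext_dbl_thin hab hb hc eC eN h
    exact ⟨a, b, hab, hb, ⟨eC⟩, Or.inl ⟨c, t', h1, h2, h3, ⟨eN⟩⟩⟩
  · exact ⟨a, b, hab, hb, ⟨eC⟩, Or.inr ⟨c, d, hcd,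
      finrank_ext_dbl_dbl hab hb hcd hd eC eN h, ⟨eN⟩⟩⟩

end

end DRep

/-! ### Pencils of two-generated modules -/

namespace DRep

variable {n : ℕ} {K : Type u} [Field K]

section Biprod

variable {X Y T : DRep K n}

lemma isFinDim_biprod (hX : IsFinDim X) (hY : IsFinDim Y) : IsFinDim (X ⊞ Y) := fun v => by
  have := hX v
  have := hY v
  exact (finrank_of_shortExact (ShortComplex.Splitting.ofHasBinaryBiproduct X Y).shortExact v).1

lemma finrank_biprod (hX : IsFinDim X) (hY : IsFinDim Y) (v : Vert n) :
    Module.finrank K ((X ⊞ Y).obj v) =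
      Module.finrank K (X.obj v) + Module.finrank K (Y.obj v) := by
  have := hX v
  have := hY v
  exact (finrank_of_shortExact (ShortComplex.Splitting.ofHasBinaryBiproduct X Y).shortExact v).2

/-- The inclusion of the first summand, on elements. -/
noncomputable def inl (X Y : DRep K n) (v : Vert n) : X.obj v →ₗ[K] (X ⊞ Y).obj v :=
  ((biprod.inl : X ⟶ X ⊞ Y).app v).hom

/-- The inclusion of the second summand, on elements. -/
noncomputable def inr (X Y : DRep K n) (v : Vert n) : Y.obj v →ₗ[K] (X ⊞ Y).obj v :=
  ((biprod.inr : Y ⟶ X ⊞ Y).app v).hom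

lemma res_inl (v w : Vert n) (x : X.obj v) : res (X ⊞ Y) v w (inl X Y v x) = inl X Y w (res X v w x) :=
  (app_res biprod.inl v w x).symm

lemma res_inr (v w : Vert n) (y : Y.obj v) : res (X ⊞ Y) v w (inr X Y v y) = inr X Y w (res Y v w y) :=
  (app_res biprod.inr v w y).symm

end Biprod

variable [h4 : Fact (4 ≤ n)]

/-- `Z` is generated by elements at the two sources that vanish from `e` on and satisfy one linear
relation from `a` on. -/
structure IsPencil (Z : DRep K n) (e a : ℕ) (l m : K) (p : Z.obj vL) (q : Z.obj vR) : Prop where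
  finDim : IsFinDim Z
  gen : ∀ {T : DRep K n} (f : Z ⟶ T), f.app vL p = 0 → f.app vR q = 0 → f = 0
  rel : ∀ w : Vert n, lab w ≤ a → l • res Z vL w p + m • res Z vR w q = 0
  left : ∀ w : Vert n, lab w ≤ e → res Z vL w p = 0
  right : ∀ w : Vert n, lab w ≤ e → res Z vR w q = 0
  finrank : ∀ v : Vert n, Module.finrank K (Z.obj v) =
    (if e < lab v then 1 else 0) + (if a < lab v ∧ lab v + 2 ≤ n then 1 else 0)

section

variable {e a : ℕ} (hea : e < a) (ha : a + 2 ≤ n)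
include hea ha

/-- Rescaling the generators by m and -l turns the relation x = y into lp + mq = 0. -/
lemma isPencil_dbl {l m : K} (hl : l ≠ 0) (hm : m ≠ 0) :
    IsPencil (dbl K n e a) e a l m (m • dblGenL hea ha K) (-l • dblGenR hea ha K) where
  finDim := isFinDim_dbl _ _
  gen f hf hg := by
    rw [map_smul] at hf hg
    refine dbl_hom_ext hea ha ?_ ?_
    · exact (smul_eq_zero.1 hf).resolve_left hm
    · exact (smul_eq_zero.1 hg).resolve_left (neg_ne_zero.2 hl)
  rel w hw := by
    rw [map_smul, map_smul, res_dblGen_eq hea ha hw]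
    module
  left w hw := by rw [map_smul, res_dblGenL_eq_zero hea ha hw, smul_zero]
  right w hw := by
    rw [map_smul, ← res_dblGen_eq hea ha (hw.trans hea.le), res_dblGenL_eq_zero hea ha hw,
      smul_zero]
  finrank := finrank_dbl hea ha

/-- For l = 0 the relation no longer involves p: it kills q from a on, and the module splits. -/
lemma isPencil_left (m : K) :
    IsPencil (thin K e (vL : Vert n) ⊞ thin K a vR) e a 0 m (inl _ _ _ (thinGen K e vL))
      (inr _ _ _ (thinGen K a vR)) where
  finDim := isFinDim_biprod (isFinDim_thin _ _) (isFinDim_thin _ _)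
  gen f hf hg := biprod.hom_ext' _ _ (thin_hom_ext (by exact hf)) (thin_hom_ext (by exact hg))
  rel w hw := by
    rw [res_inr, res_thinGen_of_le hw, map_zero, smul_zero, zero_smul, add_zero]
  left w hw := by rw [res_inl, res_thinGen_of_le hw, map_zero]
  right w hw := by rw [res_inr, res_thinGen_of_le (hw.trans hea.le), map_zero]
  finrank v := by
    classical
    rw [finrank_biprod (isFinDim_thin _ _) (isFinDim_thin _ _), finrank_thin, finrank_thin,
      reach_vL_iff, reach_vR_iff]
    have h1 := @lab_vL n _
    have h2 := @lab_vR n _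
    rcases eq_vL_or_eq_vR_or v with rfl | rfl | h
    · rw [if_pos ⟨vL_ne_vR, by omega⟩, if_neg fun h => h.1 rfl, if_pos (by omega),
        if_neg (by omega)]
    · rw [if_neg fun h => h.1 rfl, if_pos ⟨vL_ne_vR.symm, by omega⟩, if_pos (by omega),
        if_neg (by omega)]
    · have hL : v ≠ vL := fun h' => by rw [h'] at h; omega
      have hR : v ≠ vR := fun h' => by rw [h'] at h; omega
      simp only [hL, hR, h, ne_eq, not_false_eq_true, true_and, and_true]

lemma isPencil_right (l : K) :
    IsPencil (thin K e (vR : Vert n) ⊞ thin K a vL) e a l 0 (inr _ _ _ (thinGen K a vL))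
      (inl _ _ _ (thinGen K e vR)) where
  finDim := isFinDim_biprod (isFinDim_thin _ _) (isFinDim_thin _ _)
  gen f hf hg := biprod.hom_ext' _ _ (thin_hom_ext (by exact hg)) (thin_hom_ext (by exact hf))
  rel w hw := by
    rw [res_inr, res_thinGen_of_le hw, map_zero, smul_zero, zero_smul, add_zero]
  left w hw := by rw [res_inr, res_thinGen_of_le (hw.trans hea.le), map_zero]
  right w hw := by rw [res_inl, res_thinGen_of_le hw, map_zero]
  finrank v := by
    classical
    rw [finrank_biprod (isFinDim_thin _ _) (isFinDim_thin _ _), finrank_thin, finrank_thin,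
      reach_vL_iff, reach_vR_iff]
    have h1 := @lab_vL n _
    have h2 := @lab_vR n _
    rcases eq_vL_or_eq_vR_or v with rfl | rfl | h
    · rw [if_neg fun h => h.1 rfl, if_pos ⟨vL_ne_vR, by omega⟩, if_pos (by omega),
        if_neg (by omega)]
    · rw [if_pos ⟨vL_ne_vR.symm, by omega⟩, if_neg fun h => h.1 rfl, if_pos (by omega),
        if_neg (by omega)]
    · have hL : v ≠ vL := fun h' => by rw [h'] at h; omega
      have hR : v ≠ vR := fun h' => by rw [h'] at h; omega
      simp only [hL, hR, h, ne_eq, not_false_eq_true, true_and, and_true]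

/-- The middle terms, when the extension classes form a plane with coordinates `l` and `m`. -/
lemma isNonsplitMiddleTerm_iff_of_pencil {ι κ : Type} [Fintype ι] [Fintype κ] {A : Mat K n ι κ}
    {C N : DRep K n} {g : ∀ k, C.obj (A.col k)} (h : A.Presents C g) (h2 : (2 : K) ≠ 0)
    (Φ : K → K → ∀ i, N.obj (A.row i))
    (hΦ : ∀ l m, Φ l m ∈ LinearMap.range (A.eval N) → l = 0 ∧ m = 0)
    (hΦ' : ∀ α, ∃ l m x, α = Φ l m + A.eval N x) (hΦ0 : Φ 0 0 = 0)
    {S W : DRep K n} (hS : ∀ l, l ≠ 0 → A.Realizes g (Φ l (-l)) S)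
    (hZ : ∀ (Z : DRep K n) (l m : K) (p : Z.obj vL) (q : Z.obj vR), IsPencil Z e a l m p q →
      l + m ≠ 0 → A.Realizes g (Φ l m) (Z ⊞ W)) (Y : DRep K n) :
    IsNonsplitMiddleTerm N Y C ↔
      Nonempty (Y ≅ (thin K e vL ⊞ thin K a vR) ⊞ W) ∨
        Nonempty (Y ≅ (thin K e vR ⊞ thin K a vL) ⊞ W) ∨ Nonempty (Y ≅ S) ∨
          Nonempty (Y ≅ dbl K n e a ⊞ W) := by
  have h1 : (1 : K) ≠ 0 := one_ne_zero
  constructor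
  · intro hY
    obtain ⟨α, hα, hY⟩ := h.exists_realizes hY
    obtain ⟨l, m, x, rfl⟩ := hΦ' α
    have hY' : A.Realizes g (Φ l m) Y := by
      have := hY.add_range (-x)
      rwa [map_neg, add_neg_cancel_right] at this
    -- The four cases are the three special lines in the plane of classes and their complement.
    by_cases hlm : l + m = 0
    · obtain rfl : m = -l := (neg_eq_of_add_eq_zero_right hlm).symm
      have hl : l ≠ 0 := fun hl => hα (by
        rw [hl, neg_zero, hΦ0, zero_add]
        exact ⟨x, rfl⟩)
      exact Or.inr (Or.inr (Or.inl (hY'.nonempty_iso h (hS l hl))))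
    · by_cases hl : l = 0
      · subst hl
        exact Or.inl (hY'.nonempty_iso h (hZ _ _ _ _ _ (isPencil_left hea ha m) hlm))
      · by_cases hm : m = 0
        · subst hm
          exact Or.inr (Or.inl (hY'.nonempty_iso h (hZ _ _ _ _ _ (isPencil_right hea ha l) hlm)))
        · exact Or.inr (Or.inr (Or.inr
            (hY'.nonempty_iso h (hZ _ _ _ _ _ (isPencil_dbl hea ha hl hm) hlm))))
  · rintro (⟨⟨i⟩⟩ | ⟨⟨i⟩⟩ | ⟨⟨i⟩⟩ | ⟨⟨i⟩⟩)
    · exact ((hZ _ _ _ _ _ (isPencil_left hea ha (1 : K)) (by rwa [zero_add])).of_iso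
        i.symm).isNonsplitMiddleTerm fun h' => h1 (hΦ _ _ h').2
    · exact ((hZ _ _ _ _ _ (isPencil_right hea ha (1 : K)) (by rwa [add_zero])).of_iso
        i.symm).isNonsplitMiddleTerm fun h' => h1 (hΦ _ _ h').1
    · exact ((hS 1 h1).of_iso i.symm).isNonsplitMiddleTerm fun h' => h1 (hΦ _ _ h').1
    -- The class l = m = 1 is off the line l + m = 0 because 2 is invertible.
    · exact ((hZ _ _ _ _ _ (isPencil_dbl hea ha h1 h1) (by rwa [one_add_one_eq_two])).of_iso
        i.symm).isNonsplitMiddleTerm fun h' => h1 (hΦ _ _ h').1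

end

end DRep

/-! ### Middle terms when the left end is P(t)/P(c) -/

namespace DRep

variable {n : ℕ} {K : Type u} [Field K] [h4 : Fact (4 ≤ n)]

section Thin

variable {a b c : ℕ} {t : Vert n} (hca : c < a) (hab : a < b) (hbt : b ≤ lab t)
  (ht : lab t + 2 ≤ n)

/-- The extension class of `dbl K n a b` by `thin K c t` with given coordinates. -/
noncomputable def thinClass (K : Type u) [Field K] (a b c : ℕ) (t : Vert n) (l m : K)
    (i : RowTwo n a b) : (thin K c t).obj i.1 :=
  -- With value m at a and l + m at b, the special lines become l = 0, m = 0 and l + m = 0, as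
  -- `IsPencil` requires.
  (if lab i.1 = b then l + m else m) • res _ t i.1 (thinGen K c t)

include hab hbt ht

omit h4 in
lemma reach_row {i : RowTwo n a b} : reach t i.1 := by
  rcases i.2 with h | h
  · exact reach_of_lt (by omega) (by omega)
  · rcases hbt.eq_or_lt with h' | h'
    · rw [lab_injective (h.trans h')]
      exact reach_refl t
    · exact reach_of_lt (by omega) (by omega)

omit hab hbt in
lemma subsingleton_thin_source (k : Bool) : Subsingleton ((thin K c t).obj (source n k)) := by
  refine ⟨fun x y => (thinShape K c t).coord_injective _ (funext fun _ => ?_)⟩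
  have h : ¬ (reach t (source n k) ∧ c < lab (source n k)) := fun h => by
    have h1 := h.1.lab_le
    cases k
    · change lab (vR : Vert n) ≤ _ at h1
      rw [lab_vR] at h1
      omega
    · change lab (vL : Vert n) ≤ _ at h1
      rw [lab_vL] at h1
      omega
  rw [mem_thinShape.1 ((thinShape K c t).coord_mem _ x) h,
    mem_thinShape.1 ((thinShape K c t).coord_mem _ y) h]

include hca

/-- The generator of N goes to that of P(t)/P(b) plus (p - q)/(l + m), and p, q lift the generators
of C. At b, (l + m) times the image is p - q; at a, m times the image is p, because lp + mq = 0
gives m(p - q) = (l + m)p. -/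
lemma realizes_thinClass_of_isPencil {Z : DRep K n} {l m : K} {p : Z.obj vL} {q : Z.obj vR}
    (hZ : IsPencil Z c a l m p q) (hlm : l + m ≠ 0) :
    (dblMat K n a b hab (by omega)).Realizes (dblGen hab (by omega) K) (thinClass K a b c t l m)
      (Z ⊞ thin K b t) := by
  have hb : b + 2 ≤ n := by omega
  let X : (Z ⊞ thin K b t).obj t := inr _ _ t (thinGen K b t) + (l + m)⁻¹ •
    (res _ vL t (inl _ _ vL p) - res _ vR t (inl _ _ vR q))
  have hX : ∀ w, reach t w → res _ t w X = inr _ _ w (res _ t w (thinGen K b t)) + (l + m)⁻¹ •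
      (inl _ _ w (res _ vL w p) - inl _ _ w (res _ vR w q)) := fun w hw => by
    change res _ t w (_ + _ • (_ - _)) = _
    rw [map_add, map_smul, map_sub, res_inr, res_res _ (reach_vL ht) hw,
      res_res _ (reach_vR ht) hw, res_inl, res_inl]
  obtain ⟨f, hf⟩ := exists_thin_hom (a := c) X fun w hw => by
    by_cases h : reach t w
    · rw [hX w h, res_thinGen_of_le (by omega), hZ.left w hw, hZ.right w hw, map_zero, map_zero,
        sub_zero, smul_zero, add_zero]
    · exact res_of_not _ h _
  refine Mat.realizes_of_finrank (dblMat_presents hab hb) (isFinDim_dbl _ _) (isFinDim_thin _ _)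
    (isFinDim_biprod hZ.finDim (isFinDim_thin _ _)) f
    (Bool.rec (inl _ _ vR q) (inl _ _ vL p)) (fun i => ?_) (fun {T} u hu hm => ?_) fun v => ?_
  · have hi : reach t i.1 := reach_row hab hbt ht
    have hib : lab i.1 ≤ b := by rcases i.2 with h | h <;> omega
    refine (dblMat_eval hab hb _ _ i).trans ?_
    change res _ vL i.1 (inl _ _ vL p) -
      (if lab i.1 = b then res _ vR i.1 (inl _ _ vR q) else 0) =
      f.app i.1 ((if lab i.1 = b then l + m else m) • res _ t i.1 (thinGen K c t))
    rw [map_smul, app_res, hf, hX _ hi, res_thinGen_of_le hib, map_zero, zero_add, res_inl, res_inl]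
    split_ifs with h
    · rw [smul_smul, mul_inv_cancel₀ hlm, one_smul]
    · have h1 := congrArg (inl Z (thin K b t) i.1)
        (hZ.rel i.1 (by have := i.2.resolve_right h; omega))
      rw [map_add, map_smul, map_smul, map_zero] at h1
      generalize inl Z (thin K b t) i.1 (res Z vL i.1 p) = P at h1 ⊢
      generalize inl Z (thin K b t) i.1 (res Z vR i.1 q) = Q at h1 ⊢
      have h2 : P = (l + m)⁻¹ • ((l + m) • P) := by
        rw [smul_smul, inv_mul_cancel₀ hlm, one_smul]
      have h3 : (l + m) • P = m • (P - Q) := by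
        rw [← add_zero (m • (P - Q)), ← h1]
        module
      rw [sub_zero, smul_comm, ← h3, ← h2]
  · have h1 : biprod.inl ≫ u = 0 := hZ.gen _ (hm true) (hm false)
    have h1' : ∀ v x, u.app v (inl _ _ v x) = 0 := fun v x =>
      congrArg (fun f => f.app v x) h1
    have h2 : u.app t X = 0 := by
      rw [← hf]
      exact congrArg (fun f => f.app t (thinGen K c t)) hu
    refine biprod.hom_ext' _ _ (by rw [h1, comp_zero]) (thin_hom_ext ?_)
    change u.app t (inr _ _ t (thinGen K b t)) = 0
    have h3 : u.app t X = u.app t (inr _ _ t (thinGen K b t)) := by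
      change u.app t (_ + _ • (_ - _)) = _
      rw [map_add, map_smul, map_sub, res_inl, res_inl, h1', h1', sub_zero, smul_zero, add_zero]
    rw [← h3, h2]
  · classical
    rw [finrank_biprod hZ.finDim (isFinDim_thin _ _), hZ.finrank, finrank_thin, finrank_thin,
      finrank_dbl hab hb]
    by_cases hv : reach t v
    · have h1 : lab v + 2 ≤ n := by have := hv.lab_le; omega
      simp only [hv, h1, true_and, and_true]
      split_ifs <;> omega
    · have h1 : lab t < lab v ∨ n < lab v + 2 := by
        by_contra! h
        exact hv (by
          rcases h.1.eq_or_lt with h' | h'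
          · rw [lab_injective h']
            exact reach_refl t
          · exact reach_of_lt h' (by omega))
      simp only [hv, false_and, if_false]
      split_ifs <;> omega

/-- On this line the value at b is zero, so the lifted generators may already agree there: they are
those of `dbl K n c b`. The coefficient -1/l in the image of the generator of N makes the value -l
at a match the relation x = 0. -/
lemma realizes_thinClass_neg {l : K} (hl : l ≠ 0) :
    (dblMat K n a b hab (by omega)).Realizes (dblGen hab (by omega) K) (thinClass K a b c t l (-l))
      (dbl K n c b ⊞ thin K a t) := by
  have hb : b + 2 ≤ n := by omega
  have hcb : c < b := by omega
  let X : (dbl K n c b ⊞ thin K a t).obj t := inr _ _ t (thinGen K a t) - l⁻¹ •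
    res _ vL t (inl _ _ vL (dblGenL hcb hb K))
  have hX : ∀ w, reach t w → res _ t w X = inr _ _ w (res _ t w (thinGen K a t)) - l⁻¹ •
      inl _ _ w (res _ vL w (dblGenL hcb hb K)) := fun w hw => by
    change res _ t w (_ - _ • _) = _
    rw [map_sub, map_smul, res_inr, res_res _ (reach_vL ht) hw, res_inl]
  obtain ⟨f, hf⟩ := exists_thin_hom (a := c) X fun w hw => by
    by_cases h : reach t w
    · rw [hX w h, res_thinGen_of_le (by omega), res_dblGenL_eq_zero hcb hb hw, map_zero, map_zero,
        smul_zero, sub_zero]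
    · exact res_of_not _ h _
  refine Mat.realizes_of_finrank (dblMat_presents hab hb) (isFinDim_dbl _ _) (isFinDim_thin _ _)
    (isFinDim_biprod (isFinDim_dbl _ _) (isFinDim_thin _ _)) f
    (Bool.rec (inl _ _ vR (dblGenR hcb hb K)) (inl _ _ vL (dblGenL hcb hb K)))
    (fun i => ?_) (fun {T} u hu hm => ?_) fun v => ?_
  · have hi : reach t i.1 := reach_row hab hbt ht
    have hib : lab i.1 ≤ b := by rcases i.2 with h | h <;> omega
    refine (dblMat_eval hab hb _ _ i).trans ?_
    change res _ vL i.1 (inl _ _ vL _) - (if lab i.1 = b then res _ vR i.1 (inl _ _ vR _) else 0) =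
      f.app i.1 ((if lab i.1 = b then l + -l else -l) • res _ t i.1 (thinGen K c t))
    rw [map_smul, app_res, hf, hX _ hi, res_inl, res_inl, ← res_dblGen_eq hcb hb hib]
    split_ifs with h
    · rw [sub_self, add_neg_cancel, zero_smul]
    · rw [res_thinGen_of_le (i.2.resolve_right h).le, map_zero, zero_sub, sub_zero, neg_smul_neg,
        smul_smul, mul_inv_cancel₀ hl, one_smul]
  · have h1 : biprod.inl ≫ u = 0 := dbl_hom_ext hcb hb (hm true) (hm false)
    have h1' : ∀ v x, u.app v (inl _ _ v x) = 0 := fun v x =>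
      congrArg (fun f => f.app v x) h1
    have h2 : u.app t X = 0 := by
      rw [← hf]
      exact congrArg (fun f => f.app t (thinGen K c t)) hu
    refine biprod.hom_ext' _ _ (by rw [h1, comp_zero]) (thin_hom_ext ?_)
    change u.app t (inr _ _ t (thinGen K a t)) = 0
    have h3 : u.app t X = u.app t (inr _ _ t (thinGen K a t)) := by
      change u.app t (_ - _ • _) = _
      rw [map_sub, map_smul, res_inl, h1', smul_zero, sub_zero]
    rw [← h3, h2]
  · classical
    rw [finrank_biprod (isFinDim_dbl _ _) (isFinDim_thin _ _), finrank_thin, finrank_thin,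
      finrank_dbl hab hb, finrank_dbl hcb hb]
    by_cases hv : reach t v
    · simp only [hv, true_and]
      split_ifs <;> omega
    · have h1 : lab t < lab v ∨ n < lab v + 2 := by
        by_contra! h
        exact hv (by
          rcases h.1.eq_or_lt with h' | h'
          · rw [lab_injective h']
            exact reach_refl t
          · exact reach_of_lt h' (by omega))
      simp only [hv, false_and, if_false]
      split_ifs <;> omega

theorem isNonsplitMiddleTerm_thin_iff (h2 : (2 : K) ≠ 0) (Y : DRep K n) :
    IsNonsplitMiddleTerm (thin K c t) Y (dbl K n a b) ↔
      Nonempty (Y ≅ (thin K c (vL : Vert n) ⊞ thin K a vR) ⊞ thin K b t) ∨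
        Nonempty (Y ≅ (thin K c (vR : Vert n) ⊞ thin K a vL) ⊞ thin K b t) ∨
          Nonempty (Y ≅ dbl K n c b ⊞ thin K a t) ∨
            Nonempty (Y ≅ dbl K n c a ⊞ thin K b t) := by
  have hb : b + 2 ≤ n := by omega
  obtain ⟨ra, hra⟩ := exists_lab (n := n) (j := a) (by omega) (by omega)
  obtain ⟨rb, hrb⟩ := exists_lab (n := n) (j := b) (by omega) (by omega)
  have hreach : ∀ {i : RowTwo n a b}, reach t i.1 := reach_row hab hbt ht
  have hsub := subsingleton_thin_source (K := K) (c := c) ht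
  have h0 : thinClass K a b c t 0 0 = 0 := funext fun i => by
    change (if _ then (0 : K) + 0 else 0) • _ = _
    rw [add_zero, ite_self, zero_smul]
    rfl
  refine isNonsplitMiddleTerm_iff_of_pencil hca (by omega) (dblMat_presents hab hb) h2
    (thinClass K a b c t) (fun l m h => ?_) (fun α => ?_) h0
    (fun l hl => realizes_thinClass_neg hca hab hbt ht hl)
    (fun Z l m p q hZ hlm => realizes_thinClass_of_isPencil hca hab hbt ht hZ hlm) Y
  · obtain ⟨x, hx⟩ := h
    -- N vanishes at both sources, so Hom(P₀, N) = 0 and the classes are all the pairs of values at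
    -- a and b.
    have hx0 : x = 0 := funext fun k => (hsub k).elim _ _
    rw [hx0, map_zero] at hx
    have ha' : (if lab ra = b then l + m else m) • res (thin K c t) t ra (thinGen K c t) = 0 :=
      (congrFun hx ⟨ra, Or.inl hra⟩).symm
    have hb' : (if lab rb = b then l + m else m) • res (thin K c t) t rb (thinGen K c t) = 0 :=
      (congrFun hx ⟨rb, Or.inr hrb⟩).symm
    rw [if_neg (by omega)] at ha'
    rw [if_pos hrb] at hb'
    have h1 := (smul_eq_zero.1 ha').resolve_right (res_thinGen_ne_zero
      (hreach (i := ⟨ra, Or.inl hra⟩)) (by omega))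
    have h2 := (smul_eq_zero.1 hb').resolve_right (res_thinGen_ne_zero
      (hreach (i := ⟨rb, Or.inr hrb⟩)) (by omega))
    rw [h1, add_zero] at h2
    exact ⟨h2, h1⟩
  · let A := (thinShape K c t).coord ra (α ⟨ra, Or.inl hra⟩) ()
    let B := (thinShape K c t).coord rb (α ⟨rb, Or.inr hrb⟩) ()
    refine ⟨B - A, A, 0, ?_⟩
    rw [map_zero, add_zero]
    funext i
    change α i = (if lab i.1 = b then B - A + A else A) • res _ t i.1 (thinGen K c t)
    by_cases h : lab i.1 = b
    · obtain rfl : i = ⟨rb, Or.inr hrb⟩ := Subtype.ext (lab_injective (h.trans hrb.symm))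
      rw [if_pos h, sub_add_cancel]
      exact thin_eq_smul _ _
    · obtain rfl : i = ⟨ra, Or.inl hra⟩ :=
        Subtype.ext (lab_injective ((i.2.resolve_right h).trans hra.symm))
      rw [if_neg h]
      exact thin_eq_smul _ _

end Thin

end DRep

/-! ### Middle terms when the left end is a two-generated module -/

namespace DRep

variable {n : ℕ} {K : Type u} [Field K] [h4 : Fact (4 ≤ n)]

section Dbl

variable {a b c d : ℕ} (hcd : c < d) (hda : d < a) (hab : a < b) (hb : b + 2 ≤ n)
include hcd hda hab hb

/-- The extension class of `dbl K n a b` by `dbl K n c d` with given coordinates. -/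
noncomputable def dblClass (K : Type u) [Field K] (l m : K)
    (i : RowTwo n a b) : (dbl K n c d).obj i.1 :=
  if lab i.1 = b then 0 else
    l • res _ vL i.1 (dblGenL hcd (by omega) K) + m • res _ vR i.1 (dblGenR hcd (by omega) K)

/-- The generators of `dbl K n c b` lift those of C, with value zero at b. Those of N go to their
multiples by 1/(l + m) plus p and q. At a, the combination with coefficients l, m returns the common
image of the lifts, since lp + mq = 0 there. -/
lemma realizes_dblClass_of_isPencil {Z : DRep K n} {l m : K} {p : Z.obj vL} {q : Z.obj vR}
    (hZ : IsPencil Z d a l m p q) (hlm : l + m ≠ 0) :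
    (dblMat K n a b hab hb).Realizes (dblGen hab hb K) (dblClass hcd hda hab hb K l m)
      (Z ⊞ dbl K n c b) := by
  have hd : d + 2 ≤ n := by omega
  have hcb : c < b := by omega
  let X : (Z ⊞ dbl K n c b).obj vL :=
    (l + m)⁻¹ • inr _ _ vL (dblGenL hcb hb K) + inl _ _ vL p
  let Y : (Z ⊞ dbl K n c b).obj vR :=
    (l + m)⁻¹ • inr _ _ vR (dblGenR hcb hb K) + inl _ _ vR q
  have hX : ∀ w, res _ vL w X =
      (l + m)⁻¹ • inr _ _ w (res _ vL w (dblGenL hcb hb K)) + inl _ _ w (res _ vL w p) := fun w => by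
    change res _ vL w (_ • _ + _) = _
    rw [map_add, map_smul, res_inr, res_inl]
  have hY : ∀ w, res _ vR w Y =
      (l + m)⁻¹ • inr _ _ w (res _ vR w (dblGenR hcb hb K)) + inl _ _ w (res _ vR w q) := fun w => by
    change res _ vR w (_ • _ + _) = _
    rw [map_add, map_smul, res_inr, res_inl]
  obtain ⟨f, hfL, hfR⟩ := exists_dbl_hom hcd hd X Y
    (fun w hw => by
      rw [hX, hY, hZ.left w hw, hZ.right w hw, res_dblGen_eq hcb hb (by omega), map_zero])
    (fun w hw => by
      rw [hX, hZ.left w (by omega), res_dblGenL_eq_zero hcb hb hw, map_zero, map_zero, smul_zero,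
        add_zero])
  refine Mat.realizes_of_finrank (dblMat_presents hab hb) (isFinDim_dbl _ _) (isFinDim_dbl _ _)
    (isFinDim_biprod hZ.finDim (isFinDim_dbl _ _)) f
    (Bool.rec (inr _ _ vR (dblGenR hcb hb K)) (inr _ _ vL (dblGenL hcb hb K)))
    (fun i => ?_) (fun {T} u hu hm => ?_) fun v => ?_
  · have hib : lab i.1 ≤ b := by rcases i.2 with h | h <;> omega
    refine (dblMat_eval hab hb _ _ i).trans ?_
    change res _ vL i.1 (inr _ _ vL _) - (if lab i.1 = b then res _ vR i.1 (inr _ _ vR _) else 0) =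
      f.app i.1 (if lab i.1 = b then 0 else l • res _ vL i.1 (dblGenL hcd hd K) +
        m • res _ vR i.1 (dblGenR hcd hd K))
    rw [res_inr, res_inr, ← res_dblGen_eq hcb hb hib]
    split_ifs with h
    · rw [sub_self, map_zero]
    · rw [sub_zero, map_add, map_smul, map_smul, app_res, app_res, hfL, hfR, hX, hY,
        ← res_dblGen_eq hcb hb hib]
      have h1 := congrArg (inl Z (dbl K n c b) i.1)
        (hZ.rel i.1 (by have := i.2.resolve_right h; omega))
      rw [map_add, map_smul, map_smul, map_zero] at h1
      generalize inl Z (dbl K n c b) i.1 (res Z vL i.1 p) = P at h1 ⊢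
      generalize inl Z (dbl K n c b) i.1 (res Z vR i.1 q) = Q at h1 ⊢
      generalize inr Z (dbl K n c b) i.1 _ = R
      have h2 : R = ((l + m) * (l + m)⁻¹) • R + (l • P + m • Q) := by
        rw [mul_inv_cancel₀ hlm, one_smul, h1, add_zero]
      conv_lhs => rw [h2]
      module
  · have h1 : biprod.inr ≫ u = 0 := dbl_hom_ext hcb hb (hm true) (hm false)
    have h1' : ∀ v x, u.app v (inr _ _ v x) = 0 := fun v x =>
      congrArg (fun f => f.app v x) h1
    have h2 : u.app vL X = 0 := by
      rw [← hfL]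
      exact congrArg (fun f => f.app vL (dblGenL hcd hd K)) hu
    have h3 : u.app vR Y = 0 := by
      rw [← hfR]
      exact congrArg (fun f => f.app vR (dblGenR hcd hd K)) hu
    have h2' : u.app vL X = u.app vL (inl _ _ vL p) := by
      change u.app vL (_ • _ + _) = _
      rw [map_add, map_smul, h1', smul_zero, zero_add]
    have h3' : u.app vR Y = u.app vR (inl _ _ vR q) := by
      change u.app vR (_ • _ + _) = _
      rw [map_add, map_smul, h1', smul_zero, zero_add]
    exact biprod.hom_ext' _ _ ((hZ.gen _ (h2'.symm.trans h2) (h3'.symm.trans h3)).trans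
      comp_zero.symm) (h1.trans comp_zero.symm)
  · rw [finrank_biprod hZ.finDim (isFinDim_dbl _ _), hZ.finrank, finrank_dbl hcb hb,
      finrank_dbl hcd hd, finrank_dbl hab hb]
    split_ifs <;> omega

/-- The generators of `dbl K n c a` agree at a, so in the combination with coefficients l, -l they
cancel. Only l times the correction by 1/l remains, which is the lifted generator from `dbl K n d
b`. -/
lemma realizes_dblClass_neg {l : K} (hl : l ≠ 0) :
    (dblMat K n a b hab hb).Realizes (dblGen hab hb K) (dblClass hcd hda hab hb K l (-l))
      (dbl K n d b ⊞ dbl K n c a) := by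
  have hd : d + 2 ≤ n := by omega
  have ha : a + 2 ≤ n := by omega
  have hdb : d < b := by omega
  have hca : c < a := by omega
  let X : (dbl K n d b ⊞ dbl K n c a).obj vL :=
    inr _ _ vL (dblGenL hca ha K) + l⁻¹ • inl _ _ vL (dblGenL hdb hb K)
  have hX : ∀ w, res _ vL w X = inr _ _ w (res _ vL w (dblGenL hca ha K)) +
      l⁻¹ • inl _ _ w (res _ vL w (dblGenL hdb hb K)) := fun w => by
    change res _ vL w (_ + _ • _) = _
    rw [map_add, map_smul, res_inr, res_inl]
  obtain ⟨f, hfL, hfR⟩ := exists_dbl_hom hcd hd X (inr _ _ vR (dblGenR hca ha K))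
    (fun w hw => by
      rw [hX, res_inr, res_dblGen_eq hca ha (by omega), res_dblGenL_eq_zero hdb hb hw, map_zero,
        smul_zero, add_zero])
    (fun w hw => by
      rw [hX, res_dblGenL_eq_zero hca ha hw, res_dblGenL_eq_zero hdb hb (by omega), map_zero,
        map_zero, smul_zero, add_zero])
  refine Mat.realizes_of_finrank (dblMat_presents hab hb) (isFinDim_dbl _ _) (isFinDim_dbl _ _)
    (isFinDim_biprod (isFinDim_dbl _ _) (isFinDim_dbl _ _)) f
    (Bool.rec (inl _ _ vR (dblGenR hdb hb K)) (inl _ _ vL (dblGenL hdb hb K)))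
    (fun i => ?_) (fun {T} u hu hm => ?_) fun v => ?_
  · have hib : lab i.1 ≤ b := by rcases i.2 with h | h <;> omega
    refine (dblMat_eval hab hb _ _ i).trans ?_
    change res _ vL i.1 (inl _ _ vL _) - (if lab i.1 = b then res _ vR i.1 (inl _ _ vR _) else 0) =
      f.app i.1 (if lab i.1 = b then 0 else l • res _ vL i.1 (dblGenL hcd hd K) +
        -l • res _ vR i.1 (dblGenR hcd hd K))
    rw [res_inl, res_inl, ← res_dblGen_eq hdb hb hib]
    split_ifs with h
    · rw [sub_self, map_zero]
    · rw [sub_zero, map_add, map_smul, map_smul, app_res, app_res, hfL, hfR, hX, res_inr,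
        ← res_dblGen_eq hca ha (i.2.resolve_right h).le, smul_add, smul_smul, mul_inv_cancel₀ hl]
      module
  · have h1 : biprod.inl ≫ u = 0 := dbl_hom_ext hdb hb (hm true) (hm false)
    have h1' : ∀ v x, u.app v (inl _ _ v x) = 0 := fun v x =>
      congrArg (fun f => f.app v x) h1
    have h2 : u.app vL X = 0 := by
      rw [← hfL]
      exact congrArg (fun f => f.app vL (dblGenL hcd hd K)) hu
    have h3 : u.app vR (inr _ _ vR (dblGenR hca ha K)) = 0 := by
      rw [← hfR]
      exact congrArg (fun f => f.app vR (dblGenR hcd hd K)) hu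
    have h2' : u.app vL X = u.app vL (inr _ _ vL (dblGenL hca ha K)) := by
      change u.app vL (_ + _ • _) = _
      rw [map_add, map_smul, h1', smul_zero, add_zero]
    exact biprod.hom_ext' _ _ (h1.trans comp_zero.symm)
      ((dbl_hom_ext hca ha (h2'.symm.trans h2) h3 : biprod.inr ≫ u = 0).trans comp_zero.symm)
  · rw [finrank_biprod (isFinDim_dbl _ _) (isFinDim_dbl _ _), finrank_dbl hdb hb,
      finrank_dbl hca ha, finrank_dbl hcd hd, finrank_dbl hab hb]
    split_ifs <;> omega

theorem isNonsplitMiddleTerm_dbl_iff (h2 : (2 : K) ≠ 0) (Y : DRep K n) :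
    IsNonsplitMiddleTerm (dbl K n c d) Y (dbl K n a b) ↔
      Nonempty (Y ≅ (thin K d (vL : Vert n) ⊞ thin K a vR) ⊞ dbl K n c b) ∨
        Nonempty (Y ≅ (thin K d (vR : Vert n) ⊞ thin K a vL) ⊞ dbl K n c b) ∨
          Nonempty (Y ≅ dbl K n d b ⊞ dbl K n c a) ∨
            Nonempty (Y ≅ dbl K n d a ⊞ dbl K n c b) := by
  have hd : d + 2 ≤ n := by omega
  obtain ⟨ra, hra⟩ := exists_lab (n := n) (j := a) (by omega) (by omega)
  obtain ⟨rb, hrb⟩ := exists_lab (n := n) (j := b) (by omega) (by omega)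
  have hA : ∀ l m : K, dblClass hcd hda hab hb K l m ⟨ra, Or.inl hra⟩ =
      l • res _ vL ra (dblGenL hcd hd K) + m • res _ vR ra (dblGenR hcd hd K) :=
    fun l m => if_neg (show ¬ lab ra = b by omega)
  have hB : ∀ l m : K, dblClass hcd hda hab hb K l m ⟨rb, Or.inr hrb⟩ = 0 :=
    fun l m => if_pos hrb
  have hrow : ∀ i : RowTwo n a b, i = ⟨ra, Or.inl hra⟩ ∨ i = ⟨rb, Or.inr hrb⟩ := fun i =>
    i.2.imp (fun h => Subtype.ext (lab_injective (h.trans hra.symm)))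
      (fun h => Subtype.ext (lab_injective (h.trans hrb.symm)))
  have h0 : dblClass hcd hda hab hb K 0 0 = 0 := funext fun i => by
    rcases hrow i with rfl | rfl
    · rw [hA, zero_smul, zero_smul, add_zero]
      rfl
    · exact hB 0 0
  have hev := dblMat_eval hab hb (dbl K n c d)
  refine isNonsplitMiddleTerm_iff_of_pencil hda (by omega) (dblMat_presents hab hb) h2
    (dblClass hcd hda hab hb K) (fun l m h => ?_) (fun α => ?_) h0
    (fun l hl => realizes_dblClass_neg hcd hda hab hb hl)
    (fun Z l m p q hZ hlm => realizes_dblClass_of_isPencil hcd hda hab hb hZ hlm) Y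
  · obtain ⟨x, hx⟩ := h
    have hb' := (hev x ⟨rb, Or.inr hrb⟩).symm.trans
      ((congrFun hx ⟨rb, Or.inr hrb⟩).trans (hB l m))
    rw [if_pos hrb] at hb'
    obtain ⟨hL, hR⟩ := eq_zero_of_res_eq (r := rb) (by omega) (by omega) (sub_eq_zero.1 hb')
    have ha' := (hev x ⟨ra, Or.inl hra⟩).symm.trans
      ((congrFun hx ⟨ra, Or.inl hra⟩).trans (hA l m))
    rw [if_neg (show ¬ lab ra = b by omega), hL, map_zero, sub_zero] at ha'
    have h1 : res (dbl K n c d) vL ra (l • dblGenL hcd hd K) =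
        res (dbl K n c d) vR ra (-m • dblGenR hcd hd K) := by
      rw [map_smul, map_smul, neg_smul]
      exact eq_neg_of_add_eq_zero_left ha'.symm
    obtain ⟨h3, h5⟩ := eq_zero_of_res_eq (r := ra) (by omega) (by omega) h1
    have hgL : dblGenL hcd hd K ≠ 0 := fun h => res_dblGenL_ne_zero (K := K) hcd hd
      (reach_vL (w := ra) (by omega)) (by omega) (by rw [h, map_zero])
    have hgR : dblGenR hcd hd K ≠ 0 := fun h => res_dblGenR_ne_zero (K := K) hcd hd
      (reach_vR (w := ra) (by omega)) (by omega) (by rw [h, map_zero])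
    exact ⟨(smul_eq_zero.1 h3).resolve_right hgL,
      neg_eq_zero.1 ((smul_eq_zero.1 h5).resolve_right hgR)⟩
  · obtain ⟨A, B, hAB⟩ : ∃ A B : K, α ⟨rb, Or.inr hrb⟩ =
      A • res _ vL rb (dblGenL hcd hd K) + B • res _ vR rb (dblGenR hcd hd K) :=
        ⟨_, _, dbl_eq_add hcd hd rb _⟩
    -- At b the two source spaces of N together span, so changing the lifts clears the value at b;
    -- the remaining value at a supplies l and m.
    let x : ∀ k, (dbl K n c d).obj (source n k) :=
      Bool.rec (-B • dblGenR hcd hd K) (A • dblGenL hcd hd K)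
    have hx : (dblMat K n a b hab hb).eval (dbl K n c d) x ⟨rb, Or.inr hrb⟩ =
        α ⟨rb, Or.inr hrb⟩ := by
      rw [hev, if_pos hrb, hAB]
      change res _ vL rb (A • dblGenL hcd hd K) - res _ vR rb (-B • dblGenR hcd hd K) = _
      rw [map_smul, map_smul, neg_smul, sub_neg_eq_add]
    obtain ⟨l, m, hlm⟩ : ∃ l m : K, α ⟨ra, Or.inl hra⟩ -
      (dblMat K n a b hab hb).eval (dbl K n c d) x ⟨ra, Or.inl hra⟩ =
        l • res _ vL ra (dblGenL hcd hd K) + m • res _ vR ra (dblGenR hcd hd K) :=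
        ⟨_, _, dbl_eq_add hcd hd ra _⟩
    refine ⟨l, m, x, funext fun i => ?_⟩
    rw [Pi.add_apply]
    rcases hrow i with rfl | rfl
    · rw [hA, ← hlm, sub_add_cancel]
    · rw [hB, hx, zero_add]

end Dbl

/-! ### Transport along isomorphisms and parity -/

omit h4 in
lemma IsNonsplitMiddleTerm.of_iso {M M' Y N N' : DRep K n} (h : IsNonsplitMiddleTerm M Y N)
    (e : M ≅ M') (e' : N ≅ N') : IsNonsplitMiddleTerm M' Y N' := by
  obtain ⟨f, g, w, hS, hs⟩ := h
  have w' : (e.inv ≫ f) ≫ g ≫ e'.hom = 0 := by simp [reassoc_of% w]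
  let i : ShortComplex.mk f g w ≅ ShortComplex.mk (e.inv ≫ f) (g ≫ e'.hom) w' :=
    ShortComplex.isoMk e (Iso.refl _) e' (by simp) (by simp)
  exact ⟨_, _, w', ShortComplex.shortExact_of_iso i hS, ⟨fun s => hs.elim (s.ofIso i.symm)⟩⟩

omit h4 in
lemma isNonsplitMiddleTerm_congr {M M' N N' : DRep K n} (e : M ≅ M') (e' : N ≅ N')
    (Y : DRep K n) : IsNonsplitMiddleTerm M Y N ↔ IsNonsplitMiddleTerm M' Y N' :=
  ⟨fun h => h.of_iso e e', fun h => h.of_iso e.symm e'.symm⟩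

omit h4 in
lemma nonempty_iso_congr {Y X X' : DRep K n} (e : X ≅ X') :
    Nonempty (Y ≅ X) ↔ Nonempty (Y ≅ X') :=
  ⟨fun ⟨i⟩ => ⟨i ≪≫ e⟩, fun ⟨i⟩ => ⟨i ≪≫ e.symm⟩⟩

/-- The two summands always come from opposite sources. Since τ exchanges the sources, the parity of
r decides whether their second coordinates agree, and odd k only interchanges the two alternatives.
-/
lemma exists_summands {k r : ℕ} (h : k + r + 2 ≤ n) (W : DRep K n) :
    ∃ A₁ A₂ B₁ B₂ : DRep K n, AtPosition k (n - 1) A₁ ∧ AtPosition k n A₂ ∧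
      AtPosition (k + r) (n - 1) B₁ ∧ AtPosition (k + r) n B₂ ∧ ∀ Y : DRep K n,
        ((Nonempty (Y ≅ A₁ ⊞ (if Odd r then B₁ else B₂) ⊞ W) ∨
          Nonempty (Y ≅ A₂ ⊞ (if Odd r then B₂ else B₁) ⊞ W)) ↔
        (Nonempty (Y ≅ (thin K k (vL : Vert n) ⊞ thin K (k + r) vR) ⊞ W) ∨
          Nonempty (Y ≅ (thin K k (vR : Vert n) ⊞ thin K (k + r) vL) ⊞ W))) := by
  obtain ⟨h1, h2⟩ := atPosition_thin_source (K := K) (n := n) k (by omega)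
  obtain ⟨h3, h5⟩ := atPosition_thin_source (K := K) (n := n) (k + r) (by omega)
  have e1 := fun Y : DRep K n => nonempty_iso_congr (Y := Y)
    (biprod.associator (thin K k (vL : Vert n)) (thin K (k + r) vR) W)
  have e2 := fun Y : DRep K n => nonempty_iso_congr (Y := Y)
    (biprod.associator (thin K k (vR : Vert n)) (thin K (k + r) vL) W)
  rcases Nat.even_or_odd k with hk | hk <;> rcases Nat.even_or_odd r with hr | hr
  · rw [if_pos hk] at h1 h2
    rw [if_pos (hk.add hr)] at h3 h5
    refine ⟨_, _, _, _, h1, h2, h3, h5, fun Y => ?_⟩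
    rw [if_neg (Nat.not_odd_iff_even.2 hr), if_neg (Nat.not_odd_iff_even.2 hr), e1, e2]
  · rw [if_pos hk] at h1 h2
    rw [if_neg (Nat.not_even_iff_odd.2 (hk.add_odd hr))] at h3 h5
    refine ⟨_, _, _, _, h1, h2, h5, h3, fun Y => ?_⟩
    rw [if_pos hr, if_pos hr, e1, e2]
  · rw [if_neg (Nat.not_even_iff_odd.2 hk)] at h1 h2
    rw [if_neg (Nat.not_even_iff_odd.2 (hk.add_even hr))] at h3 h5
    refine ⟨_, _, _, _, h2, h1, h5, h3, fun Y => ?_⟩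
    rw [if_neg (Nat.not_odd_iff_even.2 hr), if_neg (Nat.not_odd_iff_even.2 hr), e1, e2, or_comm]
  · rw [if_neg (Nat.not_even_iff_odd.2 hk)] at h1 h2
    rw [if_pos (hk.add_odd hr)] at h3 h5
    refine ⟨_, _, _, _, h2, h1, h3, h5, fun Y => ?_⟩
    rw [if_pos hr, if_pos hr, e1, e2, or_comm]

end DRep

/-! ### Assembling the theorem -/

theorem lemma2p2 {K : Type u} [Field K] [IsAlgClosed K] (hchar : ringChar K ≠ 2)
    (n : ℕ) (hn : 4 ≤ n) (Mi Mβ : DRep K n)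
    (hMi : DRep.IsFinDim Mi) (hMβ : DRep.IsFinDim Mβ)
    (hi : Indecomposable Mi) (hβ : Indecomposable Mβ)
    (hext : Module.finrank K (Abelian.Ext Mβ Mi 1) = 2) :
    -- the relative position of the two modules in the Auslander-Reiten quiver
    ∃ k i r s : ℕ, 1 ≤ r ∧ r < s ∧ s ≤ i ∧ i ≤ n - 2 ∧ k + s ≤ n - 2 ∧
      DRep.AtPosition k i Mi ∧ DRep.AtPosition (k + s) (n - 1 - (s - r)) Mβ ∧
      -- the modules occurring in the middle terms, and their positions
      ∃ A₁ A₂ B₁ B₂ X X₁ X₂ X₃ : DRep K n,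
        DRep.AtPosition k (n - 1) A₁ ∧ DRep.AtPosition k n A₂ ∧
        DRep.AtPosition (k + r) (n - 1) B₁ ∧ DRep.AtPosition (k + r) n B₂ ∧
        DRep.AtPosition (k + r) (n - 1 - r) X ∧
        DRep.AtPosition (k + s) (n - 1 - s) X₁ ∧
        DRep.AtPosition (k + r) (i - r) X₂ ∧
        (s < i → DRep.AtPosition (k + s) (i - s) X₃) ∧ (s = i → IsZero X₃) ∧
        -- the middle terms
        ∀ Y : DRep K n, DRep.IsNonsplitMiddleTerm Mi Y Mβ ↔
          (Nonempty (Y ≅ A₁ ⊞ (if Odd r then B₁ else B₂) ⊞ X₃) ∨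
            Nonempty (Y ≅ A₂ ⊞ (if Odd r then B₂ else B₁) ⊞ X₃) ∨
            Nonempty (Y ≅ X₁ ⊞ X₂) ∨
            Nonempty (Y ≅ X ⊞ X₃)) := by
  have h4 : Fact (4 ≤ n) := ⟨hn⟩
  have h2 : (2 : K) ≠ 0 := Ring.two_ne_zero hchar
  obtain ⟨a, b, hab, hb, ⟨eC⟩, ⟨c, t, hca, hbt, ht, ⟨eN⟩⟩ | ⟨c, d, hcd, hda, ⟨eN⟩⟩⟩ :=
    DRep.exists_iso_of_finrank_ext hβ hi hext
  -- For a thin left end k = c, and r, s, i are the distances from c to a, b and the label of t. X₃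
  -- is P(t)/P(b), zero exactly when b is the label of t.
  · obtain ⟨r, rfl⟩ : ∃ r, a = c + r := ⟨a - c, by omega⟩
    obtain ⟨s, rfl⟩ : ∃ s, b = c + s := ⟨b - c, by omega⟩
    obtain ⟨i, hi⟩ : ∃ i, DRep.lab t = c + i := ⟨DRep.lab t - c, by omega⟩
    have pN := DRep.atPosition_thin (K := K) (a := c) (t := t) (by omega) ht
    have pC := DRep.atPosition_dbl (K := K) (n := n) hab hb
    have pX := DRep.atPosition_dbl (K := K) (n := n) hca (by omega)
    have pX₁ := DRep.atPosition_dbl (K := K) (n := n) (show c < c + s by omega) hb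
    have pX₂ := DRep.atPosition_thin (K := K) (a := c + r) (t := t) (by omega) ht
    rw [show DRep.lab t - c = i by omega] at pN
    rw [show n - 1 - (c + s - (c + r)) = n - 1 - (s - r) by omega] at pC
    rw [show n - 1 - (c + r - c) = n - 1 - r by omega] at pX
    rw [show n - 1 - (c + s - c) = n - 1 - s by omega] at pX₁
    rw [show DRep.lab t - (c + r) = i - r by omega] at pX₂
    obtain ⟨A₁, A₂, B₁, B₂, hA₁, hA₂, hB₁, hB₂, hY⟩ := DRep.exists_summands (K := K)
      (show c + r + 2 ≤ n by omega) (DRep.thin K (c + s) t)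
    refine ⟨c, i, r, s, by omega, by omega, by omega, by omega, by omega, pN.of_iso eN.symm,
      pC.of_iso eC.symm, A₁, A₂, B₁, B₂, _, _, _, DRep.thin K (c + s) t, hA₁, hA₂, hB₁, hB₂, pX,
      pX₁, pX₂, fun h => ?_, fun h => DRep.isZero_thin (by omega), fun Y => ?_⟩
    · have := DRep.atPosition_thin (K := K) (a := c + s) (t := t) (by omega) ht
      rwa [show DRep.lab t - (c + s) = i - s by omega] at this
    · rw [DRep.isNonsplitMiddleTerm_congr eN eC,
        DRep.isNonsplitMiddleTerm_thin_iff hca hab hbt ht h2, ← or_assoc, ← hY, or_assoc]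
  -- For a two-generated left end the first coordinate is d, so r and s are measured from d. Here i
  -- - s = n-1-(b-c) is positive, so s = i cannot occur.
  · obtain ⟨r, rfl⟩ : ∃ r, a = d + r := ⟨a - d, by omega⟩
    obtain ⟨s, rfl⟩ : ∃ s, b = d + s := ⟨b - d, by omega⟩
    obtain ⟨i, hi⟩ : ∃ i, n - 1 - (d - c) = i := ⟨_, rfl⟩
    have pN := DRep.atPosition_dbl (K := K) (n := n) hcd (by omega)
    have pC := DRep.atPosition_dbl (K := K) (n := n) hab hb
    have pX := DRep.atPosition_dbl (K := K) (n := n) hda (by omega)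
    have pX₁ := DRep.atPosition_dbl (K := K) (n := n) (show d < d + s by omega) hb
    have pX₂ := DRep.atPosition_dbl (K := K) (n := n) (show c < d + r by omega) (by omega)
    have pX₃ := DRep.atPosition_dbl (K := K) (n := n) (show c < d + s by omega) hb
    rw [hi] at pN
    rw [show n - 1 - (d + s - (d + r)) = n - 1 - (s - r) by omega] at pC
    rw [show n - 1 - (d + r - d) = n - 1 - r by omega] at pX
    rw [show n - 1 - (d + s - d) = n - 1 - s by omega] at pX₁
    rw [show n - 1 - (d + r - c) = i - r by omega] at pX₂
    rw [show n - 1 - (d + s - c) = i - s by omega] at pX₃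
    obtain ⟨A₁, A₂, B₁, B₂, hA₁, hA₂, hB₁, hB₂, hY⟩ := DRep.exists_summands (K := K)
      (show d + r + 2 ≤ n by omega) (DRep.dbl K n c (d + s))
    refine ⟨d, i, r, s, by omega, by omega, by omega, by omega, by omega, pN.of_iso eN.symm,
      pC.of_iso eC.symm, A₁, A₂, B₁, B₂, _, _, _, _, hA₁, hA₂, hB₁, hB₂, pX,
      pX₁, pX₂, fun _ => pX₃, fun h => by omega, fun Y => ?_⟩
    rw [DRep.isNonsplitMiddleTerm_congr eN eC,
      DRep.isNonsplitMiddleTerm_dbl_iff hcd hda hab hb h2, ← or_assoc, ← hY, or_assoc]
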